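/- **Setting.** An *implicit set system* $\Phi$ maps every string $I\in\{0,1\}^*$ to a finite set $U_I$ (whose elements are named by binary strings) and a family $\mathcal F_I\subseteq 2^{U_I}$. It is *monotone* if for every $I$ we have $U_I\in\mathcal F_I$, and $S\in\mathcal F_I$, $S\subseteq T\subseteq U_I$ imply $T\in\mathcal F_I$. It is *polynomial-time computable* if there are deterministic polynomial-time algorithms that compute $U_I$ from $I$, and that decide, given $I$ and $S\subseteq U_I$, whether $S\in\mathcal F_I$. Algorithms are programs over binary trees with unit-cost tree operations (equivalent, up to factors logarithmic in the running time, to random access machines); randomized algorithms also flip fair coins, and their time bounds hold for all outcomes of the coins. $O^*(\cdot)$ hides a factor polynomial in the size of the input. For $\alpha\ge 1$, a *randomized $(\alpha,\Phi)$-extension algorithm* gets $I\in\{0,1\}^*$, $X\subseteq U_I$ and $k\in\mathbb N$, returns a set $Y\subseteq U_I$, and there is a constant $\varepsilon>0$ such that on every input, with probability at least $\varepsilon$, the following holds: if there is a set $S\subseteq U_I$ with $S\cup X\in\mathcal F_I$ and $|S|\le k$, then $Y\cup X\in\mathcal F_I$ and $|Y|\le\alpha k$. A *randomized $\alpha$-approximation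 algorithm for $\Phi$-Minimum Subset* gets $I$, returns a set $S\in\mathcal F_I$, and there is a constant $\varepsilon>0$ such that for every $I$, with probability at least $\varepsilon$, $|S|\le\alpha\cdot|\mathrm{OPT}|$, where $\mathrm{OPT}$ is a set of minimum cardinality in $\mathcal F_I$. **Theorem.** Let $\Phi$ be a monotone, polynomial-time computable implicit set system, and let $\alpha\ge1$ and $c>1$ be real numbers that can be approximated to within $1/m$ in time polynomial in $m$ (for example, rational or algebraic numbers). Suppose that there is a randomized $(\alpha,\Phi)$-extension algorithm that runs in time $O^*(c^k)$. Then there is exactly one $\gamma\in\left(1,1+\frac{c-1}{\alpha}\right)$ such that $$D\!\left(\tfrac1\alpha\,\Big\|\,\tfrac{\gamma-1}{c-1}\right)=\frac{\ln c}{\alpha},\qquad\text{where } D(a\|b)=a\ln\frac ab+(1-a)\ln\frac{1-a}{1-b}\ \ (0\ln 0=0),$$ and for this $\gamma=\mathrm{amls}(\alpha,c)$ there is a randomized $\alpha$-approximation algorithm for $\Phi$-Minimum Subset that runs in time $O^*(\gamma^n)$, where $n=|U_I|$. -/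

import Mathlib

open scoped ENNReal

/-! ### Model of computation

Programs work on binary trees (the data type of Lisp), with unit-cost tree operations and fair
coins.  Up to logarithmic factors in the number of steps this is the (probabilistic) random access
machine. -/

/-- Binary trees with a single atom `nil`. -/
inductive Data : Type
  | nil : Data
  | cons : Data → Data → Data

namespace Data

/-- The left component, `nil` for the atom. -/
def hd : Data → Data
  | nil => nil
  | cons a _ => a

/-- The right component, `nil` for the atom. -/
def tl : Data → Data
  | nil => nil
  | cons _ b => b

/-- The number of nodes. -/
def size : Data → ℕ
  | nil => 1
  | cons a b => a.size + b.size + 1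

/-- `nil` stands for "false". -/
def ofBool : Bool → Data
  | false => nil
  | true => cons nil nil

/-- Lists in the style of Lisp. -/
def ofList {β : Type} (f : β → Data) : List β → Data
  | [] => nil
  | b :: l => cons (f b) (ofList f l)

/-- Natural numbers in unary. -/
def ofNat : ℕ → Data
  | 0 => nil
  | n + 1 => cons nil (ofNat n)

/-- Binary strings. -/
def ofString : List Bool → Data := ofList ofBool

/-- `d` lists the elements of the finite set `S` of strings, in some order, each exactly once. -/
def IsCode (d : Data) (S : Finset (List Bool)) : Prop :=
  ∃ l : List (List Bool), l.Nodup ∧ l.toFinset = S ∧ d = ofList ofString l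

end Data

/-- Programs; each one transforms one tree into another. -/
inductive Prog : Type
  /-- return the input -/
  | id : Prog
  /-- return `nil` -/
  | nil : Prog
  /-- left component -/
  | hd : Prog
  /-- right component -/
  | tl : Prog
  /-- a fair random bit -/
  | coin : Prog
  /-- run both programs on the input and pair the results -/
  | cons : Prog → Prog → Prog
  /-- run the first program, then the second one on its result -/
  | seq : Prog → Prog → Prog
  /-- `cond b p q`: run `b` on the input; then, on the same input, run `p` if the result is not
  `nil`, and `q` if it is `nil` -/
  | cond : Prog → Prog → Prog → Prog
  /-- `loop b p`: as long as `b` applied to the current value is not `nil`, apply `p` to it -/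
  | loop : Prog → Prog → Prog

namespace Prog

/-- Deterministic programs, those that never flip a coin. -/
def CoinFree : Prog → Prop
  | id => True
  | nil => True
  | hd => True
  | tl => True
  | coin => False
  | cons p q => CoinFree p ∧ CoinFree q
  | seq p q => CoinFree p ∧ CoinFree q
  | cond b p q => CoinFree b ∧ CoinFree p ∧ CoinFree q
  | loop b p => CoinFree b ∧ CoinFree p

/-- `Eval p x μ`: on input `x` the program `p` halts whatever the outcomes of its coins, and `μ` is
the joint distribution of its output and of the number of steps that it makes. -/
inductive Eval : Prog → Data → PMF (Data × ℕ) → Prop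
  | id (x : Data) : Eval id x (PMF.pure (x, 1))
  | nil (x : Data) : Eval nil x (PMF.pure (Data.nil, 1))
  | hd (x : Data) : Eval hd x (PMF.pure (x.hd, 1))
  | tl (x : Data) : Eval tl x (PMF.pure (x.tl, 1))
  | coin (x : Data) :
      Eval coin x ((PMF.uniformOfFintype Bool).map fun b => (Data.ofBool b, 1))
  | cons {p q : Prog} {x : Data} {μ ν : PMF (Data × ℕ)} :
      Eval p x μ → Eval q x ν →
      Eval (cons p q) x
        (μ.bind fun o => ν.map fun r => (Data.cons o.1 r.1, o.2 + r.2 + 1))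
  | seq {p q : Prog} {x : Data} {μ : PMF (Data × ℕ)} {ν : Data × ℕ → PMF (Data × ℕ)} :
      Eval p x μ → (∀ o ∈ μ.support, Eval q o.1 (ν o)) →
      Eval (seq p q) x (μ.bind fun o => (ν o).map fun r => (r.1, o.2 + r.2 + 1))
  | cond {b p q : Prog} {x : Data} {μ : PMF (Data × ℕ)} {ν : Data × ℕ → PMF (Data × ℕ)} :
      Eval b x μ →
      (∀ o ∈ μ.support, o.1 ≠ Data.nil → Eval p x (ν o)) →
      (∀ o ∈ μ.support, o.1 = Data.nil → Eval q x (ν o)) →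
      Eval (cond b p q) x (μ.bind fun o => (ν o).map fun r => (r.1, o.2 + r.2 + 1))
  | loop {b p : Prog} {x : Data} {μ : PMF (Data × ℕ)} :
      Eval (Prog.cond b (Prog.seq p (Prog.loop b p)) Prog.id) x μ → Eval (loop b p) x μ

/-- On input `x` the program `p` makes at most `T` steps, whatever its coins show, and `μ` is the
joint distribution of its output and of the number of its steps. -/
def RunsWithin (p : Prog) (x : Data) (T : ℝ) (μ : PMF (Data × ℕ)) : Prop :=
  Eval p x μ ∧ ∀ o ∈ μ.support, (o.2 : ℝ) ≤ T

/-- On input `x` the program `p` returns `y` in at most `T` steps, whatever its coins show. -/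
def ReturnsWithin (p : Prog) (x : Data) (T : ℕ) (y : Data) : Prop :=
  ∃ s ≤ T, Eval p x (PMF.pure (y, s))

end Prog

/-- `x` can be approximated to within `1 / m` (by a fraction with denominator `m`) in time
polynomial in `m`. All rational and all algebraic numbers and, more generally, all real numbers
whose first `m` binary digits can be computed in time `2 ^ O(m)` have this property. -/
def PolyApproximable (x : ℝ) : Prop :=
  ∃ (p : Prog) (P : Polynomial ℕ), p.CoinFree ∧
    ∀ m : ℕ, ∃ a : ℕ, |m * x - a| ≤ 1 ∧
      p.ReturnsWithin (Data.ofNat m) (P.eval m) (Data.ofNat a)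

/-! ### Implicit set systems -/

/-- A function that maps every string `I` to a finite set `U I` of elements, named by strings, and
to a family `F I` of subsets of `U I`. -/
structure ImplicitSetSystem where
  U : List Bool → Finset (List Bool)
  F : List Bool → Set (Finset (List Bool))
  subset_U : ∀ I, ∀ S ∈ F I, S ⊆ U I

namespace ImplicitSetSystem

/-- Every family contains the universe and is closed under supersets. -/
def Monotone (Φ : ImplicitSetSystem) : Prop :=
  ∀ I, Φ.U I ∈ Φ.F I ∧ ∀ S T, S ⊆ T → T ⊆ Φ.U I → S ∈ Φ.F I → T ∈ Φ.F I

/-- The universe can be computed, and membership in the family be decided, in polynomial time. -/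
def PolyTimeComputable (Φ : ImplicitSetSystem) : Prop :=
  (∃ (p : Prog) (P : Polynomial ℕ), p.CoinFree ∧
    ∀ I : List Bool, ∃ y : Data, y.IsCode (Φ.U I) ∧
      p.ReturnsWithin (Data.ofString I) (P.eval (Data.ofString I).size) y) ∧
  (∃ (p : Prog) (P : Polynomial ℕ), p.CoinFree ∧
    ∀ (I : List Bool) (S : Finset (List Bool)) (d : Data), S ⊆ Φ.U I → d.IsCode S →
      ∃ y : Data, (y ≠ Data.nil ↔ S ∈ Φ.F I) ∧
        p.ReturnsWithin (Data.cons (Data.ofString I) d)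
          (P.eval (Data.cons (Data.ofString I) d).size) y)

/-- The input `(I, X, k)` of an extension algorithm, where `d` is a code of `X`. -/
def extensionInput (I : List Bool) (d : Data) (k : ℕ) : Data :=
  Data.cons (Data.ofString I) (Data.cons d (Data.ofNat k))

/-- `Y` is an admissible answer to the extension problem `(I, X, k)`. -/
def IsExtension (Φ : ImplicitSetSystem) (α : ℝ) (I : List Bool) (X : Finset (List Bool)) (k : ℕ)
    (Y : Finset (List Bool)) : Prop :=
  (∃ S ⊆ Φ.U I, S ∪ X ∈ Φ.F I ∧ S.card ≤ k) → Y ∪ X ∈ Φ.F I ∧ (Y.card : ℝ) ≤ α * k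

/-- There is a parameterized randomized `α`-approximate `Φ`-extension algorithm that runs in time
`O*(c ^ k)`, that is, `c ^ k` times a polynomial in the size of the input. -/
def HasRandomizedExtensionAlgorithm (Φ : ImplicitSetSystem) (α c : ℝ) : Prop :=
  ∃ (p : Prog) (P : Polynomial ℕ) (ε : ℝ≥0∞), 0 < ε ∧
    ∀ (I : List Bool) (X : Finset (List Bool)) (d : Data) (k : ℕ), X ⊆ Φ.U I → d.IsCode X →
      ∃ μ : PMF (Data × ℕ),
        p.RunsWithin (extensionInput I d k) (P.eval (extensionInput I d k).size * c ^ k) μ ∧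
        (∀ o ∈ μ.support, ∃ Y ⊆ Φ.U I, o.1.IsCode Y) ∧
        ε ≤ μ.toOuterMeasure {o | ∃ Y, o.1.IsCode Y ∧ Φ.IsExtension α I X k Y}

/-- `S` is a solution of `I` of minimum cardinality. -/
def IsOptimal (Φ : ImplicitSetSystem) (I : List Bool) (S : Finset (List Bool)) : Prop :=
  S ∈ Φ.F I ∧ ∀ T ∈ Φ.F I, S.card ≤ T.card

/-- There is a randomized `α`-approximation algorithm for `Φ`-Minimum Subset that runs in time
`O*(γ ^ n)`, that is, `γ ^ n` times a polynomial in the size of the input, `n` being the size of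
the universe.  It always returns a solution, and with constant probability one whose cardinality is
at most `α` times the minimum. -/
def HasRandomizedApproximationAlgorithm (Φ : ImplicitSetSystem) (α γ : ℝ) : Prop :=
  ∃ (p : Prog) (P : Polynomial ℕ) (ε : ℝ≥0∞), 0 < ε ∧
    ∀ I : List Bool, ∃ μ : PMF (Data × ℕ),
      p.RunsWithin (Data.ofString I)
        (P.eval (Data.ofString I).size * γ ^ (Φ.U I).card) μ ∧
      (∀ o ∈ μ.support, ∃ S ∈ Φ.F I, o.1.IsCode S) ∧
      ε ≤ μ.toOuterMeasure {o | ∃ S ∈ Φ.F I, o.1.IsCode S ∧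
        ∀ OPT, Φ.IsOptimal I OPT → (S.card : ℝ) ≤ α * OPT.card}

end ImplicitSetSystem

/-! ### The base of the running time -/

/-- The Kullback-Leibler divergence of two Bernoulli distributions. -/
noncomputable def bernoulliKL (a b : ℝ) : ℝ :=
  a * Real.log (a / b) + (1 - a) * Real.log ((1 - a) / (1 - b))

/-- The property that defines `γ = amls(α, c)`. -/
def IsAmls (α c γ : ℝ) : Prop :=
  γ ∈ Set.Ioo 1 (1 + (c - 1) / α) ∧ bernoulliKL (1 / α) ((γ - 1) / (c - 1)) = Real.log c / α

/-! ### Running programs -/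

/-! The algorithm is approximate monotone local search. Let O be a minimum solution, k = |O| and n =
|U|. Suppose a random set X of t elements contains exactly i elements of O, where t ≤ α i. By
monotonicity O \ X solves the extension problem for X with k - i elements, so the given algorithm,
called with parameter k - i, returns with constant probability a set Y such that X ∪ Y is a solution
and |X ∪ Y| ≤ t + α (k - i) ≤ α k (`trial_hit`). A call costs about c^(k-i), and X is as desired
with probability C(k,i) C(n-k,t-i) / C(n,t). If α k > n, every solution is good enough. Otherwise i
and t are needed with c^(k-i) C(n,t) ≤ poly(n) γ^n C(k,i) C(n-k,t-i).

That is `exists_good_sizes`. Put δ = (γ-1)/(c-1), so that γ = cδ + (1-δ). Double counting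
(`choose_exchange`) gives C(n,t) C(t,i) C(n-t,k-i) = C(n,k) C(k,i) C(n-k,t-i); multiply by (cδ)^k
(1-δ)^(n-k). On the right, C(n,k) (cδ)^k (1-δ)^(n-k) is one term in the expansion of γ^n. On the
left, c^(k-i) C(n,t) is multiplied by C(t,i) (cδ)^i (1-δ)^(t-i) and by the binomial probability
C(n-t,k-i) δ^(k-i) (1-δ)^(n-t-(k-i)). The latter is at least an inverse polynomial if k - i ≈ δ (n -
t). The former is so if t ≈ α i: the equation D(1/α‖δ) = ln c / α says that a binomial variable with
parameters t, δ takes the value t/α with probability about c^(-i). The two conditions determine i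
and t. If k ≤ δ n, the choice i = t = 0 and Bernoulli's inequality suffice.

The algorithm knows none of k, i, t. The size t need not be guessed: elements enter X independently
with a common bias that is itself uniformly random, and this makes all sizes almost equally likely
(`randomSample_lower`). For k - i all values j ≤ n are tried, each with about V / c^j trials, where
V is γ^n times a polynomial. Every phase then costs V up to polynomial factors.

It remains to compute V and the powers of c. An error O(1/n) in a base changes the n-th power by a
constant factor only (`pow_le_exp_mul_pow`), so unary arithmetic with denominators polynomial in n
is precise enough. The number δ is found from Riemann sums for the logarithms in its defining
equation (`rootCount_approx`, `baseNum_approx`). Programs are never written out in full: they are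
assembled by the combinators for `Comp`, `DetComp` and `PolyTime`. -/

theorem PMF.bind_congr_of_support {α β : Type*} (p : PMF α) {f g : α → PMF β}
    (h : ∀ a ∈ p.support, f a = g a) : p.bind f = p.bind g := by
  ext b
  simp only [PMF.bind_apply]
  refine tsum_congr fun a => ?_
  by_cases ha : a ∈ p.support
  · rw [h a ha]
  · rw [PMF.mem_support_iff, not_not] at ha
    simp [ha]

namespace Prog

/-- On input `x` the program `p` makes at most `T` steps, and its output has distribution `ν`. -/
def Runs (p : Prog) (x : Data) (T : ℝ) (ν : PMF Data) : Prop :=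
  ∃ μ, p.RunsWithin x T μ ∧ μ.map Prod.fst = ν

theorem Runs.mono {p : Prog} {x : Data} {T T' : ℝ} {ν : PMF Data} (h : p.Runs x T ν)
    (hT : T ≤ T') : p.Runs x T' ν := by
  obtain ⟨μ, ⟨h1, h2⟩, h3⟩ := h
  exact ⟨μ, ⟨h1, fun o ho => (h2 o ho).trans hT⟩, h3⟩

theorem ReturnsWithin.runs {p : Prog} {x y : Data} {T : ℕ} (h : p.ReturnsWithin x T y) :
    p.Runs x T (PMF.pure y) := by
  obtain ⟨s, hs, h⟩ := h
  refine ⟨_, ⟨h, ?_⟩, by rw [PMF.pure_map]⟩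
  intro o ho
  simp only [PMF.support_pure, Set.mem_singleton_iff] at ho
  subst ho
  exact_mod_cast hs

theorem runs_id (x : Data) : id.Runs x 1 (PMF.pure x) :=
  ReturnsWithin.runs (T := 1) ⟨1, le_rfl, .id x⟩ |>.mono (by simp)

theorem runs_nil (x : Data) : nil.Runs x 1 (PMF.pure Data.nil) :=
  ReturnsWithin.runs (T := 1) ⟨1, le_rfl, .nil x⟩ |>.mono (by simp)

theorem runs_hd (x : Data) : hd.Runs x 1 (PMF.pure x.hd) :=
  ReturnsWithin.runs (T := 1) ⟨1, le_rfl, .hd x⟩ |>.mono (by simp)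

theorem runs_tl (x : Data) : tl.Runs x 1 (PMF.pure x.tl) :=
  ReturnsWithin.runs (T := 1) ⟨1, le_rfl, .tl x⟩ |>.mono (by simp)

theorem runs_coin (x : Data) :
    coin.Runs x 1 ((PMF.uniformOfFintype Bool).map Data.ofBool) := by
  refine ⟨_, ⟨.coin x, ?_⟩, by rw [PMF.map_comp]; rfl⟩
  intro o ho
  rw [PMF.mem_support_map_iff] at ho
  obtain ⟨b, -, rfl⟩ := ho
  simp

theorem Runs.cons {p q : Prog} {x : Data} {T₁ T₂ : ℝ} {ν₁ ν₂ : PMF Data}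
    (h₁ : p.Runs x T₁ ν₁) (h₂ : q.Runs x T₂ ν₂) :
    (cons p q).Runs x (T₁ + T₂ + 1) (ν₁.bind fun a => ν₂.map (Data.cons a)) := by
  obtain ⟨μ₁, ⟨e₁, t₁⟩, rfl⟩ := h₁
  obtain ⟨μ₂, ⟨e₂, t₂⟩, rfl⟩ := h₂
  refine ⟨_, ⟨.cons e₁ e₂, ?_⟩, ?_⟩
  · intro o ho
    simp only [PMF.mem_support_bind_iff, PMF.mem_support_map_iff] at ho
    obtain ⟨a, ha, b, hb, rfl⟩ := ho
    have := t₁ a ha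
    have := t₂ b hb
    push_cast
    linarith
  · simp only [PMF.map_bind, PMF.map_comp, PMF.bind_map]
    rfl

theorem Runs.seq {p q : Prog} {x : Data} {T₁ T₂ : ℝ} {ν : PMF Data} {κ : Data → PMF Data}
    (h₁ : p.Runs x T₁ ν) (h₂ : ∀ y ∈ ν.support, q.Runs y T₂ (κ y)) :
    (seq p q).Runs x (T₁ + T₂ + 1) (ν.bind κ) := by
  obtain ⟨μ, ⟨e₁, t₁⟩, rfl⟩ := h₁
  -- Choice needs a distribution for every tree; outside the support an arbitrary point mass is
  -- used.
  have h₂' : ∀ y : Data, ∃ μ', y ∈ (μ.map Prod.fst).support →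
      q.RunsWithin y T₂ μ' ∧ μ'.map Prod.fst = κ y := by
    intro y
    by_cases hy : y ∈ (μ.map Prod.fst).support
    · obtain ⟨μ', h⟩ := h₂ y hy
      exact ⟨μ', fun _ => h⟩
    · exact ⟨PMF.pure (y, 0), fun h => absurd h hy⟩
  choose μ' hμ' using h₂'
  have hs : ∀ o ∈ μ.support, o.1 ∈ (μ.map Prod.fst).support := fun o ho =>
    (PMF.mem_support_map_iff _ _ _).2 ⟨o, ho, rfl⟩
  refine ⟨_, ⟨.seq (ν := fun o => μ' o.1) e₁ fun o ho => (hμ' o.1 (hs o ho)).1.1, ?_⟩, ?_⟩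
  · intro o ho
    simp only [PMF.mem_support_bind_iff, PMF.mem_support_map_iff] at ho
    obtain ⟨a, ha, b, hb, rfl⟩ := ho
    have := t₁ a ha
    have := (hμ' a.1 (hs a ha)).1.2 b hb
    push_cast
    linarith
  · simp only [PMF.map_bind, PMF.map_comp, PMF.bind_map]
    refine PMF.bind_congr_of_support _ fun o ho => ?_
    rw [Function.comp_apply, ← (hμ' o.1 (hs o ho)).2]
    rfl

theorem Runs.cond {b p q : Prog} {x : Data} {T₁ T₂ : ℝ} {ν : PMF Data} {κ : Data → PMF Data}
    (h₁ : b.Runs x T₁ ν) (hp : ∀ y ∈ ν.support, y ≠ Data.nil → p.Runs x T₂ (κ y))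
    (hq : ∀ y ∈ ν.support, y = Data.nil → q.Runs x T₂ (κ y)) :
    (cond b p q).Runs x (T₁ + T₂ + 1) (ν.bind κ) := by
  obtain ⟨μ, ⟨e₁, t₁⟩, rfl⟩ := h₁
  have h₂' : ∀ y : Data, ∃ μ', y ∈ (μ.map Prod.fst).support →
      ((y ≠ Data.nil → p.RunsWithin x T₂ μ') ∧ (y = Data.nil → q.RunsWithin x T₂ μ')) ∧
        μ'.map Prod.fst = κ y := by
    intro y
    by_cases hy : y ∈ (μ.map Prod.fst).support
    · by_cases hn : y = Data.nil
      · obtain ⟨μ', h⟩ := hq y hy hn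
        exact ⟨μ', fun _ => ⟨⟨fun h => absurd hn h, fun _ => h.1⟩, h.2⟩⟩
      · obtain ⟨μ', h⟩ := hp y hy hn
        exact ⟨μ', fun _ => ⟨⟨fun _ => h.1, fun h => absurd h hn⟩, h.2⟩⟩
    · exact ⟨PMF.pure (y, 0), fun h => absurd h hy⟩
  choose μ' hμ' using h₂'
  have hs : ∀ o ∈ μ.support, o.1 ∈ (μ.map Prod.fst).support := fun o ho =>
    (PMF.mem_support_map_iff _ _ _).2 ⟨o, ho, rfl⟩
  refine ⟨_, ⟨.cond (ν := fun o => μ' o.1) e₁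
    (fun o ho hn => ((hμ' o.1 (hs o ho)).1.1 hn).1)
    (fun o ho hn => ((hμ' o.1 (hs o ho)).1.2 hn).1), ?_⟩, ?_⟩
  · intro o ho
    simp only [PMF.mem_support_bind_iff, PMF.mem_support_map_iff] at ho
    obtain ⟨a, ha, r, hr, rfl⟩ := ho
    have := t₁ a ha
    have : (r.2 : ℝ) ≤ T₂ := by
      by_cases hn : a.1 = Data.nil
      · exact ((hμ' a.1 (hs a ha)).1.2 hn).2 r hr
      · exact ((hμ' a.1 (hs a ha)).1.1 hn).2 r hr
    push_cast
    linarith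
  · simp only [PMF.map_bind, PMF.map_comp, PMF.bind_map]
    refine PMF.bind_congr_of_support _ fun o ho => ?_
    rw [Function.comp_apply, ← (hμ' o.1 (hs o ho)).2]
    rfl

theorem Runs.loop {b p : Prog} {x : Data} {T : ℝ} {ν : PMF Data}
    (h : (Prog.cond b (Prog.seq p (Prog.loop b p)) Prog.id).Runs x T ν) :
    (loop b p).Runs x T ν := by
  obtain ⟨μ, ⟨e, t⟩, h⟩ := h
  exact ⟨μ, ⟨.loop e, t⟩, h⟩

theorem Runs.seq_pure {p q : Prog} {x y : Data} {T₁ T₂ : ℝ} {ν : PMF Data}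
    (h₁ : p.Runs x T₁ (PMF.pure y)) (h₂ : q.Runs y T₂ ν) :
    (Prog.seq p q).Runs x (T₁ + T₂ + 1) ν := by
  have := h₁.seq (κ := fun _ => ν) (q := q) (T₂ := T₂) (by simpa using h₂)
  simpa using this

theorem Runs.cons_pure {p q : Prog} {x y : Data} {T₁ T₂ : ℝ} {ν : PMF Data}
    (h₁ : p.Runs x T₁ (PMF.pure y)) (h₂ : q.Runs x T₂ ν) :
    (Prog.cons p q).Runs x (T₁ + T₂ + 1) (ν.map (Data.cons y)) := by
  simpa using h₁.cons h₂

end Prog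

/-! ### Encodings and typed computations -/

/-- Types whose elements are represented by trees. -/
class Enc (A : Type) where
  enc : A → Data
  enc_injective : Function.Injective enc

open Enc

theorem Data.ofBool_injective : Function.Injective Data.ofBool := by
  intro a b h
  cases a <;> cases b <;> simp_all [Data.ofBool]

theorem Data.ofNat_injective : Function.Injective Data.ofNat := by
  intro a
  induction a with
  | zero => intro b h; cases b <;> simp_all [Data.ofNat]
  | succ a ih =>
    intro b h
    cases b with
    | zero => simp [Data.ofNat] at h
    | succ b =>
      simp only [Data.ofNat, Data.cons.injEq, true_and] at h
      rw [ih h]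

theorem Data.ofList_injective {β : Type} {f : β → Data} (hf : Function.Injective f) :
    Function.Injective (Data.ofList f) := by
  intro a
  induction a with
  | nil => intro b h; cases b <;> simp_all [Data.ofList]
  | cons x a ih =>
    intro b h
    cases b with
    | nil => simp [Data.ofList] at h
    | cons y b =>
      simp only [Data.ofList, Data.cons.injEq] at h
      rw [ih h.2, hf h.1]

instance : Enc Data := ⟨fun d => d, fun _ _ h => h⟩
instance : Enc Bool := ⟨Data.ofBool, Data.ofBool_injective⟩
instance : Enc ℕ := ⟨Data.ofNat, Data.ofNat_injective⟩
instance {A B : Type} [Enc A] [Enc B] : Enc (A × B) :=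
  ⟨fun p => Data.cons (enc p.1) (enc p.2), fun p q h => by
    simp only [Data.cons.injEq] at h
    exact Prod.ext (enc_injective h.1) (enc_injective h.2)⟩
instance {A : Type} [Enc A] : Enc (List A) :=
  ⟨Data.ofList enc, Data.ofList_injective enc_injective⟩

section
variable {A B C σ β : Type} [Enc A] [Enc B] [Enc C] [Enc σ] [Enc β]

theorem enc_list_cons (a : A) (l : List A) : enc (a :: l) = Data.cons (enc a) (enc l) := rfl

/-- There is a program which, on the code of every `a` that satisfies `D`, makes at most `T a`
steps and returns a code of a random element with distribution `f a`. -/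
def Comp (D : A → Prop) (f : A → PMF B) (T : A → ℝ) : Prop :=
  ∃ p : Prog, ∀ a, D a → p.Runs (enc a) (T a) ((f a).map enc)

/-- The deterministic case of `Comp`. -/
abbrev DetComp (D : A → Prop) (f : A → B) (T : A → ℝ) : Prop :=
  Comp D (fun a => PMF.pure (f a)) T

theorem Comp.mono {D D' : A → Prop} {f : A → PMF B} {T T' : A → ℝ} (h : Comp D f T)
    (hD : ∀ a, D' a → D a) (hT : ∀ a, D' a → T a ≤ T' a) : Comp D' f T' := by
  obtain ⟨p, h⟩ := h
  exact ⟨p, fun a ha => (h a (hD a ha)).mono (hT a ha)⟩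

theorem Comp.congr {D : A → Prop} {f g : A → PMF B} {T : A → ℝ} (h : Comp D f T)
    (hfg : ∀ a, D a → f a = g a) : Comp D g T := by
  obtain ⟨p, h⟩ := h
  exact ⟨p, fun a ha => hfg a ha ▸ h a ha⟩

theorem DetComp.id (D : A → Prop) : DetComp D (fun a => a) fun _ => 1 :=
  ⟨.id, fun a _ => by simpa [PMF.pure_map] using Prog.runs_id (enc a)⟩

theorem DetComp.fst (D : A × B → Prop) : DetComp D Prod.fst fun _ => 1 :=
  ⟨.hd, fun a _ => by rw [PMF.pure_map]; exact Prog.runs_hd (enc a)⟩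

theorem DetComp.snd (D : A × B → Prop) : DetComp D Prod.snd fun _ => 1 :=
  ⟨.tl, fun a _ => by rw [PMF.pure_map]; exact Prog.runs_tl (enc a)⟩

theorem Prog.Runs.seq_map {p q : Prog} {x : Data} {T₁ T₂ : ℝ} {f : PMF B} {g : B → PMF Data}
    (h₁ : p.Runs x T₁ (f.map enc)) (h₂ : ∀ b ∈ f.support, q.Runs (enc b) T₂ (g b)) :
    (Prog.seq p q).Runs x (T₁ + T₂ + 1) (f.bind g) := by
  obtain ⟨b₀, -⟩ := f.support_nonempty
  have : Nonempty B := ⟨b₀⟩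
  -- The continuation in `Runs.seq` is indexed by trees, so codes are translated back by a left
  -- inverse of `enc`.
  have := h₁.seq (q := q) (T₂ := T₂) (κ := fun y => g (Function.invFun enc y)) fun y hy => by
    rw [PMF.mem_support_map_iff] at hy
    obtain ⟨b, hb, rfl⟩ := hy
    rw [Function.leftInverse_invFun enc_injective b]
    exact h₂ b hb
  rw [PMF.bind_map] at this
  convert this using 2
  funext b
  rw [Function.comp_apply, Function.leftInverse_invFun enc_injective b]

theorem Comp.bind {D : A → Prop} {D' : B → Prop} {f : A → PMF B} {g : B → PMF C}
    {T : A → ℝ} {T' : B → ℝ} {T'' : A → ℝ} (hf : Comp D f T) (hg : Comp D' g T')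
    (h : ∀ a, D a → ∀ b ∈ (f a).support, D' b ∧ T' b ≤ T'' a) :
    Comp D (fun a => (f a).bind g) fun a => T a + T'' a + 1 := by
  obtain ⟨p, hp⟩ := hf
  obtain ⟨q, hq⟩ := hg
  refine ⟨.seq p q, fun a ha => ?_⟩
  rw [PMF.map_bind]
  exact (hp a ha).seq_map fun b hb => (hq b (h a ha b hb).1).mono (h a ha b hb).2

/-- A deterministic computation followed by a random one. -/
theorem Comp.comp {D : A → Prop} {D' : B → Prop} {f : A → B} {g : B → PMF C}
    {T : A → ℝ} {T' : B → ℝ} (hg : Comp D' g T') (hf : DetComp D f T)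
    (h : ∀ a, D a → D' (f a)) :
    Comp D (fun a => g (f a)) fun a => T a + T' (f a) + 1 := by
  have := hf.bind hg (T'' := fun a => T' (f a)) (by simpa using h)
  simpa using this

theorem DetComp.comp {D : A → Prop} {D' : B → Prop} {f : A → B} {g : B → C}
    {T : A → ℝ} {T' : B → ℝ} (hg : DetComp D' g T') (hf : DetComp D f T)
    (h : ∀ a, D a → D' (f a)) :
    DetComp D (fun a => g (f a)) fun a => T a + T' (f a) + 1 :=
  Comp.comp hg hf h

theorem Comp.pair {D : A → Prop} {f : A → PMF B} {g : A → PMF C} {T T' : A → ℝ}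
    (hf : Comp D f T) (hg : Comp D g T') :
    Comp D (fun a => (f a).bind fun b => (g a).map fun c => (b, c))
      fun a => T a + T' a + 1 := by
  obtain ⟨p, hp⟩ := hf
  obtain ⟨q, hq⟩ := hg
  refine ⟨.cons p q, fun a ha => ?_⟩
  have := (hp a ha).cons (hq a ha)
  simp only [PMF.map_bind, PMF.map_comp, PMF.bind_map] at this ⊢
  exact this

theorem DetComp.pair {D : A → Prop} {f : A → B} {g : A → C} {T T' : A → ℝ}
    (hf : DetComp D f T) (hg : DetComp D g T') :
    DetComp D (fun a => (f a, g a)) fun a => T a + T' a + 1 := by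
  have := Comp.pair hf hg
  simpa [PMF.pure_map] using this

/-- A case distinction: the test `g` returns `nil` for "false". -/
theorem Comp.ite {D : A → Prop} {g : A → C} {P : A → Prop} [DecidablePred P]
    {f₁ f₂ : A → PMF B} {T T₁ T₂ : A → ℝ} (hg : DetComp D g T)
    (hP : ∀ a, D a → (enc (g a) ≠ Data.nil ↔ P a))
    (h₁ : Comp (fun a => D a ∧ P a) f₁ T₁) (h₂ : Comp (fun a => D a ∧ ¬ P a) f₂ T₂) :
    Comp D (fun a => if P a then f₁ a else f₂ a)
      fun a => T a + (if P a then T₁ a else T₂ a) + 1 := by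
  obtain ⟨b, hb⟩ := hg
  obtain ⟨p, hp⟩ := h₁
  obtain ⟨q, hq⟩ := h₂
  refine ⟨.cond b p q, fun a ha => ?_⟩
  have hba := hb a ha
  rw [PMF.pure_map] at hba
  have := hba.cond (p := p) (q := q) (T₂ := if P a then T₁ a else T₂ a)
    (κ := fun _ => (if P a then f₁ a else f₂ a).map enc) ?_ ?_
  · simpa using this
  · intro y hy hn
    simp only [PMF.support_pure, Set.mem_singleton_iff] at hy
    subst hy
    have := (hP a ha).1 hn
    simp only [this, if_true]
    exact hp a ⟨ha, this⟩
  · intro y hy hn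
    simp only [PMF.support_pure, Set.mem_singleton_iff] at hy
    subst hy
    have : ¬ P a := fun h => (hP a ha).2 h hn
    simp only [this, if_false]
    exact hq a ⟨ha, this⟩

/-- Randomized left fold. -/
noncomputable def foldPMF {σ β : Type} (step : σ → β → PMF σ) : List β → σ → PMF σ
  | [], s => PMF.pure s
  | b :: l, s => (step s b).bind (foldPMF step l)

theorem foldPMF_pure {σ β : Type} (f : σ → β → σ) (l : List β) (s : σ) :
    foldPMF (fun s b => PMF.pure (f s b)) l s = PMF.pure (l.foldl f s) := by
  induction l generalizing s with
  | nil => rfl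
  | cons b l ih => simp [foldPMF, ih]

/-- The loop of a fold over a list; its states are triples of context, remaining list and
accumulator. -/
def Prog.foldLoop (p : Prog) : Prog :=
  .loop (.seq .tl .hd)
    (.cons .hd (.cons (.seq (.seq .tl .hd) .tl)
      (.seq (.cons .hd (.cons (.seq .tl .tl) (.seq (.seq .tl .hd) .hd))) p)))

/-- `Inv` relates the remaining list to the accumulator, so that the step has to be understood on
reachable states only. The constant 40 covers the guard and the unpacking and repacking of the
triple in one round. -/
theorem Prog.runs_foldLoop {p : Prog} {a : A} {step : σ → β → PMF σ} {τ : ℝ}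
    {Inv : List β → σ → Prop}
    (hstep : ∀ b r s, Inv (b :: r) s → p.Runs (enc (a, s, b)) τ ((step s b).map enc) ∧
      ∀ s' ∈ (step s b).support, Inv r s') (l : List β) :
    ∀ s, Inv l s → (Prog.foldLoop p).Runs (enc (a, l, s)) (l.length * (τ + 40) + 10)
      ((foldPMF step l s).map fun s' => enc (a, ([] : List β), s')) := by
  induction l with
  | nil =>
    intro s _
    refine Runs.loop ?_
    have h := (runs_tl (enc (a, ([] : List β), s))).seq_pure (runs_hd _)
    have h := h.cond (p := .seq
      (.cons .hd (.cons (.seq (.seq .tl .hd) .tl)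
      (.seq (.cons .hd (.cons (.seq .tl .tl) (.seq (.seq .tl .hd) .hd))) p))) (foldLoop p))
      (q := .id) (T₂ := 1)
      (κ := fun _ => PMF.pure (enc (a, ([] : List β), s))) ?_ ?_
    · refine Runs.mono (T := 1 + 1 + 1 + 1 + 1) ?_ (by norm_num)
      rw [PMF.pure_bind] at h
      simp only [foldPMF, PMF.pure_map]
      exact h
    · intro y hy hn
      simp only [PMF.support_pure, Set.mem_singleton_iff] at hy
      exact absurd hy hn
    · intro y _ _
      exact runs_id _
  | cons b l ih =>
    intro s hs
    obtain ⟨h1, h2⟩ := hstep b l s hs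
    refine Runs.loop ?_
    set x := enc (a, b :: l, s) with hx
    have hg := (runs_tl x).seq_pure (runs_hd _)
    have hl : (Prog.seq (.seq .tl .hd) .tl).Runs x 5 (PMF.pure (enc l)) :=
      (((runs_tl x).seq_pure (runs_hd _)).seq_pure (runs_tl _)).mono (by norm_num)
    have hb : (Prog.seq (.seq .tl .hd) .hd).Runs x 5 (PMF.pure (enc b)) :=
      (((runs_tl x).seq_pure (runs_hd _)).seq_pure (runs_hd _)).mono (by norm_num)
    have hs' : (Prog.seq .tl .tl).Runs x 3 (PMF.pure (enc s)) :=
      ((runs_tl x).seq_pure (runs_tl _)).mono (by norm_num)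
    have ha : Prog.hd.Runs x 1 (PMF.pure (enc a)) := runs_hd x
    have harr := ha.cons_pure (hs'.cons_pure hb)
    rw [PMF.pure_map, PMF.pure_map] at harr
    have hbody := ha.cons_pure (hl.cons_pure (harr.seq_pure h1))
    rw [PMF.map_comp, PMF.map_comp] at hbody
    have hbody' : (Prog.cons .hd (.cons (.seq (.seq .tl .hd) .tl)
      (.seq (.cons .hd (.cons (.seq .tl .tl) (.seq (.seq .tl .hd) .hd))) p))).Runs x
      (τ + 25) (((step s b).map fun s' => (a, l, s')).map enc) := by
      rw [PMF.map_comp]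
      exact hbody.mono (by linarith)
    have hrec := hbody'.seq_map (q := foldLoop p) (T₂ := l.length * (τ + 40) + 10)
      (g := fun t => (foldPMF step l t.2.2).map fun s' => enc (a, ([] : List β), s')) ?_
    · rw [PMF.bind_map] at hrec
      have h := hg.cond (q := .id) (κ := fun _ => (step s b).bind ((fun t : A × List β × σ =>
        (foldPMF step l t.2.2).map fun s' => enc (a, ([] : List β), s')) ∘
          fun s' => (a, l, s'))) (fun y _ _ => hrec) ?_
      · rw [PMF.pure_bind] at h
        simp only [foldPMF, PMF.map_bind]
        refine h.mono (T := (1 + 1 + 1) + (τ + 25 + (l.length * (τ + 40) + 10) + 1) + 1) ?_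
        push_cast [List.length_cons]
        linarith
      · intro y hy hn
        simp only [PMF.support_pure, Set.mem_singleton_iff] at hy
        rw [hy] at hn
        cases hn
    · intro t ht
      rw [PMF.mem_support_map_iff] at ht
      obtain ⟨s', hs', rfl⟩ := ht
      exact ih s' (h2 s' hs')

/-- The invariant turns the state-dependent time `Ts` into a bound `τ` that depends on the input
alone; this allows times to be multiplied by the number of rounds. -/
theorem Comp.fold {D : A → Prop} {D' : A × σ × β → Prop} {l : A → List β} {init : A → PMF σ}
    {step : A × σ × β → PMF σ} {Tl Ti τ : A → ℝ} {Ts : A × σ × β → ℝ}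
    (Inv : A → List β → σ → Prop)
    (hl : DetComp D l Tl) (hi : Comp D init Ti) (hs : Comp D' step Ts)
    (h0 : ∀ a, D a → ∀ s ∈ (init a).support, Inv a (l a) s)
    (h1 : ∀ a, D a → ∀ b r s, Inv a (b :: r) s → D' (a, s, b) ∧ Ts (a, s, b) ≤ τ a ∧
      ∀ s' ∈ (step (a, s, b)).support, Inv a r s') :
    Comp D (fun a => (init a).bind (foldPMF (fun s b => step (a, s, b)) (l a)))
      fun a => Tl a + Ti a + (l a).length * (τ a + 40) + 20 := by
  obtain ⟨pl, hl⟩ := hl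
  obtain ⟨pi, hi⟩ := hi
  obtain ⟨p, hp⟩ := hs
  refine ⟨.seq (.seq (.cons .id (.cons pl pi)) (.foldLoop p)) (.seq .tl .tl), fun a ha => ?_⟩
  have hla := hl a ha
  rw [PMF.pure_map] at hla
  have hstart := (Prog.runs_id (enc a)).cons_pure (hla.cons_pure (hi a ha))
  rw [PMF.map_comp, PMF.map_comp] at hstart
  have hstart' : (Prog.cons .id (.cons pl pi)).Runs (enc a) (Tl a + Ti a + 3)
      (((init a).map fun s => (a, l a, s)).map enc) := by
    rw [PMF.map_comp]
    exact hstart.mono (by linarith)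
  have hloop := hstart'.seq_map (q := .foldLoop p) (T₂ := (l a).length * (τ a + 40) + 10)
    (g := fun t => ((foldPMF (fun s b => step (a, s, b)) (l a) t.2.2).map
      fun s' => (a, ([] : List β), s')).map enc) ?_
  · have hfin := Prog.Runs.seq_map (f := ((init a).map fun s => (a, l a, s)).bind fun t =>
        (foldPMF (fun s b => step (a, s, b)) (l a) t.2.2).map fun s' => (a, ([] : List β), s'))
      (q := .seq .tl .tl) (T₂ := 3)
      (g := fun t => PMF.pure (enc t.2.2)) (by rw [PMF.map_bind]; exact hloop) (fun t _ =>
        (((Prog.runs_tl (enc t)).seq_pure (Prog.runs_tl _))).mono (by norm_num))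
    refine Prog.Runs.mono (T := Tl a + Ti a + 3 + ((l a).length * (τ a + 40) + 10) + 1 + 3 + 1)
      ?_ (by linarith)
    convert hfin using 1
    rw [PMF.bind_map, PMF.bind_bind, PMF.map_bind]
    congr 1
    funext s
    rw [Function.comp_apply, PMF.bind_map]
    rfl
  · intro t ht
    rw [PMF.mem_support_map_iff] at ht
    obtain ⟨s, hs, rfl⟩ := ht
    rw [PMF.map_comp]
    refine Prog.runs_foldLoop (Inv := Inv a) ?_ (l a) s (h0 a ha s hs)
    intro b r s hI
    obtain ⟨hD, hT, hsup⟩ := h1 a ha b r s hI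
    exact ⟨(hp _ hD).mono hT, hsup⟩

theorem DetComp.foldl {D : A → Prop} {D' : A × σ × β → Prop} {l : A → List β} {init : A → σ}
    {step : A × σ × β → σ} {Tl Ti τ : A → ℝ} {Ts : A × σ × β → ℝ}
    (Inv : A → List β → σ → Prop)
    (hl : DetComp D l Tl) (hi : DetComp D init Ti) (hs : DetComp D' step Ts)
    (h0 : ∀ a, D a → Inv a (l a) (init a))
    (h1 : ∀ a, D a → ∀ b r s, Inv a (b :: r) s → D' (a, s, b) ∧ Ts (a, s, b) ≤ τ a ∧
      Inv a r (step (a, s, b))) :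
    DetComp D (fun a => (l a).foldl (fun s b => step (a, s, b)) (init a))
      fun a => Tl a + Ti a + (l a).length * (τ a + 40) + 20 := by
  have := Comp.fold Inv hl hi hs (by simpa using h0) (by simpa using h1)
  simpa [foldPMF_pure] using this

end

/-! ### Polynomial time -/

theorem Polynomial.eval_mono_nat (P : Polynomial ℕ) : Monotone fun n : ℕ => P.eval n := by
  intro a b h
  simp only [Polynomial.eval_eq_sum_range]
  gcongr

section
variable {A B C σ β : Type} [Enc A] [Enc B] [Enc C] [Enc σ] [Enc β]

/-- The size of the code of `a`. -/
def esize (a : A) : ℕ := (enc a).size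

theorem Data.size_pos (d : Data) : 0 < d.size := by cases d <;> simp [Data.size]

theorem esize_pos (a : A) : 0 < esize a := Data.size_pos _

theorem esize_pair (a : A) (b : B) : esize (a, b) = esize a + esize b + 1 := rfl
theorem esize_nil : esize ([] : List A) = 1 := rfl
theorem esize_cons (a : A) (l : List A) : esize (a :: l) = esize a + esize l + 1 := rfl
theorem esize_nat (n : ℕ) : esize n = 2 * n + 1 := by
  induction n with
  | zero => rfl
  | succ n ih =>
    have : esize (n + 1) = 1 + esize n + 1 := rfl
    omega

theorem esize_mem {b : β} {l : List β} (h : b ∈ l) : esize b ≤ esize l := by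
  induction l with
  | nil => simp at h
  | cons c l ih =>
    rw [esize_cons]
    rcases List.mem_cons.1 h with rfl | h
    · omega
    · have := ih h
      omega

theorem length_le_esize (l : List β) : l.length ≤ esize l := by
  induction l with
  | nil => simp
  | cons c l ih =>
    rw [esize_cons, List.length_cons]
    omega

/-- `f` can be computed in polynomial time, and the size of its values is polynomial. -/
def PolyTime (f : A → B) : Prop :=
  ∃ P : Polynomial ℕ, DetComp (fun _ => True) f (fun a => (P.eval (esize a) : ℕ)) ∧
    ∀ a, esize (f a) ≤ P.eval (esize a)

theorem PolyTime.of_bounds {f : A → B} {T : A → ℝ} (P Q : Polynomial ℕ)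
    (h : DetComp (fun _ => True) f T) (hT : ∀ a, T a ≤ (P.eval (esize a) : ℕ))
    (hs : ∀ a, esize (f a) ≤ Q.eval (esize a)) : PolyTime f := by
  refine ⟨P + Q, h.mono (fun _ h => h) fun a _ => (hT a).trans ?_, fun a => ?_⟩
  · simp
  · simpa using (hs a).trans (Nat.le_add_left _ _)

theorem PolyTime.id : PolyTime fun a : A => a :=
  .of_bounds 1 .X (DetComp.id _) (by simp) (by simp)

theorem PolyTime.fst : PolyTime (Prod.fst : A × B → A) :=
  .of_bounds 1 .X (DetComp.fst _) (by simp) fun a => by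
    have : esize a = esize a.1 + esize a.2 + 1 := rfl
    simp only [Polynomial.eval_X]
    omega

theorem PolyTime.snd : PolyTime (Prod.snd : A × B → B) :=
  .of_bounds 1 .X (DetComp.snd _) (by simp) fun a => by
    have : esize a = esize a.1 + esize a.2 + 1 := rfl
    simp only [Polynomial.eval_X]
    omega

/-- This is why `PolyTime` also bounds the size of the value: time alone does not, because pairing a
tree with itself doubles its size at constant cost. -/
theorem PolyTime.comp {g : B → C} {f : A → B} (hg : PolyTime g) (hf : PolyTime f) :
    PolyTime fun a => g (f a) := by
  obtain ⟨P, hP, hP'⟩ := hf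
  obtain ⟨Q, hQ, hQ'⟩ := hg
  refine .of_bounds (P + Q.comp P + 1) (Q.comp P) (DetComp.comp hQ hP fun _ _ => trivial) ?_ ?_
  · intro a
    simp only [Polynomial.eval_add, Polynomial.eval_comp, Polynomial.eval_one]
    have := Q.eval_mono_nat (hP' a)
    push_cast
    have : (((Q.eval (esize (f a))) : ℕ) : ℝ) ≤ (Q.eval (P.eval (esize a)) : ℕ) := by
      exact_mod_cast this
    linarith
  · intro a
    rw [Polynomial.eval_comp]
    exact (hQ' _).trans (Q.eval_mono_nat (hP' a))

theorem PolyTime.pair {f : A → B} {g : A → C} (hf : PolyTime f) (hg : PolyTime g) :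
    PolyTime fun a => (f a, g a) := by
  obtain ⟨P, hP, hP'⟩ := hf
  obtain ⟨Q, hQ, hQ'⟩ := hg
  refine .of_bounds (P + Q + 1) (P + Q + 1) (DetComp.pair hP hQ) ?_ ?_
  · intro a
    simp
  · intro a
    have := hP' a
    have := hQ' a
    simp only [esize_pair, Polynomial.eval_add, Polynomial.eval_one]
    omega

/-- A function of two arguments after two functions. -/
theorem PolyTime.comp₂ {g : B × C → σ} {f₁ : A → B} {f₂ : A → C} (hg : PolyTime g)
    (h₁ : PolyTime f₁) (h₂ : PolyTime f₂) : PolyTime fun a => g (f₁ a, f₂ a) :=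
  hg.comp (h₁.pair h₂)

theorem PolyTime.ite {g : A → C} {P : A → Prop} [DecidablePred P] {f₁ f₂ : A → B}
    (hg : PolyTime g) (hP : ∀ a, enc (g a) ≠ Data.nil ↔ P a)
    (h₁ : PolyTime f₁) (h₂ : PolyTime f₂) : PolyTime fun a => if P a then f₁ a else f₂ a := by
  obtain ⟨P₀, h₀, -⟩ := hg
  obtain ⟨P₁, h₁, h₁'⟩ := h₁
  obtain ⟨P₂, h₂, h₂'⟩ := h₂
  have h := Comp.ite (P := P) (D := fun _ => True) h₀ (fun a _ => hP a)
    (h₁.mono (fun _ _ => trivial) fun _ _ => le_rfl)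
    (h₂.mono (fun _ _ => trivial) fun _ _ => le_rfl)
  refine PolyTime.of_bounds (P₀ + P₁ + P₂ + 1) (P₁ + P₂)
    (h.congr fun a _ => by beta_reduce; split_ifs <;> rfl) ?_ ?_
  · intro a
    simp only [Polynomial.eval_add, Polynomial.eval_one]
    push_cast
    split_ifs
    · have : (0 : ℝ) ≤ (P₂.eval (esize a) : ℕ) := Nat.cast_nonneg _
      linarith
    · have : (0 : ℝ) ≤ (P₁.eval (esize a) : ℕ) := Nat.cast_nonneg _
      linarith
  · intro a
    have := h₁' a
    have := h₂' a
    simp only [Polynomial.eval_add]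
    split_ifs <;> omega

/-- A polynomial-time step can be iterated only if the accumulators stay small, since polynomial
growth may compound. `Q` has to bound them after every prefix `r` of the list. -/
theorem PolyTime.foldl {l : A → List β} {init : A → σ} {step : A × σ × β → σ}
    (hl : PolyTime l) (hi : PolyTime init) (hs : PolyTime step) (Q : Polynomial ℕ)
    (hQ : ∀ a r r', r ++ r' = l a →
      esize (r.foldl (fun s b => step (a, s, b)) (init a)) ≤ Q.eval (esize a)) :
    PolyTime fun a => (l a).foldl (fun s b => step (a, s, b)) (init a) := by
  obtain ⟨Pl, hl, hl'⟩ := hl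
  obtain ⟨Pi, hi, -⟩ := hi
  obtain ⟨Ps, hs, -⟩ := hs
  have h := DetComp.foldl (D := fun _ => True)
    (τ := fun a => ((Ps.comp (.X + Q + Pl + 2)).eval (esize a) : ℕ))
    (fun a r' s => ∃ r, r ++ r' = l a ∧ s = r.foldl (fun s b => step (a, s, b)) (init a))
    hl hi hs (fun a _ => ⟨[], rfl, rfl⟩) ?_
  · refine PolyTime.of_bounds (Pl + Pi + Pl * (Ps.comp (.X + Q + Pl + 2) + 40) + 20) Q h ?_ ?_
    · intro a
      simp only [Polynomial.eval_add, Polynomial.eval_mul, Polynomial.eval_ofNat]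
      push_cast
      have := ((length_le_esize (l a)).trans (hl' a))
      gcongr
    · exact fun a => hQ a (l a) [] (by simp)
  · rintro a - b r' s ⟨r, hr, rfl⟩
    refine ⟨trivial, ?_, r ++ [b], by simpa using hr, by simp⟩
    simp only [Polynomial.eval_comp, Nat.cast_le]
    refine Ps.eval_mono_nat ?_
    simp only [esize_pair, Polynomial.eval_add, Polynomial.eval_X, Polynomial.eval_ofNat]
    have := hQ a r _ hr
    have : b ∈ l a := by rw [← hr]; simp
    have := esize_mem this
    have := hl' a
    omega

/-! ### Arithmetic of unary numbers -/

theorem DetComp.zero (D : A → Prop) : DetComp D (fun _ => (0 : ℕ)) fun _ => 1 :=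
  ⟨.nil, fun a _ => by rw [PMF.pure_map]; exact Prog.runs_nil (enc a)⟩

theorem DetComp.emptyList (D : A → Prop) : DetComp D (fun _ => ([] : List B)) fun _ => 1 :=
  ⟨.nil, fun a _ => by rw [PMF.pure_map]; exact Prog.runs_nil (enc a)⟩

theorem DetComp.succ (D : ℕ → Prop) : DetComp D (fun n => n + 1) fun _ => 3 :=
  ⟨.cons .nil .id, fun a _ => by
    rw [PMF.pure_map]
    have := (Prog.runs_nil (enc a)).cons_pure (Prog.runs_id _)
    rw [PMF.pure_map] at this
    exact this.mono (by norm_num)⟩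

theorem DetComp.pred (D : ℕ → Prop) : DetComp D (fun n => n - 1) fun _ => 1 :=
  ⟨.tl, fun a _ => by
    rw [PMF.pure_map]
    have := Prog.runs_tl (enc a)
    cases a <;> exact this⟩

theorem DetComp.listCons (D : A × List A → Prop) : DetComp D (fun q => q.1 :: q.2) fun _ => 1 :=
  ⟨.id, fun a _ => by rw [PMF.pure_map]; exact Prog.runs_id (enc a)⟩

theorem DetComp.tail (D : List A → Prop) : DetComp D List.tail fun _ => 1 :=
  ⟨.tl, fun l _ => by
    rw [PMF.pure_map]
    have := Prog.runs_tl (enc l)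
    cases l <;> exact this⟩

theorem DetComp.headD {d : A} (hd : enc d = Data.nil) (D : List A → Prop) :
    DetComp D (fun l => l.headD d) fun _ => 1 :=
  ⟨.hd, fun l _ => by
    rw [PMF.pure_map]
    have := Prog.runs_hd (enc l)
    cases l with
    | nil => beta_reduce; rw [List.headD_nil, hd]; exact this
    | cons => exact this⟩

theorem DetComp.toNat (D : Bool → Prop) : DetComp D Bool.toNat fun _ => 1 :=
  ⟨.id, fun b _ => by
    rw [PMF.pure_map]
    have := Prog.runs_id (enc b)
    cases b <;> exact this⟩

/-- A number is encoded in the same way as a list of that length of empty lists. -/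
theorem DetComp.replicate (D : ℕ → Prop) :
    DetComp D (fun n => List.replicate n (0 : ℕ)) fun _ => 1 :=
  ⟨.id, fun n hn => by
    rw [PMF.pure_map]
    clear hn
    have h : enc (List.replicate n (0 : ℕ)) = enc n := by
      induction n with
      | zero => rfl
      | succ n ih => rw [List.replicate_succ, enc_list_cons, ih]; rfl
    rw [h]
    exact Prog.runs_id (enc n)⟩

theorem enc_nat_ne_nil (n : ℕ) : enc n ≠ Data.nil ↔ n ≠ 0 := by
  cases n with
  | zero => exact ⟨fun h => absurd rfl h, fun h => absurd rfl h⟩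
  | succ n => exact ⟨fun _ => n.succ_ne_zero, fun _ h => Data.noConfusion h⟩

theorem enc_list_ne_nil (l : List A) : enc l ≠ Data.nil ↔ l ≠ [] := by
  cases l with
  | nil => exact ⟨fun h => absurd rfl h, fun h => absurd rfl h⟩
  | cons a l => exact ⟨fun _ => List.cons_ne_nil a l, fun _ h => Data.noConfusion h⟩

theorem enc_bool_ne_nil (b : Bool) : enc b ≠ Data.nil ↔ b = true := by
  cases b with
  | false => exact ⟨fun h => absurd rfl h, fun h => absurd h (by decide)⟩
  | true => exact ⟨fun _ => rfl, fun _ h => Data.noConfusion h⟩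

theorem DetComp.timeMono {D : A → Prop} {f : A → B} {T T' : A → ℝ} (h : DetComp D f T)
    (hT : ∀ a, D a → T a ≤ T' a) : DetComp D f T' :=
  h.mono (fun _ h => h) hT

theorem DetComp.funCongr {D : A → Prop} {f g : A → B} {T : A → ℝ} (h : DetComp D f T)
    (hfg : ∀ a, D a → f a = g a) : DetComp D g T :=
  h.congr fun a ha => by rw [hfg a ha]

theorem foldl_replicate_eq {σ : Type} (f : σ → σ) (n : ℕ) (s : σ) :
    (List.replicate n (0 : ℕ)).foldl (fun s _ => f s) s = f^[n] s := by
  induction n generalizing s with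
  | zero => rfl
  | succ n ih => rw [List.replicate_succ, List.foldl_cons, ih, Function.iterate_succ_apply]

/-- Addition, multiplication and division get explicit times besides membership in `PolyTime`,
because they are later applied to numbers as large as γ^n, in which the time has to be linear. The
cost of a sum depends on the second summand only, which keeps multiplication by repeated addition
bilinear. -/
theorem detComp_add :
    DetComp (fun _ => True) (fun q : ℕ × ℕ => q.1 + q.2) fun q => 100 * (q.2 + 1) := by
  have hl := (DetComp.replicate (fun _ => True)).comp (DetComp.snd (A := ℕ) (B := ℕ)
    fun _ => True) (fun _ _ => trivial)
  have hs := (DetComp.succ (fun _ => True)).comp (DetComp.comp (DetComp.fst (fun _ => True))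
    (DetComp.snd (A := ℕ × ℕ) (B := ℕ × ℕ) fun _ => True) fun _ _ => trivial) fun _ _ => trivial
  have h := DetComp.foldl (fun _ _ _ => True) (τ := fun _ => 10) hl (DetComp.fst fun _ => True) hs
    (fun _ _ => trivial)
    (fun _ _ _ _ _ _ => ⟨trivial, by norm_num, trivial⟩)
  refine (h.funCongr fun q _ => ?_).timeMono fun q _ => ?_
  · rw [foldl_replicate_eq (fun s => s + 1)]
    simp
  · simp only [List.length_replicate]
    linarith [(Nat.cast_nonneg q.2 : (0 : ℝ) ≤ q.2)]

theorem detComp_sub :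
    DetComp (fun _ => True) (fun q : ℕ × ℕ => q.1 - q.2) fun q => 100 * (q.2 + 1) := by
  have hl := (DetComp.replicate (fun _ => True)).comp (DetComp.snd (A := ℕ) (B := ℕ)
    fun _ => True) (fun _ _ => trivial)
  have hs := (DetComp.pred (fun _ => True)).comp (DetComp.comp (DetComp.fst (fun _ => True))
    (DetComp.snd (A := ℕ × ℕ) (B := ℕ × ℕ) fun _ => True) fun _ _ => trivial) fun _ _ => trivial
  have h := DetComp.foldl (fun _ _ _ => True) (τ := fun _ => 10) hl (DetComp.fst fun _ => True) hs
    (fun _ _ => trivial)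
    (fun _ _ _ _ _ _ => ⟨trivial, by norm_num, trivial⟩)
  refine (h.funCongr fun q _ => ?_).timeMono fun q _ => ?_
  · rw [foldl_replicate_eq (fun s => s - 1)]
    exact Nat.pred_iterate _ _
  · simp only [List.length_replicate]
    linarith [(Nat.cast_nonneg q.2 : (0 : ℝ) ≤ q.2)]

theorem detComp_mul :
    DetComp (fun _ => True) (fun q : ℕ × ℕ => q.1 * q.2)
      fun q => 1000 * (q.1 + 1) * (q.2 + 1) := by
  have hl := (DetComp.replicate (fun _ => True)).comp (DetComp.fst (A := ℕ) (B := ℕ)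
    fun _ => True) (fun _ _ => trivial)
  have hs := detComp_add.comp (DetComp.pair
    (DetComp.comp (DetComp.fst (fun _ => True))
      (DetComp.snd (A := ℕ × ℕ) (B := ℕ × ℕ) fun _ => True) fun _ _ => trivial)
    (DetComp.comp (DetComp.snd (fun _ => True))
      (DetComp.fst (A := ℕ × ℕ) (B := ℕ × ℕ) fun _ => True) fun _ _ => trivial))
      fun _ _ => trivial
  have h := DetComp.foldl (fun _ _ _ => True) (τ := fun q => 100 * (q.2 + 1) + 20) hl
    (DetComp.zero fun _ => True) hs
    (fun _ _ => trivial)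
    (fun _ _ _ _ _ _ => ⟨trivial, by linarith, trivial⟩)
  refine (h.funCongr fun q _ => ?_).timeMono fun q _ => ?_
  · rw [foldl_replicate_eq (fun s => s + q.2)]
    simp
  · simp only [List.length_replicate]
    have h1 := (Nat.cast_nonneg q.1 : (0 : ℝ) ≤ q.1)
    have h2 := (Nat.cast_nonneg q.2 : (0 : ℝ) ≤ q.2)
    nlinarith [mul_nonneg h1 h2]

/-- One step of the division by `y`: the state consists of the quotient and of the number of units
that are missing to the next multiple of `y`. -/
def divStep (y : ℕ) (s : ℕ × ℕ) : ℕ × ℕ :=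
  if s.2 - 1 ≠ 0 then (s.1, s.2 - 1) else (s.1 + 1, y)

/-- After x units have been consumed, the second component is what is missing to the next multiple
of y. It lies between 1 and y, never 0, so the first component is the floor of x / y. -/
theorem divStep_iterate {y : ℕ} (hy : 0 < y) (x : ℕ) :
    ((divStep y)^[x] (0, y)).1 * y + y = x + ((divStep y)^[x] (0, y)).2 ∧
      1 ≤ ((divStep y)^[x] (0, y)).2 ∧ ((divStep y)^[x] (0, y)).2 ≤ y := by
  induction x with
  | zero => simp; omega
  | succ x ih =>
    rw [Function.iterate_succ_apply']
    obtain ⟨h1, h2, h3⟩ := ih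
    generalize (divStep y)^[x] (0, y) = s at *
    unfold divStep
    split_ifs
    · refine ⟨?_, ?_, ?_⟩ <;> dsimp only <;> omega
    · refine ⟨?_, ?_, ?_⟩ <;> dsimp only
      · rw [Nat.succ_mul]; omega
      · omega
      · omega

theorem divStep_iterate_fst {y : ℕ} (hy : 0 < y) (x : ℕ) :
    ((divStep y)^[x] (0, y)).1 = x / y := by
  obtain ⟨h1, h2, h3⟩ := divStep_iterate hy x
  refine (Nat.div_eq_of_lt_le ?_ ?_).symm
  · omega
  · rw [Nat.succ_mul]; omega

theorem detComp_divStep :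
    DetComp (fun _ => True) (fun q : ℕ × ℕ × ℕ => divStep q.1 q.2) fun _ => 40 := by
  have hs := DetComp.snd (A := ℕ) (B := ℕ × ℕ) fun _ => True
  have h1 := (DetComp.fst (A := ℕ) (B := ℕ) fun _ => True).comp hs fun _ _ => trivial
  have h2 := (DetComp.pred fun _ => True).comp
    ((DetComp.snd (A := ℕ) (B := ℕ) fun _ => True).comp hs fun _ _ => trivial) fun _ _ => trivial
  have hy := DetComp.fst (A := ℕ) (B := ℕ × ℕ) fun _ => True
  have h := Comp.ite (P := fun q : ℕ × ℕ × ℕ => q.2.2 - 1 ≠ 0) h2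
    (fun q _ => enc_nat_ne_nil _) ((DetComp.pair h1 h2).mono (fun _ _ => trivial)
      fun _ _ => le_rfl) ((DetComp.pair ((DetComp.succ fun _ => True).comp h1 fun _ _ => trivial)
      hy).mono (fun _ _ => trivial) fun _ _ => le_rfl)
  refine (h.congr fun q _ => ?_).mono (fun _ h => h) fun q _ => ?_
  · dsimp only [divStep]
    split_ifs <;> rfl
  · split_ifs <;> norm_num

theorem detComp_div :
    DetComp (fun _ => True) (fun q : ℕ × ℕ => q.1 / q.2) fun q => 200 * (q.1 + 1) := by
  have hl := (DetComp.replicate (fun _ => True)).comp (DetComp.fst (A := ℕ) (B := ℕ)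
    fun _ => True) (fun _ _ => trivial)
  have hi := (DetComp.zero fun _ => True).pair (DetComp.snd (A := ℕ) (B := ℕ) fun _ => True)
  have hs := detComp_divStep.comp (((DetComp.snd (A := ℕ) (B := ℕ) fun _ => True).comp
      (DetComp.fst (A := ℕ × ℕ) (B := (ℕ × ℕ) × ℕ) fun _ => True) fun _ _ => trivial).pair
    ((DetComp.fst (A := ℕ × ℕ) (B := ℕ) fun _ => True).comp
      (DetComp.snd (A := ℕ × ℕ) (B := (ℕ × ℕ) × ℕ) fun _ => True) fun _ _ => trivial))
      fun _ _ => trivial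
  have h := (DetComp.fst (A := ℕ) (B := ℕ) fun _ => True).comp
    (DetComp.foldl (fun _ _ _ => True) (τ := fun _ => 60) hl hi hs (fun _ _ => trivial)
    (fun _ _ _ _ _ _ => ⟨trivial, by norm_num, trivial⟩)) fun _ _ => trivial
  have h' := Comp.ite (P := fun q : ℕ × ℕ => q.2 ≠ 0) (DetComp.snd (A := ℕ) (B := ℕ) fun _ => True)
    (fun q _ => enc_nat_ne_nil _) (h.mono (fun _ _ => trivial) fun _ _ => le_rfl)
    ((DetComp.zero fun _ => True).mono (fun _ _ => trivial) fun _ _ => le_rfl)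
  refine (h'.congr fun q _ => ?_).mono (fun _ h => h) fun q _ => ?_
  · dsimp only
    split_ifs with hq
    · rw [foldl_replicate_eq (divStep q.2), divStep_iterate_fst (Nat.pos_of_ne_zero hq)]
    · rw [not_not] at hq
      rw [hq, Nat.div_zero]
  · have := (Nat.cast_nonneg q.1 : (0 : ℝ) ≤ q.1)
    split_ifs
    · simp only [List.length_replicate]
      linarith
    · linarith

open Polynomial in
theorem polyTime_add : PolyTime fun q : ℕ × ℕ => q.1 + q.2 := by
  refine .of_bounds (100 * X) X detComp_add (fun q => ?_) fun q => ?_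
  · rw [show esize q = esize q.1 + esize q.2 + 1 from rfl, esize_nat, esize_nat]
    simp only [eval_mul, eval_X, eval_ofNat]
    push_cast
    have := (Nat.cast_nonneg q.1 : (0 : ℝ) ≤ q.1)
    have := (Nat.cast_nonneg q.2 : (0 : ℝ) ≤ q.2)
    linarith
  · rw [show esize q = esize q.1 + esize q.2 + 1 from rfl, esize_nat, esize_nat, esize_nat]
    simp only [eval_X]
    omega

open Polynomial in
theorem polyTime_sub : PolyTime fun q : ℕ × ℕ => q.1 - q.2 := by
  refine .of_bounds (100 * X) X detComp_sub (fun q => ?_) fun q => ?_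
  · rw [show esize q = esize q.1 + esize q.2 + 1 from rfl, esize_nat, esize_nat]
    simp only [eval_mul, eval_X, eval_ofNat]
    push_cast
    have := (Nat.cast_nonneg q.1 : (0 : ℝ) ≤ q.1)
    have := (Nat.cast_nonneg q.2 : (0 : ℝ) ≤ q.2)
    linarith
  · rw [show esize q = esize q.1 + esize q.2 + 1 from rfl, esize_nat, esize_nat, esize_nat]
    simp only [eval_X]
    omega

open Polynomial in
theorem polyTime_mul : PolyTime fun q : ℕ × ℕ => q.1 * q.2 := by
  refine .of_bounds (1000 * X ^ 2) (X ^ 2) detComp_mul (fun q => ?_) fun q => ?_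
  · rw [show esize q = esize q.1 + esize q.2 + 1 from rfl, esize_nat, esize_nat]
    simp only [eval_mul, eval_X, eval_ofNat, eval_pow]
    push_cast
    have h1 := (Nat.cast_nonneg q.1 : (0 : ℝ) ≤ q.1)
    have h2 := (Nat.cast_nonneg q.2 : (0 : ℝ) ≤ q.2)
    nlinarith [mul_nonneg h1 h2]
  · rw [show esize q = esize q.1 + esize q.2 + 1 from rfl, esize_nat, esize_nat, esize_nat]
    simp only [eval_X, eval_pow]
    nlinarith [Nat.zero_le (q.1 * q.2)]

open Polynomial in
theorem polyTime_div : PolyTime fun q : ℕ × ℕ => q.1 / q.2 := by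
  refine .of_bounds (200 * X) X detComp_div (fun q => ?_) fun q => ?_
  · rw [show esize q = esize q.1 + esize q.2 + 1 from rfl, esize_nat, esize_nat]
    simp only [eval_mul, eval_X, eval_ofNat]
    push_cast
    have := (Nat.cast_nonneg q.1 : (0 : ℝ) ≤ q.1)
    have := (Nat.cast_nonneg q.2 : (0 : ℝ) ≤ q.2)
    linarith
  · rw [show esize q = esize q.1 + esize q.2 + 1 from rfl, esize_nat, esize_nat, esize_nat]
    simp only [eval_X]
    have := Nat.div_le_self q.1 q.2
    omega

theorem PolyTime.add {f g : A → ℕ} (hf : PolyTime f) (hg : PolyTime g) :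
    PolyTime fun a => f a + g a := polyTime_add.comp₂ hf hg

theorem PolyTime.sub {f g : A → ℕ} (hf : PolyTime f) (hg : PolyTime g) :
    PolyTime fun a => f a - g a := polyTime_sub.comp₂ hf hg

theorem PolyTime.mul {f g : A → ℕ} (hf : PolyTime f) (hg : PolyTime g) :
    PolyTime fun a => f a * g a := polyTime_mul.comp₂ hf hg

theorem PolyTime.div {f g : A → ℕ} (hf : PolyTime f) (hg : PolyTime g) :
    PolyTime fun a => f a / g a := polyTime_div.comp₂ hf hg

open Polynomial in
theorem PolyTime.zero : PolyTime fun _ : A => (0 : ℕ) :=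
  .of_bounds 1 1 (DetComp.zero _) (by simp) fun _ => by simp [esize_nat]

open Polynomial in
theorem polyTime_succ : PolyTime fun n : ℕ => n + 1 :=
  .of_bounds 3 (X + 2) (DetComp.succ _) (by simp) fun n => by
    simp only [esize_nat, eval_add, eval_X, eval_ofNat]
    omega

theorem PolyTime.natConst (k : ℕ) : PolyTime fun _ : A => k := by
  induction k with
  | zero => exact .zero
  | succ k ih => exact polyTime_succ.comp ih

theorem PolyTime.pow {f : A → ℕ} (hf : PolyTime f) (k : ℕ) : PolyTime fun a => f a ^ k := by
  induction k with
  | zero => simpa using PolyTime.natConst 1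
  | succ k ih => simpa [pow_succ] using ih.mul hf

open Polynomial in
theorem polyTime_replicate : PolyTime fun n : ℕ => List.replicate n (0 : ℕ) :=
  .of_bounds 1 X (DetComp.replicate _) (by simp) fun n => by
    simp only [eval_X]
    induction n with
    | zero => rfl
    | succ n ih =>
      rw [List.replicate_succ, esize_cons, esize_nat, esize_nat]
      rw [esize_nat] at ih
      omega

theorem foldl_replicate_sum (f : ℕ → ℕ) (n : ℕ) :
    (List.replicate n (0 : ℕ)).foldl (fun (s : ℕ × ℕ) _ => (s.1 + 1, s.2 + f s.1)) (0, 0) =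
      (n, ∑ i ∈ Finset.range n, f i) := by
  rw [foldl_replicate_eq fun s : ℕ × ℕ => (s.1 + 1, s.2 + f s.1)]
  induction n with
  | zero => rfl
  | succ n ih => rw [Function.iterate_succ_apply', ih, Finset.sum_range_succ]

-- The accumulator carries the index along with the partial sum. Partial sums are at most the number
-- of terms times a bound for one term, so their unary codes stay polynomial.
open Polynomial in
theorem PolyTime.sum {N : A → ℕ} {f : A × ℕ → ℕ} (hN : PolyTime N) (hf : PolyTime f) :
    PolyTime fun a => ∑ i ∈ Finset.range (N a), f (a, i) := by
  have hs : PolyTime fun q : A × (ℕ × ℕ) × ℕ => (q.2.1.1 + 1, q.2.1.2 + f (q.1, q.2.1.1)) := by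
    have h1 : PolyTime fun q : A × (ℕ × ℕ) × ℕ => q.2.1 := PolyTime.fst.comp .snd
    have h2 := PolyTime.fst.comp h1
    exact (polyTime_succ.comp h2).pair
      ((PolyTime.snd.comp h1).add (hf.comp (PolyTime.fst.pair h2)))
  have hN' := hN
  obtain ⟨PN, -, hPN⟩ := hN'
  obtain ⟨Pf, -, hPf⟩ := hf
  have h := PolyTime.foldl (polyTime_replicate.comp hN)
    (PolyTime.zero.pair PolyTime.zero : PolyTime fun _ : A => ((0 : ℕ), (0 : ℕ))) hs
    (2 * PN + 2 * (PN * Pf.comp (X + PN + 1)) + 3) ?_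
  · have := PolyTime.snd.comp h
    convert this using 2 with a
    exact (congrArg Prod.snd (foldl_replicate_sum (fun i => f (a, i)) (N a))).symm
  · intro a r r' hr
    obtain ⟨k, rfl⟩ : ∃ k, r = List.replicate k 0 := by
      refine ⟨r.length, List.eq_replicate_of_mem fun b hb => ?_⟩
      exact List.eq_of_mem_replicate (hr ▸ List.mem_append_left r' hb)
    have hk : k ≤ N a := by
      have := congrArg List.length hr
      simp at this
      omega
    have hNa := hPN a
    rw [esize_nat] at hNa
    rw [foldl_replicate_sum (fun i => f (a, i)) k]
    simp only [esize_pair, esize_nat, eval_add, eval_mul, eval_ofNat, eval_comp, eval_X, eval_one]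
    have : ∑ i ∈ Finset.range k, f (a, i) ≤
        PN.eval (esize a) * Pf.eval (esize a + PN.eval (esize a) + 1) := by
      calc ∑ i ∈ Finset.range k, f (a, i)
          ≤ ∑ i ∈ Finset.range k, Pf.eval (esize a + PN.eval (esize a) + 1) := by
            refine Finset.sum_le_sum fun i hi => ?_
            rw [Finset.mem_range] at hi
            have h1 := hPf (a, i)
            rw [esize_nat] at h1
            have h2 : Pf.eval (esize (a, i)) ≤ _ :=
              Pf.eval_mono_nat (b := esize a + PN.eval (esize a) + 1)
              (by rw [esize_pair, esize_nat]; omega)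
            dsimp only at h2
            omega
        _ = k * Pf.eval (esize a + PN.eval (esize a) + 1) := by simp
        _ ≤ _ := Nat.mul_le_mul_right _ (by omega)
    omega

end

/-! ### Lists of strings -/

section
variable {A B C σ β : Type} [Enc A] [Enc B] [Enc C] [Enc σ] [Enc β]

open Polynomial

theorem PolyTime.iteNat {g : A → ℕ} {f₁ f₂ : A → B} (hg : PolyTime g)
    (h₁ : PolyTime f₁) (h₂ : PolyTime f₂) : PolyTime fun a => if g a ≠ 0 then f₁ a else f₂ a :=
  .ite hg (fun a => enc_nat_ne_nil (g a)) h₁ h₂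

theorem polyTime_listCons : PolyTime fun q : A × List A => q.1 :: q.2 :=
  .of_bounds 1 X (DetComp.listCons _) (by simp) fun q => by
    simp only [eval_X]
    exact le_of_eq rfl

theorem esize_tail_le (l : List A) : esize l.tail ≤ esize l := by
  cases l with
  | nil => simp
  | cons a l => rw [esize_cons, List.tail_cons]; omega

theorem polyTime_tail : PolyTime fun l : List A => l.tail :=
  .of_bounds 1 X (DetComp.tail _) (by simp) fun l => by simpa using esize_tail_le l

theorem esize_bool_le (b : Bool) : esize b ≤ 3 := by cases b <;> decide

theorem polyTime_headBit : PolyTime fun l : List Bool => (l.headD false).toNat :=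
  .of_bounds 3 3 ((DetComp.toNat fun _ => True).comp (DetComp.headD rfl fun _ => True) fun _ _ => trivial)
    (fun l => by norm_num) fun l => by
      rw [esize_nat]
      simp only [eval_ofNat]
      cases l.headD false <;> simp

theorem polyTime_toNat : PolyTime Bool.toNat :=
  .of_bounds 1 3 (DetComp.toNat _) (by simp) fun b => by
      rw [esize_nat]
      simp only [eval_ofNat]
      cases b <;> simp

theorem polyTime_length : PolyTime fun l : List A => l.length := by
  have hs : PolyTime fun q : List A × ℕ × A => q.2.1 + 1 :=
    polyTime_succ.comp (PolyTime.fst.comp .snd)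
  have hl (l : List A) : l.foldl (fun s _ => s + 1) 0 = l.length := by
    induction l using List.reverseRecOn with
    | nil => rfl
    | append_singleton l a ih => simp [ih]
  have h := PolyTime.foldl (l := fun l : List A => l) (init := fun _ => (0 : ℕ))
    PolyTime.id .zero hs (2 * X + 1) ?_
  · convert h using 2 with l
    exact (hl l).symm
  · intro l r r' hr
    simp only [hl, esize_nat, eval_add, eval_mul, eval_X, eval_ofNat, eval_one]
    have := length_le_esize l
    have := congrArg List.length hr
    simp only [List.length_append] at this
    omega

/-- One step of the comparison of two strings: the state consists of the rest of the second string
and of a bit. -/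
def eqStep (s : List Bool × ℕ) (b : Bool) : List Bool × ℕ :=
  (s.1.tail, if s.2 ≠ 0 then if s.1 ≠ [] then
    if b.toNat ≠ 0 then (s.1.headD false).toNat else 1 - (s.1.headD false).toNat else 0 else 0)

/-- The bit of the final state, provided that the second string has been read to its end. -/
def eqOut (s : List Bool × ℕ) : ℕ := if s.1 ≠ [] then 0 else s.2

/-- `1` if the strings are equal, otherwise `0`. -/
def eqBit (q : List Bool × List Bool) : ℕ := eqOut (q.1.foldl eqStep (q.2, 1))

theorem foldl_eqStep_zero (s t : List Bool) : (s.foldl eqStep (t, 0)).2 = 0 := by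
  induction s generalizing t with
  | nil => rfl
  | cons b s ih => rw [List.foldl_cons]; exact ih _

theorem eqBit_eq (s t : List Bool) : eqBit (s, t) = if s = t then 1 else 0 := by
  change eqOut (s.foldl eqStep (t, 1)) = _
  induction s generalizing t with
  | nil => cases t <;> simp [eqOut]
  | cons b s ih =>
    rw [List.foldl_cons]
    cases t with
    | nil =>
      have : eqStep ([], 1) b = ([], 0) := by simp [eqStep]
      simp [this, foldl_eqStep_zero, eqOut]
    | cons b' t =>
      by_cases hb : b = b'
      · have : eqStep (b' :: t, 1) b = (t, 1) := by subst hb; cases b <;> simp [eqStep]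
        rw [this, ih t]
        simp [hb]
      · have : eqStep (b' :: t, 1) b = (t, 0) := by
          cases b <;> cases b' <;> simp_all [eqStep]
        rw [this, eqOut, foldl_eqStep_zero]
        simp [hb]

theorem polyTime_eqBit : PolyTime eqBit := by
  have hs : PolyTime fun q : (List Bool × List Bool) × (List Bool × ℕ) × Bool =>
      eqStep q.2.1 q.2.2 := by
    have h0 : PolyTime fun q : (List Bool × List Bool) × (List Bool × ℕ) × Bool => q.2.1 :=
      PolyTime.fst.comp .snd
    have h1 := PolyTime.fst.comp h0
    have h2 := PolyTime.snd.comp h0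
    have hb : PolyTime fun q : (List Bool × List Bool) × (List Bool × ℕ) × Bool => q.2.2.toNat :=
      polyTime_toNat.comp (PolyTime.snd.comp .snd)
    have hh := polyTime_headBit.comp h1
    exact (polyTime_tail.comp h1).pair (.iteNat h2 (.ite h1 (fun q => enc_list_ne_nil _)
      (.iteNat hb hh ((PolyTime.natConst 1).sub hh)) .zero) .zero)
  have h := PolyTime.foldl (PolyTime.fst (A := List Bool) (B := List Bool))
    (PolyTime.snd.pair (PolyTime.natConst 1)) hs (X + 5) ?_
  · exact .ite (PolyTime.fst.comp h) (fun q => enc_list_ne_nil _) .zero (PolyTime.snd.comp h)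
  · rintro ⟨s, t⟩ r r' -
    have key : ∀ (r t : List Bool) (k : ℕ), k ≤ 1 → esize (r.foldl eqStep (t, k)).1 ≤ esize t ∧
        (r.foldl eqStep (t, k)).2 ≤ 1 := by
      intro r
      induction r with
      | nil => exact fun t k hk => ⟨le_rfl, hk⟩
      | cons b r ih =>
        intro t k hk
        rw [List.foldl_cons]
        have h1 : (eqStep (t, k) b).2 ≤ 1 := by
          unfold eqStep
          dsimp only
          split_ifs
          · exact Bool.toNat_le _
          · omega
          · omega
          · omega
        have := ih (eqStep (t, k) b).1 (eqStep (t, k) b).2 h1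
        exact ⟨this.1.trans (esize_tail_le t), this.2⟩
    have := key r t 1 le_rfl
    have h3 : esize (r.foldl eqStep (t, 1)) = esize (r.foldl eqStep (t, 1)).1 +
      esize (r.foldl eqStep (t, 1)).2 + 1 := rfl
    rw [esize_nat] at h3
    change esize (r.foldl eqStep (t, 1)) ≤ _
    simp only [eval_add, eval_X, eval_ofNat, esize_pair]
    omega

/-- `1` if the string occurs in the list, otherwise `0`. -/
def memBit (q : List Bool × List (List Bool)) : ℕ :=
  q.2.foldl (fun s b => if eqBit (q.1, b) ≠ 0 then 1 else s) 0

theorem memBit_eq (x : List Bool) (l : List (List Bool)) :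
    memBit (x, l) = if x ∈ l then 1 else 0 := by
  unfold memBit
  induction l using List.reverseRecOn with
  | nil => simp
  | append_singleton l a ih =>
    rw [List.foldl_append, ih]
    simp only [List.foldl_cons, List.foldl_nil, eqBit_eq, List.mem_append, List.mem_singleton]
    by_cases h : x = a <;> simp [h]

theorem polyTime_memBit : PolyTime memBit := by
  have hs : PolyTime fun q : (List Bool × List (List Bool)) × ℕ × List Bool =>
      if eqBit (q.1.1, q.2.2) ≠ 0 then 1 else q.2.1 :=
    .iteNat (polyTime_eqBit.comp₂ (PolyTime.fst.comp .fst) (PolyTime.snd.comp .snd))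
      (.natConst 1) (PolyTime.fst.comp .snd)
  refine PolyTime.foldl (PolyTime.snd (A := List Bool) (B := List (List Bool))) .zero hs 3 ?_
  rintro ⟨x, l⟩ r r' -
  have := memBit_eq x r
  unfold memBit at this
  dsimp only at this ⊢
  rw [this, esize_nat]
  simp only [eval_ofNat]
  split_ifs <;> omega

/-- The union of two lists without repetitions. -/
def unionList (q : List (List Bool) × List (List Bool)) : List (List Bool) :=
  q.1.foldl (fun s b => if memBit (b, s) ≠ 0 then s else b :: s) q.2

theorem unionList_spec (X Y : List (List Bool)) (hY : Y.Nodup) :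
    (unionList (X, Y)).Nodup ∧ (unionList (X, Y)).toFinset = Y.toFinset ∪ X.toFinset := by
  unfold unionList
  induction X generalizing Y with
  | nil => simpa using hY
  | cons x X ih =>
    simp only [List.foldl_cons, memBit_eq]
    by_cases hx : x ∈ Y
    · simp only [hx, if_true, ne_eq, one_ne_zero, not_false_eq_true]
      obtain ⟨h1, h2⟩ := ih Y hY
      refine ⟨by simpa [memBit_eq] using h1, ?_⟩
      simp only [memBit_eq] at h2
      rw [h2]
      ext z
      simp only [Finset.mem_union, List.mem_toFinset, List.mem_cons]
      constructor
      · tauto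
      · rintro (h | rfl | h) <;> tauto
    · simp only [hx, if_false, ne_eq, not_true_eq_false]
      obtain ⟨h1, h2⟩ := ih (x :: Y) (List.nodup_cons.2 ⟨hx, hY⟩)
      refine ⟨by simpa [memBit_eq] using h1, ?_⟩
      simp only [memBit_eq] at h2
      rw [h2]
      ext z
      simp only [Finset.mem_union, List.mem_toFinset, List.mem_cons]
      tauto

theorem polyTime_unionList : PolyTime unionList := by
  have hs : PolyTime fun q : (List (List Bool) × List (List Bool)) × List (List Bool) × List Bool =>
      if memBit (q.2.2, q.2.1) ≠ 0 then q.2.1 else q.2.2 :: q.2.1 := by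
    have h1 : PolyTime fun q : (List (List Bool) × List (List Bool)) × List (List Bool) × List Bool
      => q.2.1 := PolyTime.fst.comp .snd
    have h2 : PolyTime fun q : (List (List Bool) × List (List Bool)) × List (List Bool) × List Bool
      => q.2.2 := PolyTime.snd.comp .snd
    exact .iteNat (polyTime_memBit.comp₂ h2 h1) h1 (polyTime_listCons.comp₂ h2 h1)
  refine PolyTime.foldl PolyTime.fst PolyTime.snd hs (2 * X) ?_
  rintro ⟨l, Y⟩ r r' hr
  have key : ∀ r Y : List (List Bool), esize (r.foldl
      (fun s b => if memBit (b, s) ≠ 0 then s else b :: s) Y) ≤ esize Y + esize r := by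
    intro r
    induction r with
    | nil => intro Y; simp
    | cons x r ih =>
      intro Y
      rw [List.foldl_cons]
      refine (ih _).trans ?_
      rw [esize_cons]
      split_ifs
      · omega
      · rw [esize_cons]; omega
  have h1 := key r Y
  have h2 : esize r ≤ esize l := by
    dsimp only at hr
    rw [← hr]
    clear h1 hr
    induction r with
    | nil => rw [esize_nil]; exact esize_pos _
    | cons x r ih => rw [List.cons_append, esize_cons, esize_cons]; omega
  simp only [eval_mul, eval_X, eval_ofNat, esize_pair]
  omega

end

/-! ### Approximating the base of the running time -/

/-- The size of the output follows from its value, not from the running time: a m ≤ m |x| + 1, and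
numbers are unary. -/
theorem PolyApproximable.exists_polyTime {x : ℝ} (h : PolyApproximable x) :
    ∃ a : ℕ → ℕ, PolyTime a ∧ ∀ m : ℕ, |m * x - a m| ≤ 1 := by
  obtain ⟨p, P, -, h⟩ := h
  choose a ha hp using h
  refine ⟨a, ?_, ha⟩
  refine PolyTime.of_bounds (T := fun m => (P.eval m : ℕ)) P (2 * ((⌈|x|⌉₊ : Polynomial ℕ) * .X) + 3)
    ⟨p, fun m _ => ?_⟩ (fun m => ?_) (fun m => ?_)
  · rw [PMF.pure_map]
    exact (hp m).runs
  · exact_mod_cast P.eval_mono_nat (by rw [esize_nat]; omega)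
  · have h1 : (a m : ℝ) ≤ m * |x| + 1 := by
      have := (abs_le.1 (ha m)).1
      have : (m : ℝ) * x ≤ m * |x| := by gcongr; exact le_abs_self x
      linarith
    have h2 : (a m : ℝ) ≤ (⌈|x|⌉₊ * (2 * m + 1) + 1 : ℕ) := by
      push_cast
      have h3 := Nat.le_ceil |x|
      have : (m : ℝ) * |x| ≤ m * ⌈|x|⌉₊ := by gcongr
      nlinarith [(Nat.cast_nonneg m : (0:ℝ) ≤ m), (Nat.cast_nonneg ⌈|x|⌉₊ : (0:ℝ) ≤ ⌈|x|⌉₊),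
        mul_nonneg (Nat.cast_nonneg m : (0:ℝ) ≤ m) (Nat.cast_nonneg ⌈|x|⌉₊ : (0:ℝ) ≤ ⌈|x|⌉₊)]
    have h2' : a m ≤ ⌈|x|⌉₊ * (2 * m + 1) + 1 := by exact_mod_cast h2
    simp only [esize_nat, Polynomial.eval_add, Polynomial.eval_mul, Polynomial.eval_natCast,
      Polynomial.eval_X, Polynomial.eval_ofNat, Nat.cast_id]
    omega

/-- `invSum m e / m ^ 2` is an approximation of `log (e / m)`. -/
def invSum (m e : ℕ) : ℕ := ∑ i ∈ Finset.range (e - m), m ^ 2 / (m + i)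

/-- The positive part of `m ^ 3 * (1 / j - (a / m - 1) / (m - j))`, rounded. -/
def slopeTerm (m a j : ℕ) : ℕ := m * (m ^ 2 / j) - (a - m) * (m ^ 2 / (m - j))

/-- The sum of the values of `slopeTerm` from `d` on. -/
def slopeSum (m a d : ℕ) : ℕ := ∑ i ∈ Finset.range (m - d), slopeTerm m a (d + i)

/-- `rootCount m a e / m` is an approximation of the number `δ < m / a` at which the divergence of
`m / a` and `δ` equals `m / a * log (e / m)`. -/
def rootCount (m a e : ℕ) : ℕ :=
  ∑ i ∈ Finset.range m, (1 - (m * invSum m e - slopeSum m a (i + 1)))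

/-- `baseNum m a e / m ^ 2` is an approximation of the base of the running time. -/
def baseNum (m a e : ℕ) : ℕ := m ^ 2 + rootCount m a e * (e - m)

section
variable {A : Type} [Enc A]

theorem PolyTime.invSum {m e : A → ℕ} (hm : PolyTime m) (he : PolyTime e) :
    PolyTime fun x => invSum (m x) (e x) :=
  .sum (f := fun q : A × ℕ => m q.1 ^ 2 / (m q.1 + q.2)) (he.sub hm)
    (((hm.comp .fst).pow 2).div ((hm.comp .fst).add .snd))

theorem PolyTime.slopeTerm {m a j : A → ℕ} (hm : PolyTime m) (ha : PolyTime a)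
    (hj : PolyTime j) : PolyTime fun x => slopeTerm (m x) (a x) (j x) :=
  (hm.mul ((hm.pow 2).div hj)).sub ((ha.sub hm).mul ((hm.pow 2).div (hm.sub hj)))

theorem PolyTime.slopeSum {m a d : A → ℕ} (hm : PolyTime m) (ha : PolyTime a)
    (hd : PolyTime d) : PolyTime fun x => slopeSum (m x) (a x) (d x) :=
  .sum (f := fun q : A × ℕ => _root_.slopeTerm (m q.1) (a q.1) (d q.1 + q.2)) (hm.sub hd)
    (.slopeTerm (hm.comp .fst) (ha.comp .fst) ((hd.comp .fst).add .snd))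

theorem PolyTime.baseNum {m a e : A → ℕ} (hm : PolyTime m) (ha : PolyTime a)
    (he : PolyTime e) : PolyTime fun x => baseNum (m x) (a x) (e x) := by
  refine (hm.pow 2).add (PolyTime.mul ?_ (he.sub hm))
  exact .sum (f := fun q : A × ℕ => 1 - (m q.1 * _root_.invSum (m q.1) (e q.1) -
      _root_.slopeSum (m q.1) (a q.1) (q.2 + 1))) hm
    ((PolyTime.natConst 1).sub (((hm.comp .fst).mul (.invSum (hm.comp .fst) (he.comp .fst))).sub
      (.slopeSum (hm.comp .fst) (ha.comp .fst) (polyTime_succ.comp .snd))))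

end

/-- An antiderivative of `1 / s - (α - 1) / (1 - s)`. -/
noncomputable def logGap (α s : ℝ) : ℝ := Real.log s + (α - 1) * Real.log (1 - s)

/-- Concavity of both logarithms, in the form log u ≤ u - 1; the second one enters with the
nonnegative weight α - 1. -/
theorem logGap_le_tangent {α x y : ℝ} (hα : 1 ≤ α) (hx : 0 < x) (hx1 : x < 1) (hy : 0 < y)
    (hy1 : y < 1) : logGap α x ≤ logGap α y + (x - y) * (1 / y - (α - 1) / (1 - y)) := by
  have h1 : Real.log x - Real.log y ≤ x / y - 1 := by
    rw [← Real.log_div hx.ne' hy.ne']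
    exact Real.log_le_sub_one_of_pos (by positivity)
  have h1y : 0 < 1 - y := by linarith
  have h1x : 0 < 1 - x := by linarith
  have h2 : Real.log (1 - x) - Real.log (1 - y) ≤ (1 - x) / (1 - y) - 1 := by
    rw [← Real.log_div h1x.ne' h1y.ne']
    exact Real.log_le_sub_one_of_pos (by positivity)
  have h3 := mul_le_mul_of_nonneg_left h2 (sub_nonneg.2 hα)
  have h4 : (x - y) * (1 / y - (α - 1) / (1 - y)) =
      (x / y - 1) + (α - 1) * ((1 - x) / (1 - y) - 1) := by
    field_simp
    ring
  unfold logGap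
  linarith

/-- For α > 1 the tangent at 1 / α is horizontal. For α = 1 this point is the end of the interval
and `logGap` is just the logarithm. -/
theorem logGap_le_max {α x : ℝ} (hα : 1 ≤ α) (hx : 0 < x) (hx1 : x < 1) :
    logGap α x ≤ logGap α (1 / α) := by
  rcases hα.eq_or_lt with rfl | hα'
  · simpa [logGap] using Real.log_nonpos hx.le hx1.le
  · have h := logGap_le_tangent hα hx hx1 (y := 1 / α) (by positivity)
      (by rw [div_lt_one (by linarith)]; exact hα')
    have : 1 / (1 / α) - (α - 1) / (1 - 1 / α) = 0 := by
      have : α - 1 ≠ 0 := by linarith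
      field_simp
      simp
    rw [this] at h
    linarith

/-- This turns the equation for γ into logGap(1/α) - logGap(δ) = log c, the form used from here on.
For α = 1 the second term of the divergence vanishes by its factor 0. -/
theorem mul_bernoulliKL {α δ : ℝ} (hα : 1 ≤ α) (hδ : 0 < δ) (hδ1 : δ < 1 / α) :
    α * bernoulliKL (1 / α) δ = logGap α (1 / α) - logGap α δ := by
  have h0 : 0 < α := by linarith
  have h1 : δ < 1 := hδ1.trans_le (by rw [div_le_one h0]; exact hα)
  unfold bernoulliKL logGap
  rw [Real.log_div (by positivity) hδ.ne']
  rcases hα.eq_or_lt with rfl | hα'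
  · simp
  · have h2 : 1 / α < 1 := by rw [div_lt_one h0]; exact hα'
    rw [Real.log_div (x := 1 - 1 / α) (y := 1 - δ) (by linarith) (by linarith)]
    generalize Real.log (1 - 1 / α) = u
    generalize Real.log (1 - δ) = v
    generalize Real.log (1 / α) = w
    field_simp
    ring

/-- In the variable δ = (γ-1)/(c-1) the left side of the equation is continuous and strictly
decreasing on (0, 1/α), vanishes at 1/α and becomes as large as log c near 0. -/
theorem existsUnique_isAmls {α c : ℝ} (hα : 1 ≤ α) (hc : 1 < c) : ∃! γ, IsAmls α c γ := by
  have h0 : 0 < α := by linarith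
  have hc0 : 0 < c - 1 := by linarith
  have hinv : 1 / α ≤ 1 := by rw [div_le_one h0]; exact hα
  have hlc := Real.log_pos hc
  have key : ∀ γ, IsAmls α c γ ↔ (0 < (γ - 1) / (c - 1) ∧ (γ - 1) / (c - 1) < 1 / α) ∧
      logGap α (1 / α) - logGap α ((γ - 1) / (c - 1)) = Real.log c := by
    intro γ
    have e1 : γ ∈ Set.Ioo 1 (1 + (c - 1) / α) ↔
        (0 < (γ - 1) / (c - 1) ∧ (γ - 1) / (c - 1) < 1 / α) := by
      rw [Set.mem_Ioo, div_pos_iff_of_pos_right hc0, div_lt_iff₀ hc0, sub_pos]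
      refine and_congr Iff.rfl ?_
      rw [one_div_mul_eq_div]
      constructor <;> intro h <;> linarith
    unfold IsAmls
    rw [e1]
    refine and_congr_right fun h => ?_
    rw [← mul_bernoulliKL hα h.1 h.2, eq_div_iff h0.ne', mul_comm]
  have hcont : ContinuousOn (fun s => logGap α (1 / α) - logGap α s) (Set.Ioc 0 (1 / α)) := by
    refine continuousOn_const.sub ?_
    unfold logGap
    refine ContinuousOn.add (Real.continuousOn_log.mono fun s hs => hs.1.ne') ?_
    rcases hα.eq_or_lt with rfl | hα'
    · simpa using continuousOn_const
    · refine continuousOn_const.mul (ContinuousOn.log (by fun_prop) fun s hs => ?_)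
      have : 1 / α < 1 := by rw [div_lt_one h0]; exact hα'
      linarith [hs.2]
  -- The tangent at y lies above the graph and has positive slope, since α y < 1.
  have hanti : ∀ x y : ℝ, 0 < x → x < y → y < 1 / α → logGap α x < logGap α y := by
    intro x y hx hxy hy
    have h := logGap_le_tangent hα hx (by linarith) (y := y) (by linarith) (by linarith)
    have hy0 : 0 < y := by linarith
    have hy1 : 0 < 1 - y := by linarith
    have : 0 < 1 / y - (α - 1) / (1 - y) := by
      rw [div_sub_div _ _ hy0.ne' hy1.ne']
      refine div_pos ?_ (by positivity)
      rw [lt_div_iff₀ h0] at hy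
      linarith
    nlinarith
  obtain ⟨δ, hδ, hδe⟩ : ∃ δ ∈ Set.Ioo 0 (1 / α), logGap α (1 / α) - logGap α δ = Real.log c := by
    -- With κ = (1 - 1/α)^(α-1), logGap(1/α) = log κ - log α. At s = κ / (α c) the gap is therefore
    -- log c - (α - 1) log(1 - s), which is at least log c.
    set κ : ℝ := Real.exp ((α - 1) * Real.log (1 - 1 / α)) with hκ
    have hκ1 : κ ≤ 1 := by
      rw [hκ, Real.exp_le_one_iff]
      refine mul_nonpos_of_nonneg_of_nonpos (by linarith) (Real.log_nonpos (by linarith) ?_)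
      have : 0 < 1 / α := by positivity
      linarith
    have hκ0 : 0 < κ := Real.exp_pos _
    set s : ℝ := κ / (α * c) with hs
    have hs0 : 0 < s := by positivity
    have hs1 : s < 1 / α := by
      rw [hs, div_lt_div_iff₀ (by positivity) h0]
      nlinarith [mul_pos h0 hc0]
    have hval : Real.log c ≤ logGap α (1 / α) - logGap α s := by
      unfold logGap
      have e1 : Real.log s = Real.log κ - (Real.log α + Real.log c) := by
        rw [hs, Real.log_div hκ0.ne' (by positivity), Real.log_mul h0.ne' (by linarith)]
      rw [e1, hκ, Real.log_exp, one_div, Real.log_inv]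
      have : (α - 1) * Real.log (1 - s) ≤ 0 :=
        mul_nonpos_of_nonneg_of_nonpos (by linarith)
          (Real.log_nonpos (by linarith) (by linarith))
      linarith
    have hmem := intermediate_value_Icc' hs1.le (hcont.mono fun t ht =>
      ⟨hs0.trans_le ht.1, ht.2⟩) (show Real.log c ∈ Set.Icc _ _ from ⟨by simpa using hlc.le, hval⟩)
    obtain ⟨δ, hδ, hδe⟩ := hmem
    refine ⟨δ, ⟨hs0.trans_le hδ.1, lt_of_le_of_ne hδ.2 ?_⟩, hδe⟩
    rintro rfl
    simp only [sub_self] at hδe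
    linarith
  refine ⟨1 + δ * (c - 1), (key _).2 ?_, fun γ hγ => ?_⟩
  · have : (1 + δ * (c - 1) - 1) / (c - 1) = δ := by
      rw [add_sub_cancel_left, mul_div_assoc, div_self hc0.ne', mul_one]
    rw [this]
    exact ⟨hδ, hδe⟩
  · obtain ⟨⟨h1, h2⟩, h3⟩ := (key γ).1 hγ
    have : (γ - 1) / (c - 1) = δ := by
      rcases lt_trichotomy ((γ - 1) / (c - 1)) δ with h | h | h
      · have := hanti _ _ h1 h hδ.2
        linarith
      · exact h
      · have := hanti _ _ hδ.1 h h2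
        linarith
    rw [← this]
    field_simp
    ring

/-! ### Rounding errors of the Riemann sums -/

section
variable {m : ℕ}

theorem div_le_nat_div_add_one (x y : ℕ) : (x : ℝ) / y - 1 ≤ ((x / y : ℕ) : ℝ) := by
  rcases Nat.eq_zero_or_pos y with rfl | hy
  · simp
  · have := Nat.lt_div_mul_add (a := x) hy
    have hy' : (0 : ℝ) < y := by exact_mod_cast hy
    rw [sub_le_iff_le_add, div_le_iff₀ hy']
    have h : (x : ℝ) < (x / y : ℕ) * y + y := by exact_mod_cast this
    linarith

theorem log_succ_sub_log_le {x : ℝ} (hx : 0 < x) : Real.log (x + 1) - Real.log x ≤ 1 / x := by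
  rw [← Real.log_div (by linarith) hx.ne']
  have := Real.log_le_sub_one_of_pos (x := (x + 1) / x) (by positivity)
  have e : (x + 1) / x - 1 = 1 / x := by field_simp; ring
  linarith

theorem le_log_succ_sub_log {x : ℝ} (hx : 0 < x) :
    1 / (x + 1) ≤ Real.log (x + 1) - Real.log x := by
  rw [← Real.log_div (by linarith) hx.ne']
  have := Real.one_sub_inv_le_log_of_pos (x := (x + 1) / x) (by positivity)
  have e : 1 - ((x + 1) / x)⁻¹ = 1 / (x + 1) := by field_simp; ring
  linarith

theorem sum_inv_bounds (hm : 0 < m) (N : ℕ) :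
    Real.log ((m + N) / m) ≤ ∑ i ∈ Finset.range N, 1 / ((m : ℝ) + i) ∧
    ∑ i ∈ Finset.range N, 1 / ((m : ℝ) + i) ≤ Real.log ((m + N) / m) + 1 / m := by
  have hm' : (0 : ℝ) < m := by exact_mod_cast hm
  rw [Real.log_div (by positivity) hm'.ne']
  -- The extra term -1/(m+N) makes the induction telescope; it is dropped afterwards.
  have h2 : ∑ i ∈ Finset.range N, 1 / ((m : ℝ) + i) ≤
      Real.log (m + N) - Real.log m + 1 / m - 1 / (m + N) := by
    induction N with
    | zero => simp
    | succ N ih =>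
      rw [Finset.sum_range_succ]
      have := le_log_succ_sub_log (x := (m : ℝ) + N) (by positivity)
      push_cast
      rw [← add_assoc]
      linarith
  refine ⟨?_, ?_⟩
  · clear h2
    induction N with
    | zero => simp
    | succ N ih =>
      rw [Finset.sum_range_succ]
      have := log_succ_sub_log_le (x := (m : ℝ) + N) (by positivity)
      push_cast
      rw [← add_assoc]
      linarith
  · have : (0 : ℝ) ≤ 1 / (m + N) := by positivity
    linarith

theorem abs_log_sub_log_le {x y : ℝ} (hx : 1 ≤ x) (hy : 1 ≤ y) :
    |Real.log x - Real.log y| ≤ |x - y| := by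
  have key : ∀ x y : ℝ, 1 ≤ x → 1 ≤ y → Real.log x - Real.log y ≤ |x - y| := by
    intro x y hx hy
    rw [← Real.log_div (by linarith) (by linarith)]
    have h1 := Real.log_le_sub_one_of_pos (x := x / y) (by positivity)
    have e : x / y - 1 = (x - y) / y := by field_simp
    have h2 : (x - y) / y ≤ |x - y| := by
      rw [div_le_iff₀ (by linarith)]
      nlinarith [le_abs_self (x - y), abs_nonneg (x - y)]
    linarith
  rw [abs_le]
  have h1 := key x y hx hy
  have h2 := key y x hy hx
  rw [abs_sub_comm] at h2
  constructor <;> linarith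

/-- Three errors add up: the Riemann sum of 1/x from m to m + N differs from the integral by at most
1/m, replacing (m + N)/m by c costs at most 1/m since log is 1-Lipschitz on [1, ∞), and rounding
down the N terms costs N/m² ≤ c/m. The last one has the opposite sign to the first. -/
theorem invSum_bounds {c : ℝ} (hc : 1 < c) (hm : 0 < m) {e : ℕ} (he : |m * c - e| ≤ 1) :
    |(invSum m e : ℝ) / m ^ 2 - Real.log c| ≤ (c + 1) / m := by
  have hm' : (0 : ℝ) < m := by exact_mod_cast hm
  have hm1 : (1 : ℝ) ≤ m := by exact_mod_cast hm
  set N := e - m with hN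
  have hN1 : |(N : ℝ) - (c - 1) * m| ≤ 1 := by
    rw [abs_le] at he ⊢
    rcases le_total m e with h | h
    · rw [hN, Nat.cast_sub h]
      constructor <;> linarith
    · rw [hN, Nat.sub_eq_zero_of_le h]
      have : (e : ℝ) ≤ m := by exact_mod_cast h
      have := mul_pos (sub_pos.2 hc) hm'
      simp only [CharP.cast_eq_zero]
      constructor <;> linarith
  have hNu : (N : ℝ) ≤ c * m := by
    have := (abs_le.1 hN1).2
    linarith
  obtain ⟨hs1, hs2⟩ := sum_inv_bounds hm N
  have hlog : |Real.log ((m + N) / m) - Real.log c| ≤ 1 / m := by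
    refine (abs_log_sub_log_le ?_ hc.le).trans ?_
    · rw [le_div_iff₀ hm']
      linarith [(Nat.cast_nonneg N : (0 : ℝ) ≤ N)]
    · have : ((m : ℝ) + N) / m - c = (N - (c - 1) * m) / m := by field_simp; ring
      rw [this, abs_div, abs_of_pos hm']
      gcongr
  have hup : (invSum m e : ℝ) / m ^ 2 ≤ ∑ i ∈ Finset.range N, 1 / ((m : ℝ) + i) := by
    rw [div_le_iff₀ (by positivity), invSum, Finset.sum_mul]
    push_cast
    refine Finset.sum_le_sum fun i _ => ?_
    refine Nat.cast_div_le.trans (le_of_eq ?_)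
    push_cast
    field_simp
  have hlo : ∑ i ∈ Finset.range N, 1 / ((m : ℝ) + i) - N / m ^ 2 ≤ (invSum m e : ℝ) / m ^ 2 := by
    rw [le_div_iff₀ (by positivity), invSum, sub_mul, Finset.sum_mul]
    push_cast
    have : ∑ i ∈ Finset.range N, (1 / ((m : ℝ) + i) * m ^ 2 - 1) ≤
        ∑ i ∈ Finset.range N, ((m ^ 2 / (m + i) : ℕ) : ℝ) := by
      refine Finset.sum_le_sum fun i _ => ?_
      have := div_le_nat_div_add_one (m ^ 2) (m + i)
      push_cast at this
      rw [one_div_mul_eq_div]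
      exact_mod_cast this
    rw [Finset.sum_sub_distrib] at this
    simp only [Finset.sum_const, Finset.card_range, nsmul_eq_mul, mul_one] at this
    have e2 : (N : ℝ) / m ^ 2 * m ^ 2 = N := by field_simp
    rw [e2]
    exact_mod_cast this
  have h3 : (N : ℝ) / m ^ 2 ≤ c / m := by
    rw [div_le_div_iff₀ (by positivity) hm']
    nlinarith
  rw [abs_le] at hlog ⊢
  have : (c + 1) / m = c / m + 1 / m := by ring
  have : 1 / (m : ℝ) ≤ c / m := by gcongr
  constructor <;> linarith

/-- Read backwards, the sum is part of a harmonic number. This is the source of the factor 1 + log m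
in the later error bounds. -/
theorem sum_inv_reflect_le (d : ℕ) :
    ∑ j ∈ Finset.Ico d m, 1 / ((m : ℝ) - j) ≤ 1 + Real.log m := by
  have h1 : ∑ j ∈ Finset.Ico d m, 1 / ((m : ℝ) - j) ≤ ∑ j ∈ Finset.range m, 1 / ((m : ℝ) - j) := by
    refine Finset.sum_le_sum_of_subset_of_nonneg ?_ ?_
    · intro j hj
      simp only [Finset.mem_Ico, Finset.mem_range] at *
      omega
    · intro j hj _
      rw [Finset.mem_range] at hj
      have : (j : ℝ) < m := by exact_mod_cast hj
      exact one_div_nonneg.2 (by linarith)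
  refine h1.trans ?_
  rw [← Finset.sum_range_reflect]
  have h2 := harmonic_le_one_add_log m
  refine le_trans (le_of_eq ?_) h2
  unfold harmonic
  push_cast
  refine Finset.sum_congr rfl fun j hj => ?_
  rw [Finset.mem_range] at hj
  rw [one_div, Nat.cast_sub (by omega), Nat.cast_sub (by omega)]
  congr 1
  push_cast
  ring

theorem slopeSum_eq (m a d : ℕ) : slopeSum m a d = ∑ j ∈ Finset.Ico d m, slopeTerm m a j := by
  rw [Finset.sum_Ico_eq_sum_range]
  rfl

theorem slopeSum_anti {a d d' : ℕ} (h : d ≤ d') : slopeSum m a d' ≤ slopeSum m a d := by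
  rw [slopeSum_eq, slopeSum_eq]
  exact Finset.sum_le_sum_of_subset (Finset.Ico_subset_Ico_left h)

/-- Rounding m²/j down costs 1/m², and replacing a - m by (α - 1) m costs at most 1/(m (m - j))
after division by m³. Rounding m²/(m - j) down and truncating the difference at 0 only help. -/
theorem slopeTerm_lower {α : ℝ} (hα : 1 ≤ α) {a : ℕ} (ha : |m * α - a| ≤ 1) {j : ℕ} (hj : 1 ≤ j)
    (hjm : j < m) :
    1 / (j : ℝ) - (α - 1) / (m - j) - (1 / m ^ 2 + 1 / m * (1 / (m - j))) ≤
      (slopeTerm m a j : ℝ) / m ^ 3 := by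
  have hm' : (0 : ℝ) < m := by exact_mod_cast (by omega : 0 < m)
  have hj' : (0 : ℝ) < j := by exact_mod_cast (by omega : 0 < j)
  have hmj : (0 : ℝ) < m - j := by
    have : (j : ℝ) < m := by exact_mod_cast hjm
    linarith
  have hsub : ((a - m : ℕ) : ℝ) ≤ (α - 1) * m + 1 := by
    rcases le_total m a with h | h
    · rw [Nat.cast_sub h]
      linarith [(abs_le.1 ha).1]
    · rw [Nat.sub_eq_zero_of_le h]
      have := mul_nonneg (sub_nonneg.2 hα) hm'.le
      simp only [CharP.cast_eq_zero]
      linarith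
  have h1 := div_le_nat_div_add_one (m ^ 2) j
  have h2 : ((m ^ 2 / (m - j) : ℕ) : ℝ) ≤ m ^ 2 / (m - j) := by
    have := Nat.cast_div_le (α := ℝ) (m := m ^ 2) (n := m - j)
    rw [Nat.cast_sub hjm.le] at this
    exact_mod_cast this
  have h3 : (m : ℝ) * (m ^ 2 / j : ℕ) - (a - m : ℕ) * (m ^ 2 / (m - j) : ℕ) ≤ slopeTerm m a j := by
    unfold slopeTerm
    rw [sub_le_iff_le_add]
    norm_cast
    omega
  have h4 : ((a - m : ℕ) : ℝ) * (m ^ 2 / (m - j) : ℕ) ≤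
      ((α - 1) * m + 1) * (m ^ 2 / (m - j)) := by
    gcongr
  have h5 : (m : ℝ) * ((m : ℝ) ^ 2 / j - 1) ≤ m * (m ^ 2 / j : ℕ) := by
    gcongr
    exact_mod_cast h1
  rw [le_div_iff₀ (by positivity)]
  have e : (1 / (j : ℝ) - (α - 1) / (m - j) - (1 / m ^ 2 + 1 / m * (1 / (m - j)))) * m ^ 3 =
      m * ((m : ℝ) ^ 2 / j - 1) - ((α - 1) * m + 1) * (m ^ 2 / (m - j)) := by
    field_simp
    ring
  rw [e]
  linarith

/-- Here the rounding of m²/(m - j) matters; it is multiplied by a - m ≤ α m, which gives α/m² after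
division by m³. -/
theorem slopeTerm_upper {α : ℝ} (hα : 1 ≤ α) {a : ℕ} (ha : |m * α - a| ≤ 1) {j : ℕ} (hj : 1 ≤ j)
    (hjm : j < m) :
    (slopeTerm m a j : ℝ) / m ^ 3 ≤ max 0 (1 / (j : ℝ) - (α - 1) / (m - j)) +
      (α / m ^ 2 + 1 / m * (1 / (m - j))) := by
  have hm' : (0 : ℝ) < m := by exact_mod_cast (by omega : 0 < m)
  have hm1 : (1 : ℝ) ≤ m := by exact_mod_cast (by omega : 1 ≤ m)
  have hj' : (0 : ℝ) < j := by exact_mod_cast (by omega : 0 < j)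
  have hmj : (0 : ℝ) < m - j := by
    have : (j : ℝ) < m := by exact_mod_cast hjm
    linarith
  have hsub : |((a - m : ℕ) : ℝ) - (α - 1) * m| ≤ 1 := by
    rw [abs_le] at ha ⊢
    rcases le_total m a with h | h
    · rw [Nat.cast_sub h]
      constructor <;> linarith
    · rw [Nat.sub_eq_zero_of_le h]
      have := mul_nonneg (sub_nonneg.2 hα) hm'.le
      have : (a : ℝ) ≤ m := by exact_mod_cast h
      simp only [CharP.cast_eq_zero]
      constructor <;> linarith
  have h1 : ((m ^ 2 / j : ℕ) : ℝ) ≤ m ^ 2 / j := by exact_mod_cast Nat.cast_div_le (α := ℝ)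
  have h2 : (m : ℝ) ^ 2 / (m - j) - 1 ≤ ((m ^ 2 / (m - j) : ℕ) : ℝ) := by
    have := div_le_nat_div_add_one (m ^ 2) (m - j)
    rw [Nat.cast_sub hjm.le] at this
    exact_mod_cast this
  have h4 : (α - 1) * m * (m ^ 2 / (m - j)) - m ^ 2 / (m - j) - α * m ≤
      ((a - m : ℕ) : ℝ) * (m ^ 2 / (m - j) : ℕ) := by
    have hx : (0 : ℝ) ≤ m ^ 2 / (m - j) := by positivity
    have hb := mul_le_mul_of_nonneg_left h2 (Nat.cast_nonneg (a - m) : (0 : ℝ) ≤ (a - m : ℕ))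
    have hl := (abs_le.1 hsub).1
    have hu := (abs_le.1 hsub).2
    nlinarith
  have h5 : (slopeTerm m a j : ℝ) ≤ max 0 (m * (m ^ 2 / j) -
      ((α - 1) * m * (m ^ 2 / (m - j)) - m ^ 2 / (m - j) - α * m)) := by
    unfold slopeTerm
    rcases le_total (m * (m ^ 2 / j)) ((a - m) * (m ^ 2 / (m - j))) with h | h
    · rw [Nat.sub_eq_zero_of_le h]
      simp
    · rw [Nat.cast_sub h]
      refine le_max_of_le_right ?_
      push_cast
      have : (m : ℝ) * (m ^ 2 / j : ℕ) ≤ m * (m ^ 2 / j) := by gcongr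
      linarith
  rw [div_le_iff₀ (by positivity)]
  refine h5.trans (max_le (by positivity) ?_)
  have e : m * ((m : ℝ) ^ 2 / j) - ((α - 1) * m * (m ^ 2 / (m - j)) - m ^ 2 / (m - j) - α * m) =
      ((1 / (j : ℝ) - (α - 1) / (m - j)) + (α / m ^ 2 + 1 / m * (1 / (m - j)))) * m ^ 3 := by
    field_simp
    ring
  rw [e]
  gcongr
  exact le_max_right _ _


/-- The terms are nonnegative, so those beyond J = ⌊m/α⌋ may be dropped. The slope of `logGap` is
decreasing, so up to J the left Riemann sum exceeds the increment of the function. Between J/m and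
1/α only O(1/m) is lost. -/
theorem slopeSum_lower {α : ℝ} (hα : 1 ≤ α) {a : ℕ} (ha : |m * α - a| ≤ 1) {d : ℕ}
    (hd : 1 ≤ d) (hdm : d ≤ m / α) :
    logGap α (1 / α) - logGap α (d / m) - (2 * α + 2) * ((1 + Real.log m) / m) ≤
      (slopeSum m a d : ℝ) / m ^ 3 := by
  have hα0 : 0 < α := by linarith
  have hd' : (0 : ℝ) < d := by exact_mod_cast hd
  have hm' : (0 : ℝ) < m := by
    by_contra h
    have : (m : ℝ) / α ≤ 0 := div_nonpos_of_nonpos_of_nonneg (not_lt.1 h) hα0.le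
    linarith
  have hm : 0 < m := by exact_mod_cast hm'
  have hm1 : (1 : ℝ) ≤ m := by exact_mod_cast hm
  set J := ⌊(m : ℝ) / α⌋₊ with hJ
  have hJle : (J : ℝ) ≤ m / α := Nat.floor_le (by positivity)
  have hJlt : (m : ℝ) / α < J + 1 := Nat.lt_floor_add_one _
  have hdJ : d ≤ J := Nat.le_floor hdm
  have hmα : (m : ℝ) / α ≤ m := div_le_self hm'.le hα
  have hJm : J ≤ m := by exact_mod_cast hJle.trans hmα
  have hJ1 : (1 : ℝ) ≤ J := by exact_mod_cast hd.trans hdJ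
  have hinc : ∀ j ∈ Finset.Ico d J, logGap α ((j + 1 : ℕ) / m) - logGap α (j / m) ≤
      1 / (j : ℝ) - (α - 1) / (m - j) := by
    intro j hj
    rw [Finset.mem_Ico] at hj
    have hj' : (0 : ℝ) < j := by exact_mod_cast (by omega : 0 < j)
    have h1 := log_succ_sub_log_le hj'
    unfold logGap
    push_cast
    rw [Real.log_div (by positivity) hm'.ne', Real.log_div hj'.ne' hm'.ne']
    have h2 : (α - 1) * Real.log (1 - ((j : ℝ) + 1) / m) - (α - 1) * Real.log (1 - j / m) ≤
        - ((α - 1) / (m - j)) := by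
      rcases hα.eq_or_lt with rfl | hα'
      · simp
      · have hlt : (m : ℝ) / α < m := div_lt_self hm' hα'
        have hjJ : ((j + 1 : ℕ) : ℝ) ≤ J := by exact_mod_cast hj.2
        push_cast at hjJ
        have hy : (0 : ℝ) < m - (j + 1) := by linarith
        have h3 := le_log_succ_sub_log hy
        have e1 : (1 : ℝ) - (j + 1) / m = (m - (j + 1)) / m := by field_simp
        have e2 : (1 : ℝ) - j / m = (m - j) / m := by field_simp
        have e3 : (m : ℝ) - (j + 1) + 1 = m - j := by ring
        rw [e3] at h3
        rw [e1, e2, Real.log_div hy.ne' hm'.ne', Real.log_div (by linarith) hm'.ne', ← mul_sub]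
        have := mul_le_mul_of_nonneg_left h3 (sub_nonneg.2 hα)
        rw [mul_one_div] at this
        linarith
    linarith
  have hsum := Finset.sum_le_sum hinc
  rw [Finset.sum_Ico_sub (fun j : ℕ => logGap α ((j : ℝ) / m)) hdJ] at hsum
  have hend : logGap α (1 / α) - logGap α (J / m) ≤ 2 * α / m := by
    unfold logGap
    have h1 : Real.log (1 / α) - Real.log (J / m) ≤ 2 * α / m := by
      rw [← Real.log_div (by positivity) (by positivity)]
      refine (Real.log_le_sub_one_of_pos (by positivity)).trans ?_
      have e : 1 / α / (J / m) - 1 = (m / α - J) / J := by field_simp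
      rw [e]
      -- Since J ≥ 1, m < α (J + 1) ≤ 2 α J.
      calc (m / α - J) / J ≤ 1 / (J : ℝ) := by gcongr; linarith
        _ ≤ 2 * α / m := by
          rw [div_le_div_iff₀ (by linarith) hm']
          rw [div_lt_iff₀ hα0] at hJlt
          nlinarith
    have h2 : (α - 1) * Real.log (1 - 1 / α) ≤ (α - 1) * Real.log (1 - J / m) := by
      rcases hα.eq_or_lt with rfl | hα'
      · simp
      · have : 1 / α < 1 := by rw [div_lt_one hα0]; exact hα'
        have h3 : (J : ℝ) / m ≤ 1 / α := by
          rw [div_le_iff₀ hm', one_div_mul_eq_div]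
          exact hJle
        have : 0 ≤ α - 1 := by linarith
        gcongr
    linarith
  have hlow : ∑ j ∈ Finset.Ico d J, (1 / (j : ℝ) - (α - 1) / (m - j)) -
      (1 / m + 1 / m * (1 + Real.log m)) ≤ (slopeSum m a d : ℝ) / m ^ 3 := by
    have h1 : ∑ j ∈ Finset.Ico d J, (1 / (j : ℝ) - (α - 1) / (m - j) -
        (1 / m ^ 2 + 1 / m * (1 / (m - j)))) ≤ (slopeSum m a d : ℝ) / m ^ 3 := by
      rw [slopeSum_eq, Nat.cast_sum, Finset.sum_div]
      calc _ ≤ ∑ j ∈ Finset.Ico d J, (slopeTerm m a j : ℝ) / m ^ 3 := by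
            refine Finset.sum_le_sum fun j hj => ?_
            rw [Finset.mem_Ico] at hj
            exact slopeTerm_lower hα ha (by omega) (by omega)
        _ ≤ _ := Finset.sum_le_sum_of_subset_of_nonneg (Finset.Ico_subset_Ico_right hJm)
            fun j _ _ => by positivity
    have h2 : ∑ j ∈ Finset.Ico d J, (1 / (m : ℝ) ^ 2 + 1 / m * (1 / (m - j))) ≤
        1 / m + 1 / m * (1 + Real.log m) := by
      calc _ ≤ ∑ j ∈ Finset.Ico d m, (1 / (m : ℝ) ^ 2 + 1 / m * (1 / (m - j))) := by
            refine Finset.sum_le_sum_of_subset_of_nonneg (Finset.Ico_subset_Ico_right hJm)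
              fun j hj _ => ?_
            rw [Finset.mem_Ico] at hj
            have : (j : ℝ) < m := by exact_mod_cast hj.2
            have : (0 : ℝ) < m - j := by linarith
            positivity
        _ = ((m - d : ℕ) : ℝ) * (1 / m ^ 2) + 1 / m * ∑ j ∈ Finset.Ico d m, 1 / ((m : ℝ) - j) := by
            rw [Finset.sum_add_distrib, ← Finset.mul_sum]
            simp
        _ ≤ m * (1 / m ^ 2) + 1 / m * (1 + Real.log m) := by
            gcongr
            · exact Nat.sub_le _ _
            · exact sum_inv_reflect_le d
        _ = _ := by field_simp
    rw [Finset.sum_sub_distrib] at h1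
    linarith
  have hlog : 0 ≤ Real.log m := Real.log_nonneg hm1
  have h1 : 2 * α / m + (1 / m + 1 / m * (1 + Real.log m)) ≤
      (2 * α + 2) * ((1 + Real.log m) / m) := by
    have : 2 * α / m + (1 / m + 1 / m * (1 + Real.log m)) = (2 * α + 1 + (1 + Real.log m)) / m := by
      ring
    rw [this, ← mul_div_assoc]
    gcongr
    nlinarith
  linarith

/-- Induction downwards from d = m. If the slope at d is positive, it is at most the increment of
`logGap` over the preceding interval, hence d - 1 on the right. If it is not, all later slopes are
nonpositive too, and the sum is 0. No approximation of 1/α is needed to find the end of the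
summation. -/
theorem sum_max_le {α : ℝ} (hα : 1 ≤ α) (hm : 2 ≤ m) (k : ℕ) : ∀ d, 2 ≤ d → d + k = m →
    ∑ j ∈ Finset.Ico d m, max 0 (1 / (j : ℝ) - (α - 1) / (m - j)) ≤
      logGap α (1 / α) - logGap α ((d - 1) / m) := by
  have hm' : (0 : ℝ) < m := by exact_mod_cast (by omega : 0 < m)
  have hx : ∀ d : ℕ, 2 ≤ d → d ≤ m → logGap α (((d : ℝ) - 1) / m) ≤ logGap α (1 / α) := by
    intro d hd hdm
    have h1 : (2 : ℝ) ≤ d := by exact_mod_cast hd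
    have h2 : (d : ℝ) ≤ m := by exact_mod_cast hdm
    refine logGap_le_max hα (div_pos (by linarith) hm') ?_
    rw [div_lt_one hm']
    linarith
  induction k with
  | zero =>
    intro d hd hdm
    rw [Nat.add_zero] at hdm
    rw [hdm, Finset.Ico_self, Finset.sum_empty]
    have := hx m hm le_rfl
    linarith
  | succ k ih =>
    intro d hd hdm
    have hdm' : d < m := by omega
    have hdr : (2 : ℝ) ≤ d := by exact_mod_cast hd
    have hdmr : (d : ℝ) < m := by exact_mod_cast hdm'
    rcases le_or_gt (1 / (d : ℝ) - (α - 1) / (m - d)) 0 with hneg | hpos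
    · rw [Finset.sum_eq_zero]
      · have := hx d hd hdm'.le
        linarith
      · intro j hj
        rw [Finset.mem_Ico] at hj
        have h1 : (d : ℝ) ≤ j := by exact_mod_cast hj.1
        have h2 : (j : ℝ) < m := by exact_mod_cast hj.2
        refine max_eq_left (le_trans ?_ hneg)
        have h3 : 1 / (j : ℝ) ≤ 1 / d := by gcongr
        have h4 : (α - 1) / ((m : ℝ) - d) ≤ (α - 1) / (m - j) := by
          have h5 : (0 : ℝ) < m - j := by linarith
          have h6 : 0 ≤ α - 1 := by linarith
          gcongr
        linarith
    · rw [Finset.sum_eq_sum_Ico_succ_bot hdm', max_eq_right hpos.le]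
      have h1 := ih (d + 1) (by omega) (by omega)
      push_cast at h1
      rw [add_sub_cancel_right] at h1
      have h2 : 1 / (d : ℝ) - (α - 1) / (m - d) ≤
          logGap α (d / m) - logGap α ((d - 1) / m) := by
        unfold logGap
        have hd1 : (0 : ℝ) < d - 1 := by linarith
        have h3 := le_log_succ_sub_log hd1
        have h4 := log_succ_sub_log_le (x := (m : ℝ) - d) (by linarith)
        rw [sub_add_cancel] at h3
        have e1 : (1 : ℝ) - d / m = (m - d) / m := by field_simp
        have e2 : (1 : ℝ) - (d - 1) / m = (m - d + 1) / m := by field_simp; ring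
        rw [e1, e2, Real.log_div (by linarith) hm'.ne', Real.log_div hd1.ne' hm'.ne',
          Real.log_div (by linarith) hm'.ne', Real.log_div (by linarith) hm'.ne']
        have := mul_le_mul_of_nonneg_left h4 (sub_nonneg.2 hα)
        rw [mul_one_div] at this
        linarith
      linarith

theorem slopeSum_upper {α : ℝ} (hα : 1 ≤ α) {a : ℕ} (ha : |m * α - a| ≤ 1) {d : ℕ}
    (hd : 2 ≤ d) (hdm : d ≤ m) :
    (slopeSum m a d : ℝ) / m ^ 3 ≤
      logGap α (1 / α) - logGap α ((d - 1) / m) + (α + 1) * ((1 + Real.log m) / m) := by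
  have hm : 0 < m := by omega
  have hm' : (0 : ℝ) < m := by exact_mod_cast hm
  have hm1 : (1 : ℝ) ≤ m := by exact_mod_cast hm
  have h1 := sum_max_le hα (by omega : 2 ≤ m) (m - d) d hd (by omega)
  have h2 : (slopeSum m a d : ℝ) / m ^ 3 ≤ ∑ j ∈ Finset.Ico d m,
      (max 0 (1 / (j : ℝ) - (α - 1) / (m - j)) + (α / m ^ 2 + 1 / m * (1 / (m - j)))) := by
    rw [slopeSum_eq, Nat.cast_sum, Finset.sum_div]
    refine Finset.sum_le_sum fun j hj => ?_
    rw [Finset.mem_Ico] at hj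
    exact slopeTerm_upper hα ha (by omega) (by omega)
  have h3 : ∑ j ∈ Finset.Ico d m, (α / (m : ℝ) ^ 2 + 1 / m * (1 / (m - j))) ≤
      (α + 1) * ((1 + Real.log m) / m) := by
    calc _ = ((m - d : ℕ) : ℝ) * (α / m ^ 2) + 1 / m * ∑ j ∈ Finset.Ico d m, 1 / ((m : ℝ) - j) := by
          rw [Finset.sum_add_distrib, ← Finset.mul_sum]
          simp
      _ ≤ m * (α / m ^ 2) + 1 / m * (1 + Real.log m) := by
          gcongr
          · exact Nat.sub_le _ _
          · exact sum_inv_reflect_le d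
      _ = (α + (1 + Real.log m)) / m := by field_simp
      _ ≤ _ := by
          rw [← mul_div_assoc]
          have hlog : 0 ≤ Real.log m := Real.log_nonneg hm1
          gcongr
          nlinarith
  rw [Finset.sum_add_distrib] at h2
  linarith

end

theorem slope_pos {α x : ℝ} (hα : 1 ≤ α) (hx : 0 < x) (hx1 : x < 1 / α) :
    0 < 1 / x - (α - 1) / (1 - x) := by
  have h0 : 0 < α := by linarith
  have : 1 / α ≤ 1 := by rw [div_le_one h0]; exact hα
  have hx1' : 0 < 1 - x := by linarith
  rw [div_sub_div _ _ hx.ne' hx1'.ne']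
  refine div_pos ?_ (by positivity)
  rw [lt_div_iff₀ h0] at hx1
  linarith

-- `slopeSum` decreases in d, so the d that are counted form an initial segment. Its end is compared
-- with δ m: to the left of δ, concavity makes `logGap` fall with slope at least s₀; to the right it
-- rises with slope at least s₁ up to x₁. Dividing the error O(ℓ/m) of the sums by these slopes
-- gives an error O(ℓ) for the count, where ℓ = 1 + log m.
set_option maxHeartbeats 800000 in
theorem rootCount_approx {α c δ : ℝ} (hα : 1 ≤ α) (hc : 1 < c) (hδ : 0 < δ) (hδ1 : δ < 1 / α)
    (heq : logGap α (1 / α) - logGap α δ = Real.log c) :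
    ∃ C, 0 ≤ C ∧ ∀ m a e : ℕ, 0 < m → |m * α - a| ≤ 1 → |m * c - e| ≤ 1 →
      |(rootCount m a e : ℝ) - δ * m| ≤ C * (1 + Real.log m) := by
  have hα0 : 0 < α := by linarith
  have hinv : 1 / α ≤ 1 := by rw [div_le_one hα0]; exact hα
  -- The slope may vanish at 1/α; only up to a fixed x₁ < 1/α is it bounded away from 0.
  obtain ⟨x₁, hx₁, hx₁'⟩ := exists_between hδ1
  have hs₀ := slope_pos hα hδ hδ1
  have hs₁ := slope_pos hα (hδ.trans hx₁) hx₁'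
  set s₀ := 1 / δ - (α - 1) / (1 - δ)
  set s₁ := 1 / x₁ - (α - 1) / (1 - x₁)
  -- E = (2α + 2) + (c + 1) adds the error constants of `slopeSum_lower` and `invSum_bounds`; it
  -- also covers the α + 1 of `slopeSum_upper`.
  set E := 2 * α + 3 + c with hE
  have hE0 : 0 < E := by positivity
  have hgap : 0 < x₁ - δ := by linarith
  refine ⟨(E / s₀ + 1) + (E / s₁ + 3) + (E / s₁ + 2) / (x₁ - δ), by positivity, ?_⟩
  intro m a e hm ha he
  have hm' : (0 : ℝ) < m := by exact_mod_cast hm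
  have hm1 : (1 : ℝ) ≤ m := by exact_mod_cast hm
  have hlog : 0 ≤ Real.log m := Real.log_nonneg hm1
  set ℓ := 1 + Real.log m with hℓ
  have hℓ1 : 1 ≤ ℓ := by linarith
  have hL := abs_le.1 (invSum_bounds hc hm he)
  have hcl : (c + 1) / m ≤ (c + 1) * (ℓ / m) := by
    rw [← mul_div_assoc]
    gcongr
    nlinarith
  have hiff : ∀ d, m * invSum m e ≤ slopeSum m a d ↔
      (invSum m e : ℝ) / m ^ 2 ≤ (slopeSum m a d : ℝ) / m ^ 3 := by
    intro d
    have : (invSum m e : ℝ) / m ^ 2 = (m * invSum m e : ℕ) / m ^ 3 := by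
      push_cast
      field_simp
    rw [this, div_le_div_iff_of_pos_right (by positivity), Nat.cast_le]
  have hlower : ∀ d : ℕ, 1 ≤ d → (d : ℝ) ≤ δ * m - E / s₀ * ℓ → m * invSum m e ≤ slopeSum m a d := by
    intro d hd hdm
    rw [hiff]
    have hd0 : (0 : ℝ) < d := by exact_mod_cast hd
    have hpos : 0 ≤ E / s₀ * ℓ := by positivity
    have hdδ : (d : ℝ) / m ≤ δ - E / s₀ * ℓ / m := by
      rw [div_le_iff₀ hm', sub_mul, div_mul_cancel₀ _ hm'.ne']
      exact hdm
    have hpos' : 0 ≤ E / s₀ * ℓ / m := by positivity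
    have h1 := slopeSum_lower hα ha hd (by
      have : δ * m ≤ m / α := by
        rw [← one_div_mul_eq_div]
        gcongr
      linarith)
    have h2 := logGap_le_tangent hα (x := d / m) (y := δ) (by positivity) (by linarith) hδ
      (by linarith)
    have h3 : E * (ℓ / m) ≤ (δ - d / m) * s₀ := by
      calc E * (ℓ / m) = E / s₀ * ℓ / m * s₀ := by field_simp
        _ ≤ _ := by gcongr; linarith
    have h4 : E * (ℓ / m) = (2 * α + 2) * (ℓ / m) + (c + 1) * (ℓ / m) := by rw [hE]; ring
    have h5 : (d / m - δ) * s₀ = - ((δ - d / m) * s₀) := by ring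
    rw [h5] at h2
    linarith [hL.2]
  -- With truncated subtraction, 1 - (x - y) is the indicator of x ≤ y.
  have hrc : ∀ D : ℕ, (∀ d, 1 ≤ d → d ≤ D → m * invSum m e ≤ slopeSum m a d) → D ≤ m →
      D ≤ rootCount m a e := by
    intro D h hDm
    unfold rootCount
    calc D = ∑ i ∈ Finset.range D, 1 := by simp
      _ = ∑ i ∈ Finset.range D, (1 - (m * invSum m e - slopeSum m a (i + 1))) := by
        refine Finset.sum_congr rfl fun i hi => ?_
        rw [Finset.mem_range] at hi
        have := h (i + 1) (by omega) (by omega)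
        omega
      _ ≤ _ := Finset.sum_le_sum_of_subset (by simpa using hDm)
  have hrcu : ∀ D : ℕ, slopeSum m a D < m * invSum m e → rootCount m a e ≤ D := by
    intro D h
    unfold rootCount
    calc ∑ i ∈ Finset.range m, (1 - (m * invSum m e - slopeSum m a (i + 1)))
        ≤ ∑ i ∈ Finset.range m, if i < D then 1 else 0 := by
          refine Finset.sum_le_sum fun i _ => ?_
          split_ifs with hi
          · omega
          · have := slopeSum_anti (m := m) (a := a) (d := D) (d' := i + 1) (by omega)
            omega
      _ ≤ D := by
          rw [Finset.sum_boole]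
          have : (Finset.filter (fun i => i < D) (Finset.range m)) ⊆ Finset.range D := by
            intro i hi
            simpa using (Finset.mem_filter.1 hi).2
          simpa using Finset.card_le_card this
  have hrcm : rootCount m a e ≤ m := by
    unfold rootCount
    calc _ ≤ ∑ i ∈ Finset.range m, 1 := Finset.sum_le_sum fun i _ => by omega
      _ = m := by simp
  have hδm : δ * m ≤ m := by nlinarith
  have p1 : 0 ≤ E / s₀ * ℓ := by positivity
  have p2 : 0 ≤ E / s₁ * ℓ := by positivity
  have p3 : 0 ≤ (E / s₁ + 2) / (x₁ - δ) * ℓ := by positivity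
  have expand : ((E / s₀ + 1) + (E / s₁ + 3) + (E / s₁ + 2) / (x₁ - δ)) * ℓ =
    E / s₀ * ℓ + ℓ + (E / s₁ * ℓ + 3 * ℓ) + (E / s₁ + 2) / (x₁ - δ) * ℓ := by ring
  rw [expand, abs_le]
  constructor
  · set D := ⌊δ * m - E / s₀ * ℓ⌋₊ with hD
    have hDlt := Nat.lt_floor_add_one (δ * m - E / s₀ * ℓ)
    have hge : D ≤ rootCount m a e := by
      rcases Nat.eq_zero_or_pos D with h0 | h0
      · omega
      · have hnn : 0 ≤ δ * m - E / s₀ * ℓ := by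
          by_contra hneg
          rw [hD, Nat.floor_of_nonpos (by linarith)] at h0
          exact lt_irrefl _ h0
        have hDle : (D : ℝ) ≤ δ * m - E / s₀ * ℓ := Nat.floor_le hnn
        refine hrc D (fun d hd hdD => hlower d hd (le_trans (by exact_mod_cast hdD) hDle)) ?_
        have : (D : ℝ) ≤ m := by linarith
        exact_mod_cast this
    have hge' : (D : ℝ) ≤ rootCount m a e := by exact_mod_cast hge
    rw [← hD] at hDlt
    linarith
  -- The summand 2 provides for d ≥ 2 and for the shift to (d - 1)/m in `slopeSum_upper`, and leaves
  -- 1 for the strict inequality.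
  · set D := ⌈δ * m + E / s₁ * ℓ⌉₊ + 2 with hD
    have hnn : 0 ≤ δ * m + E / s₁ * ℓ := by positivity
    have hDu : (D : ℝ) < δ * m + E / s₁ * ℓ + 3 := by
      rw [hD]
      push_cast
      linarith [Nat.ceil_lt_add_one hnn]
    have hDl : δ * m + E / s₁ * ℓ + 1 ≤ (D : ℝ) - 1 := by
      rw [hD]
      push_cast
      linarith [Nat.le_ceil (δ * m + E / s₁ * ℓ)]
    rcases le_or_gt ((D : ℝ) - 1) (x₁ * m) with h | h
    · have hD2 : 2 ≤ D := by omega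
      have hDm : D ≤ m := by
        have : (D : ℝ) < m + 1 := by nlinarith
        have : D < m + 1 := by exact_mod_cast this
        omega
      have hup := slopeSum_upper hα ha hD2 hDm
      set x := ((D : ℝ) - 1) / m with hx
      have hxl : δ + (E / s₁ * ℓ + 1) / m ≤ x := by
        rw [hx, le_div_iff₀ hm', add_mul, div_mul_cancel₀ _ hm'.ne']
        linarith
      have hpos : 0 < (E / s₁ * ℓ + 1) / m := by positivity
      have hxu : x ≤ x₁ := by rw [hx, div_le_iff₀ hm']; exact h
      have ht := logGap_le_tangent hα (x := δ) (y := x) hδ (by linarith) (by linarith)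
        (by linarith)
      have hsx : s₁ ≤ 1 / x - (α - 1) / (1 - x) := by
        have h1 : 1 / x₁ ≤ 1 / x := one_div_le_one_div_of_le (by linarith) hxu
        have h2 : (α - 1) / (1 - x) ≤ (α - 1) / (1 - x₁) := by
          have h5 : 0 < 1 - x₁ := by linarith
          have h6 : 0 ≤ α - 1 := by linarith
          gcongr
        linarith
      have h3 : E * (ℓ / m) < (x - δ) * (1 / x - (α - 1) / (1 - x)) := by
        calc E * (ℓ / m) = E / s₁ * ℓ / m * s₁ := by field_simp
          _ < (E / s₁ * ℓ + 1) / m * s₁ := by gcongr; linarith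
          _ ≤ (x - δ) * s₁ := by gcongr; linarith
          _ ≤ _ := by gcongr; linarith
      have h4 : E * (ℓ / m) = (α + 1) * (ℓ / m) + (c + 1) * (ℓ / m) + (α + 1) * (ℓ / m) := by
        rw [hE]; ring
      have h5 : (δ - x) * (1 / x - (α - 1) / (1 - x)) =
        - ((x - δ) * (1 / x - (α - 1) / (1 - x))) := by ring
      have h6 : 0 ≤ (α + 1) * (ℓ / m) := by positivity
      rw [h5] at ht
      have hlt : ¬ m * invSum m e ≤ slopeSum m a D := by
        rw [hiff, not_le]
        linarith [hL.1]
      have := hrcu D (not_le.1 hlt)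
      have : (rootCount m a e : ℝ) ≤ D := by exact_mod_cast this
      linarith
    -- If D lies beyond x₁ m, then m itself is O(ℓ), and the trivial bound by m suffices.
    · have h1 : (x₁ - δ) * m ≤ (E / s₁ + 2) * ℓ := by
        rw [sub_mul, add_mul]
        linarith
      have h2 : (m : ℝ) ≤ (E / s₁ + 2) / (x₁ - δ) * ℓ := by
        rw [div_mul_eq_mul_div, le_div_iff₀ hgap]
        linarith
      have : (rootCount m a e : ℝ) ≤ m := by exact_mod_cast hrcm
      have : 0 ≤ δ * m := by positivity
      linarith

theorem cast_sub_approx {c : ℝ} (hc : 1 ≤ c) {m e : ℕ} (he : |m * c - e| ≤ 1) :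
    |((e - m : ℕ) : ℝ) - (c - 1) * m| ≤ 1 := by
  rw [abs_le] at he ⊢
  rcases le_total m e with h | h
  · rw [Nat.cast_sub h]
    constructor <;> linarith
  · rw [Nat.sub_eq_zero_of_le h]
    have : (e : ℝ) ≤ m := by exact_mod_cast h
    have := mul_nonneg (sub_nonneg.2 hc) (Nat.cast_nonneg m : (0 : ℝ) ≤ m)
    simp only [CharP.cast_eq_zero]
    constructor <;> linarith

theorem baseNum_approx {α c δ : ℝ} (hα : 1 ≤ α) (hc : 1 < c) (hδ : 0 < δ) (hδ1 : δ < 1 / α)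
    (heq : logGap α (1 / α) - logGap α δ = Real.log c) :
    ∃ C, 0 ≤ C ∧ ∀ m a e : ℕ, 0 < m → |m * α - a| ≤ 1 → |m * c - e| ≤ 1 →
      |(baseNum m a e : ℝ) / m ^ 2 - (1 + δ * (c - 1))| ≤ C * ((1 + Real.log m) / m) := by
  obtain ⟨C, hC, h⟩ := rootCount_approx hα hc hδ hδ1 heq
  refine ⟨C * c + 1, by positivity, fun m a e hm ha he => ?_⟩
  have hm' : (0 : ℝ) < m := by exact_mod_cast hm
  have hm1 : (1 : ℝ) ≤ m := by exact_mod_cast hm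
  have hlog : 0 ≤ Real.log m := Real.log_nonneg hm1
  have h1 := h m a e hm ha he
  have h2 := cast_sub_approx hc.le he
  have hα0 : 0 < α := by linarith
  have hinv : 1 / α ≤ 1 := by rw [div_le_one hα0]; exact hα
  set N := e - m
  have hN : (N : ℝ) ≤ c * m := by linarith [(abs_le.1 h2).2]
  have e1 : (baseNum m a e : ℝ) / m ^ 2 - (1 + δ * (c - 1)) =
      ((rootCount m a e - δ * m) * N + δ * m * (N - (c - 1) * m)) / m ^ 2 := by
    unfold baseNum
    push_cast
    field_simp
    ring
  rw [e1, abs_div, abs_of_pos (by positivity : (0 : ℝ) < m ^ 2), div_le_iff₀ (by positivity)]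
  calc |((rootCount m a e : ℝ) - δ * m) * N + δ * m * (N - (c - 1) * m)|
      ≤ |(rootCount m a e : ℝ) - δ * m| * N + δ * m * |N - (c - 1) * m| := by
        refine (abs_add_le _ _).trans ?_
        rw [abs_mul, abs_mul, abs_of_nonneg (Nat.cast_nonneg N : (0 : ℝ) ≤ N),
          abs_of_nonneg (by positivity : 0 ≤ δ * m)]
    _ ≤ C * (1 + Real.log m) * (c * m) + 1 * m * 1 := by
        gcongr
        linarith
    _ ≤ (C * c + 1) * ((1 + Real.log m) / m) * m ^ 2 := by
        have : (C * c + 1) * ((1 + Real.log m) / m) * m ^ 2 =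
          C * (1 + Real.log m) * (c * m) + m * (1 + Real.log m) := by field_simp
        rw [this]
        nlinarith

/-! ### The probability of a good sample -/

/-- Expand N^N = (J + (N - J))^N. The terms increase up to j = J and decrease afterwards, so the
J-th of the N + 1 terms is the largest. -/
theorem pow_self_le_choose_mul (N J : ℕ) (hJ : J ≤ N) :
    N ^ N ≤ (N + 1) * (N.choose J * J ^ J * (N - J) ^ (N - J)) := by
  set f : ℕ → ℕ := fun j => N.choose j * J ^ j * (N - J) ^ (N - j) with hf
  have up : ∀ j, j < J → f j ≤ f (j + 1) := by
    intro j hj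
    -- After multiplication by j + 1 the terms for j + 1 and j compare as (N - j) J and (N - J)(j +
    -- 1).
    refine Nat.le_of_mul_le_mul_right (c := j + 1) ?_ (by omega)
    have h1 := Nat.choose_succ_right_eq N j
    have e1 : f (j + 1) * (j + 1) = N.choose j * (N - j) * (J ^ j * J) * (N - J) ^ (N - (j + 1)) := by
      rw [← h1, hf]
      ring
    have e2 : f j * (j + 1) =
        N.choose j * J ^ j * (N - J) ^ (N - (j + 1)) * ((N - J) * (j + 1)) := by
      have : N - j = N - (j + 1) + 1 := by omega
      rw [hf]
      dsimp only
      rw [this, pow_succ]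
      ring
    rw [e1, e2]
    have : (N - J) * (j + 1) ≤ (N - j) * J := Nat.mul_le_mul (by omega) (by omega)
    calc _ ≤ N.choose j * J ^ j * (N - J) ^ (N - (j + 1)) * ((N - j) * J) :=
          Nat.mul_le_mul_left _ this
      _ = _ := by ring
  have down : ∀ j, J ≤ j → j < N → f (j + 1) ≤ f j := by
    intro j hj hjN
    refine Nat.le_of_mul_le_mul_right (c := j + 1) ?_ (by omega)
    have h1 := Nat.choose_succ_right_eq N j
    have e1 : f (j + 1) * (j + 1) = N.choose j * (N - j) * (J ^ j * J) * (N - J) ^ (N - (j + 1)) := by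
      rw [← h1, hf]
      ring
    have e2 : f j * (j + 1) =
        N.choose j * J ^ j * (N - J) ^ (N - (j + 1)) * ((N - J) * (j + 1)) := by
      have : N - j = N - (j + 1) + 1 := by omega
      rw [hf]
      dsimp only
      rw [this, pow_succ]
      ring
    rw [e1, e2]
    have : (N - j) * J ≤ (N - J) * (j + 1) := Nat.mul_le_mul (by omega) (by omega)
    calc _ = N.choose j * J ^ j * (N - J) ^ (N - (j + 1)) * ((N - j) * J) := by ring
      _ ≤ _ := Nat.mul_le_mul_left _ this
  have hmax : ∀ j ≤ N, f j ≤ f J := by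
    intro j hjN
    rcases le_total j J with h | h
    · exact Nat.decreasingInduction' (P := fun i => f i ≤ f J)
        (fun i hi _ ih => (up i hi).trans ih) h le_rfl
    · induction j, h using Nat.le_induction with
      | base => exact le_rfl
      | succ j hj ih => exact (down j hj (by omega)).trans (ih (by omega))
  have hsum : N ^ N = ∑ j ∈ Finset.range (N + 1), f j := by
    have := add_pow J (N - J) N
    rw [Nat.add_sub_cancel' hJ] at this
    rw [this]
    refine Finset.sum_congr rfl fun j _ => ?_
    rw [hf]
    simp only [Nat.cast_id]
    ring
  rw [hsum]
  calc _ ≤ ∑ j ∈ Finset.range (N + 1), f J :=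
        Finset.sum_le_sum fun j hj => hmax j (by rw [Finset.mem_range] at hj; omega)
    _ = _ := by simp [hf]

/-- A binomial variable takes a value within 2 of its mean with probability at least const/(N + 1).
For p = J/N this is the preceding lemma. Passing to the given p costs the exponential of a relative
entropy, which is bounded via log u ≤ u - 1 by (J - pN)² / (p(1-p)N), hence by 4/(p(1-p)). -/
theorem choose_mul_pow_lower {p : ℝ} (hp : 0 < p) (hp1 : p < 1) {N J : ℕ} (hJ : J ≤ N)
    (h : |(J : ℝ) - p * N| ≤ 2) :
    1 ≤ (N + 1) * (N.choose J * p ^ J * (1 - p) ^ (N - J)) * Real.exp (4 / (p * (1 - p))) := by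
  have hp1' : 0 < 1 - p := by linarith
  rcases Nat.eq_zero_or_pos N with rfl | hN
  · obtain rfl : J = 0 := by omega
    simpa using Real.one_le_exp (by positivity : 0 ≤ 4 / (p * (1 - p)))
  have hN' : (0 : ℝ) < N := by exact_mod_cast hN
  have hN1 : (1 : ℝ) ≤ N := by exact_mod_cast hN
  have h1 : (J : ℝ) ^ J ≤ (p * N) ^ J * Real.exp (J * (J / (p * N) - 1)) := by
    have h0 : (J : ℝ) ≤ p * N * Real.exp (J / (p * N) - 1) := by
      have := Real.add_one_le_exp (J / (p * N) - 1)
      rw [sub_add_cancel, div_le_iff₀ (by positivity)] at this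
      linarith
    calc (J : ℝ) ^ J ≤ (p * N * Real.exp (J / (p * N) - 1)) ^ J := by gcongr
      _ = _ := by rw [mul_pow, ← Real.exp_nat_mul]
  have h2 : ((N - J : ℕ) : ℝ) ^ (N - J) ≤ ((1 - p) * N) ^ (N - J) *
      Real.exp ((N - J : ℕ) * ((N - J : ℕ) / ((1 - p) * N) - 1)) := by
    have h0 : ((N - J : ℕ) : ℝ) ≤ (1 - p) * N * Real.exp ((N - J : ℕ) / ((1 - p) * N) - 1) := by
      have := Real.add_one_le_exp (((N - J : ℕ) : ℝ) / ((1 - p) * N) - 1)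
      rw [sub_add_cancel, div_le_iff₀ (by positivity)] at this
      linarith
    calc ((N - J : ℕ) : ℝ) ^ (N - J)
        ≤ ((1 - p) * N * Real.exp ((N - J : ℕ) / ((1 - p) * N) - 1)) ^ (N - J) := by gcongr
      _ = _ := by rw [mul_pow, ← Real.exp_nat_mul]
  have h3 : (J : ℝ) * (J / (p * N) - 1) + (N - J : ℕ) * ((N - J : ℕ) / ((1 - p) * N) - 1) ≤
      4 / (p * (1 - p)) := by
    rw [Nat.cast_sub hJ]
    have e : (J : ℝ) * (J / (p * N) - 1) + (N - J) * ((N - J) / ((1 - p) * N) - 1) =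
        (J - p * N) ^ 2 / (p * (1 - p)) / N := by
      field_simp
      ring
    rw [e]
    have h4 : ((J : ℝ) - p * N) ^ 2 ≤ 4 := by
      rw [← sq_abs]
      nlinarith [abs_nonneg ((J : ℝ) - p * N)]
    calc ((J : ℝ) - p * N) ^ 2 / (p * (1 - p)) / N ≤ ((J : ℝ) - p * N) ^ 2 / (p * (1 - p)) :=
          div_le_self (by positivity) hN1
      _ ≤ _ := by gcongr
  have h5 : (N : ℝ) ^ N ≤ (N + 1) * (N.choose J * J ^ J * ((N - J : ℕ) : ℝ) ^ (N - J)) := by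
    exact_mod_cast pow_self_le_choose_mul N J hJ
  have h6 : (N : ℝ) ^ N = (N : ℝ) ^ J * N ^ (N - J) := by rw [← pow_add, Nat.add_sub_cancel' hJ]
  have hNN : (0 : ℝ) < (N : ℝ) ^ N := by positivity
  refine le_of_mul_le_mul_left ?_ hNN
  calc (N : ℝ) ^ N * 1 ≤ (N + 1) * (N.choose J * J ^ J * ((N - J : ℕ) : ℝ) ^ (N - J)) := by
        rw [mul_one]; exact h5
    _ ≤ (N + 1) * (N.choose J * ((p * N) ^ J * Real.exp (J * (J / (p * N) - 1))) *
        (((1 - p) * N) ^ (N - J) *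
          Real.exp ((N - J : ℕ) * ((N - J : ℕ) / ((1 - p) * N) - 1)))) := by gcongr
    _ = (N : ℝ) ^ N * ((N + 1) * (N.choose J * p ^ J * (1 - p) ^ (N - J)) *
        Real.exp ((J : ℝ) * (J / (p * N) - 1) +
          (N - J : ℕ) * ((N - J : ℕ) / ((1 - p) * N) - 1))) := by
        rw [Real.exp_add, h6, mul_pow, mul_pow]
        ring
    _ ≤ _ := by gcongr

/-- Both sides count the pairs of a t-set and a k-set in n points that meet in exactly i points. -/
theorem choose_exchange {n k i t : ℕ} (hik : i ≤ k) (hit : i ≤ t) (h : t + k ≤ n + i) :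
    n.choose t * (t.choose i * (n - t).choose (k - i)) =
      n.choose k * (k.choose i * (n - k).choose (t - i)) := by
  have key : ∀ {t k : ℕ}, i ≤ k → i ≤ t → t + k ≤ n + i →
      n.choose t * (t.choose i * (n - t).choose (k - i)) =
      n.choose i * ((n - i).choose ((t - i) + (k - i)) * ((t - i) + (k - i)).choose (t - i)) := by
    intro t k hik hit h
    rw [← mul_assoc, Nat.choose_mul hit, mul_assoc,
      Nat.choose_mul (n := n - i) (Nat.le_add_right (t - i) (k - i))]
    congr 3 <;> omega
  rw [key hik hit h, key hit hik (by omega), Nat.add_comm (k - i) (t - i)]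
  congr 2
  rw [Nat.choose_symm_add]

/-- The only place where the value of γ matters. With β = 1/α, the equation for δ says β (1-β)^(α-1)
= cδ (1-δ)^(α-1). So (cδ)^i (1-δ)^(t-i) may replace β^i (1-β)^(t-i), where i is within 2 of the mean
β t. As t - i differs from (α - 1) i by less than 1, a factor 1 - β is lost. For α = 1 the equation
reads cδ = 1 and t = i. -/
theorem first_factor_lower {α c δ : ℝ} (hα : 1 ≤ α) (hc : 1 < c) (hδ : 0 < δ) (hδ1 : δ < 1 / α)
    (heq : logGap α (1 / α) - logGap α δ = Real.log c) :
    ∃ κ > 0, ∀ i t : ℕ, t = ⌊α * i⌋₊ → i ≤ t →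
      κ ≤ (t + 1) * (t.choose i * (c * δ) ^ i * (1 - δ) ^ (t - i)) := by
  have hα0 : 0 < α := by linarith
  have hc0 : 0 < c := by linarith
  rcases hα.eq_or_lt with rfl | hα'
  · refine ⟨1, one_pos, fun i t ht hit => ?_⟩
    have : t = i := by rw [ht]; simp
    subst this
    have : c * δ = 1 := by
      simp only [logGap, div_one, Real.log_one, sub_self, zero_mul, add_zero, zero_sub] at heq
      rw [← Real.log_inv] at heq
      have := Real.log_injOn_pos (by simpa using hδ) (by simpa using hc0) heq
      rw [← this, inv_mul_cancel₀ hδ.ne']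
    simp [this]
  · set β := 1 / α with hβ
    have hβ0 : 0 < β := by positivity
    have hβ1 : β < 1 := by rw [hβ, div_lt_one hα0]; exact hα'
    have hβ1' : 0 < 1 - β := by linarith
    have hδ1' : 0 < 1 - δ := by linarith
    refine ⟨(1 - β) / Real.exp (4 / (β * (1 - β))), by positivity, fun i t ht hit => ?_⟩
    have ht1 : (t : ℝ) ≤ α * i := by rw [ht]; exact Nat.floor_le (by positivity)
    have ht2 : α * i < t + 1 := by rw [ht]; exact Nat.lt_floor_add_one _
    have hαβ : α * β = 1 := by rw [hβ]; field_simp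
    have habs : |(i : ℝ) - β * t| ≤ 2 := by
      have e : (i : ℝ) - β * t = β * (α * i - t) := by
        rw [mul_sub, ← mul_assoc, mul_comm β α, hαβ, one_mul]
      rw [e, abs_le]
      constructor <;> nlinarith
    have h1 := choose_mul_pow_lower hβ0 hβ1 hit habs
    have h2 : β ^ i * (1 - β) ^ (t - i) * (1 - β) ≤ (c * δ) ^ i * (1 - δ) ^ (t - i) := by
      rw [← Real.log_le_log_iff (by positivity) (by positivity), Real.log_mul (by positivity)
        (by positivity), Real.log_mul (by positivity) (by positivity), Real.log_mul (by positivity)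
        (by positivity), Real.log_pow, Real.log_pow, Real.log_pow, Real.log_pow,
        Real.log_mul hc0.ne' hδ.ne', ← heq, Nat.cast_sub hit]
      unfold logGap
      have hl1 : Real.log (1 - δ) ≤ 0 := Real.log_nonpos hδ1'.le (by linarith)
      have hl2 : Real.log (1 - β) ≤ Real.log (1 - δ) := Real.log_le_log hβ1' (by linarith)
      nlinarith
    have hexp := Real.exp_pos (4 / (β * (1 - β)))
    rw [div_le_iff₀ hexp]
    calc (1 - β) = 1 * (1 - β) := by ring
      _ ≤ (t + 1) * (t.choose i * β ^ i * (1 - β) ^ (t - i)) * Real.exp (4 / (β * (1 - β))) *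
          (1 - β) := by gcongr
      _ = (t + 1) * t.choose i * (β ^ i * (1 - β) ^ (t - i) * (1 - β)) *
          Real.exp (4 / (β * (1 - β))) := by ring
      _ ≤ (t + 1) * t.choose i * ((c * δ) ^ i * (1 - δ) ^ (t - i)) *
          Real.exp (4 / (β * (1 - β))) := by gcongr
      _ = _ := by ring

theorem exists_good_sizes {α c δ : ℝ} (hα : 1 ≤ α) (hc : 1 < c) (hδ : 0 < δ) (hδ1 : δ < 1 / α)
    (heq : logGap α (1 / α) - logGap α δ = Real.log c) :
    ∃ κ > 0, ∀ n k : ℕ, α * k ≤ n → ∃ i t : ℕ, i ≤ k ∧ i ≤ t ∧ t ≤ α * i ∧ t + k ≤ n + i ∧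
      κ * c ^ (k - i) * n.choose t ≤
        (1 + δ * (c - 1)) ^ n * (n + 1) ^ 2 * (k.choose i * (n - k).choose (t - i)) := by
  have hα0 : 0 < α := by linarith
  have hc0 : 0 < c := by linarith
  have hinv : 1 / α ≤ 1 := by rw [div_le_one hα0]; exact hα
  have hδ1' : 0 < 1 - δ := by linarith
  have hαδ : 0 < 1 - α * δ := by
    rw [lt_div_iff₀ hα0] at hδ1
    linarith
  obtain ⟨κ₁, hκ₁, h₁⟩ := first_factor_lower hα hc hδ hδ1 heq
  set κ₂ := (Real.exp (4 / (δ * (1 - δ))))⁻¹ with hκ₂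
  have hκ₂0 : 0 < κ₂ := by positivity
  refine ⟨min 1 (κ₁ * κ₂), by positivity, fun n k hk => ?_⟩
  have hkn : k ≤ n := by
    have : (k : ℝ) ≤ n := by nlinarith [(Nat.cast_nonneg k : (0 : ℝ) ≤ k)]
    exact_mod_cast this
  have hγ : 0 < 1 + δ * (c - 1) := by nlinarith
  rcases le_or_gt (k : ℝ) (δ * n) with hkδ | hkδ
  -- For small k no sampling is needed: c^k ≤ (c^δ)^n ≤ (1 + δ(c-1))^n.
  · refine ⟨0, 0, by omega, le_rfl, by simp, by omega, ?_⟩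
    simp only [Nat.sub_zero, Nat.choose_zero_right, Nat.cast_one, mul_one]
    have hb : c ^ δ ≤ 1 + δ * (c - 1) := by
      have := rpow_one_add_le_one_add_mul_self (s := c - 1) (by linarith) hδ.le (by linarith)
      simpa using this
    have h1 : c ^ k ≤ (1 + δ * (c - 1)) ^ n := by
      calc c ^ k = c ^ (k : ℝ) := (Real.rpow_natCast c k).symm
        _ ≤ c ^ (δ * n) := Real.rpow_le_rpow_of_exponent_le hc.le hkδ
        _ = (c ^ δ) ^ n := by rw [Real.rpow_mul hc0.le, Real.rpow_natCast]
        _ ≤ _ := by gcongr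
    have h2 : (1 : ℝ) ≤ (n + 1) ^ 2 := by
      have := (Nat.cast_nonneg n : (0 : ℝ) ≤ n)
      nlinarith
    calc min 1 (κ₁ * κ₂) * c ^ k ≤ 1 * (1 + δ * (c - 1)) ^ n := by
          gcongr
          exact min_le_left _ _
      _ ≤ (1 + δ * (c - 1)) ^ n * (n + 1) ^ 2 := by
          rw [one_mul]
          exact le_mul_of_one_le_right (by positivity) h2
  -- z solves k - z = δ (n - α z). Rounding z to i and α z to t puts k - i within 2 of the mean of a
  -- binomial variable with parameters n - t, δ.
  · set z := ((k : ℝ) - δ * n) / (1 - α * δ) with hz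
    have hz0 : 0 < z := div_pos (by linarith) hαδ
    set i := ⌈z⌉₊ with hi
    have hi1 : z ≤ i := Nat.le_ceil z
    have hi2 : (i : ℝ) < z + 1 := Nat.ceil_lt_add_one hz0.le
    have hik : i ≤ k := by
      refine Nat.ceil_le.2 ?_
      rw [hz, div_le_iff₀ hαδ]
      nlinarith
    have hikr : (i : ℝ) ≤ k := by exact_mod_cast hik
    set t := ⌊α * i⌋₊ with ht
    have ht1 : (t : ℝ) ≤ α * i := Nat.floor_le (by positivity)
    have ht2 : α * i < t + 1 := Nat.lt_floor_add_one _
    have hit : i ≤ t := Nat.le_floor (by nlinarith [(Nat.cast_nonneg i : (0 : ℝ) ≤ i)])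
    have htk : t + k ≤ n + i := by
      have : (t : ℝ) + k ≤ n + i := by nlinarith
      exact_mod_cast this
    refine ⟨i, t, hik, hit, ht1, htk, ?_⟩
    have htn : t ≤ n := by omega
    have hzeq : z * (1 - α * δ) = k - δ * n := by rw [hz, div_mul_cancel₀ _ hαδ.ne']
    have hB1 := h₁ i t ht hit
    have hB2 := choose_mul_pow_lower hδ (by linarith : δ < 1) (N := n - t) (J := k - i) (by omega)
      (by
        rw [Nat.cast_sub hik, Nat.cast_sub htn, abs_le]
        have hδ1 : δ < 1 := by linarith
        constructor <;> nlinarith)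
    have hB2' : κ₂ ≤ (n + 1) * ((n - t).choose (k - i) * δ ^ (k - i) *
        (1 - δ) ^ ((n - t) - (k - i))) := by
      rw [hκ₂, inv_le_iff_one_le_mul₀ (Real.exp_pos _)]
      refine hB2.trans ?_
      gcongr
      exact Nat.sub_le _ _
    have hB1' : κ₁ ≤ (n + 1) * (t.choose i * (c * δ) ^ i * (1 - δ) ^ (t - i)) := by
      refine hB1.trans ?_
      gcongr
    -- One term of the binomial expansion of (cδ + (1 - δ))^n.
    have hup : (n.choose k : ℝ) * ((c * δ) ^ k * (1 - δ) ^ (n - k)) ≤ (1 + δ * (c - 1)) ^ n := by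
      have e : 1 + δ * (c - 1) = c * δ + (1 - δ) := by ring
      rw [e, add_pow]
      refine le_trans (le_of_eq ?_) (Finset.single_le_sum (f := fun j => (c * δ) ^ j *
        (1 - δ) ^ (n - j) * (n.choose j : ℝ)) (fun j _ => by positivity)
        (Finset.mem_range.2 (by omega : k < n + 1)))
      ring
    have hex : (n.choose t : ℝ) * (t.choose i * (n - t).choose (k - i)) =
        n.choose k * (k.choose i * (n - k).choose (t - i)) := by
      exact_mod_cast choose_exchange hik hit htk
    calc min 1 (κ₁ * κ₂) * c ^ (k - i) * n.choose t
        ≤ ((n + 1) * (t.choose i * (c * δ) ^ i * (1 - δ) ^ (t - i))) *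
          ((n + 1) * ((n - t).choose (k - i) * δ ^ (k - i) * (1 - δ) ^ ((n - t) - (k - i)))) *
          c ^ (k - i) * n.choose t := by
          gcongr
          exact (min_le_right _ _).trans (by gcongr)
      _ = (n + 1) ^ 2 * (n.choose t * (t.choose i * (n - t).choose (k - i))) *
          (((c * δ) ^ i * (c * δ) ^ (k - i)) *
            ((1 - δ) ^ (t - i) * (1 - δ) ^ ((n - t) - (k - i)))) := by
          rw [mul_pow c δ (k - i)]
          ring
      _ = (n + 1) ^ 2 * (k.choose i * (n - k).choose (t - i)) *
          (n.choose k * ((c * δ) ^ k * (1 - δ) ^ (n - k))) := by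
          rw [hex, ← pow_add, ← pow_add]
          rw [show i + (k - i) = k by omega, show t - i + (n - t - (k - i)) = n - k by omega]
          ring
      _ ≤ (n + 1) ^ 2 * (k.choose i * (n - k).choose (t - i)) * (1 + δ * (c - 1)) ^ n := by
          gcongr
      _ = _ := by ring

/-! ### Expectations -/

namespace PMF
variable {α β : Type*}

/-- The expectation of a function with values in `[0, ∞]`. -/
noncomputable def expect (p : PMF α) (φ : α → ℝ≥0∞) : ℝ≥0∞ := ∑' a, p a * φ a

theorem expect_pure (a : α) (φ : α → ℝ≥0∞) : (PMF.pure a).expect φ = φ a := by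
  classical
  unfold expect
  rw [tsum_eq_single a]
  · simp
  · intro b hb
    simp [hb]

theorem expect_bind (p : PMF α) (f : α → PMF β) (φ : β → ℝ≥0∞) :
    (p.bind f).expect φ = p.expect fun a => (f a).expect φ := by
  unfold expect
  simp only [PMF.bind_apply, ← ENNReal.tsum_mul_right, ← ENNReal.tsum_mul_left]
  rw [ENNReal.tsum_comm]
  simp only [mul_assoc]

theorem expect_map (p : PMF α) (f : α → β) (φ : β → ℝ≥0∞) :
    (p.map f).expect φ = p.expect fun a => φ (f a) := by
  rw [← PMF.bind_pure_comp, expect_bind]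
  simp only [Function.comp_apply, expect_pure]

theorem expect_mono {p : PMF α} {φ ψ : α → ℝ≥0∞} (h : ∀ a ∈ p.support, φ a ≤ ψ a) :
    p.expect φ ≤ p.expect ψ := by
  refine ENNReal.tsum_le_tsum fun a => ?_
  by_cases ha : a ∈ p.support
  · gcongr
    exact h a ha
  · rw [PMF.mem_support_iff, not_not] at ha
    simp [ha]

theorem expect_const (p : PMF α) (r : ℝ≥0∞) : p.expect (fun _ => r) = r := by
  unfold expect
  rw [ENNReal.tsum_mul_right, p.tsum_coe, one_mul]

theorem expect_mul_const (p : PMF α) (φ : α → ℝ≥0∞) (r : ℝ≥0∞) :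
    p.expect (fun a => φ a * r) = p.expect φ * r := by
  unfold expect
  simp only [← mul_assoc, ENNReal.tsum_mul_right]

theorem toOuterMeasure_eq_expect (p : PMF α) (S : Set α) :
    p.toOuterMeasure S = p.expect (S.indicator fun _ => 1) := by
  classical
  rw [PMF.toOuterMeasure_apply]
  refine tsum_congr fun a => ?_
  by_cases h : a ∈ S <;> simp [h]

theorem expect_coin (φ : Bool → ℝ≥0∞) :
    (PMF.uniformOfFintype Bool).expect φ = 2⁻¹ * (φ false + φ true) := by
  unfold expect
  rw [tsum_bool]
  simp only [PMF.uniformOfFintype_apply, Fintype.card_bool, Nat.cast_ofNat]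
  ring

theorem mul_le_bind_apply (p : PMF α) (f : α → PMF β) (a : α) (b : β) :
    p a * f a b ≤ (p.bind f) b := by
  rw [PMF.bind_apply]
  exact ENNReal.le_tsum (f := fun a => p a * f a b) a

end PMF

/-! ### Random samples -/

/-- The value of the binary expansion of a list of bits, starting with `p`. -/
noncomputable def bitsVal (L : List Bool) (p : ℝ) : ℝ :=
  L.foldl (fun p b => (p + if b then 1 else 0) / 2) p

/-- `bitsVal L` is affine in its starting value; midpoints are all that fair coins require. -/
theorem bitsVal_mid (L : List Bool) (x y : ℝ) :
    bitsVal L ((x + y) / 2) = (bitsVal L x + bitsVal L y) / 2 := by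
  unfold bitsVal
  induction L generalizing x y with
  | nil => rfl
  | cons b L ih =>
    rw [List.foldl_cons, List.foldl_cons, List.foldl_cons, ← ih]
    congr 1
    ring

theorem bitsVal_mem (L : List Bool) {p : ℝ} (h0 : 0 ≤ p) (h1 : p ≤ 1) :
    0 ≤ bitsVal L p ∧ bitsVal L p ≤ 1 := by
  unfold bitsVal
  induction L generalizing p with
  | nil => exact ⟨h0, h1⟩
  | cons b L ih =>
    rw [List.foldl_cons]
    cases b
    · exact ih (by simp; linarith) (by simp; linarith)
    · exact ih (by simp; linarith) (by simp; linarith)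

/-- `n` random bits. -/
noncomputable def coins (n : ℕ) : PMF (List Bool) :=
  foldPMF (fun s _ => (PMF.uniformOfFintype Bool).map fun b => b :: s) (List.replicate n (0 : ℕ)) []

/-- A random bit which is `true` with probability `bitsVal L 0`. -/
noncomputable def biasedBit (L : List Bool) : PMF Bool :=
  foldPMF (fun r b => (PMF.uniformOfFintype Bool).map fun x => if x = true then b else r) L false

/-- A random sublist, every element is chosen with probability `bitsVal L 0`. -/
noncomputable def sublistPMF {β : Type} (L : List Bool) (U : List β) : PMF (List β) :=
  foldPMF (fun s u => (biasedBit L).map fun b => if b = true then u :: s else s) U []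

theorem expect_coins (F : ℝ → ℝ≥0∞) (n : ℕ) :
    (coins n).expect (fun L => F (bitsVal L 0)) =
      (2 ^ n)⁻¹ * ∑ u ∈ Finset.range (2 ^ n), F (u / 2 ^ n) := by
  -- New coins are pushed in front of `s` and read before it, so they merely make the starting value
  -- of `bitsVal s` uniform on the multiples of 2^(-n).
  have key : ∀ (n : ℕ) (s : List Bool),
      (foldPMF (fun s _ => (PMF.uniformOfFintype Bool).map fun b => b :: s)
        (List.replicate n (0 : ℕ)) s).expect (fun L => F (bitsVal L 0)) =
      (2 ^ n)⁻¹ * ∑ u ∈ Finset.range (2 ^ n), F (bitsVal s (u / 2 ^ n)) := by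
    intro n
    induction n with
    | zero => intro s; simp [foldPMF, PMF.expect_pure]
    | succ n ih =>
      intro s
      rw [List.replicate_succ, foldPMF, PMF.expect_bind, PMF.expect_map]
      simp only [ih]
      rw [PMF.expect_coin, pow_succ' (2 : ℕ), two_mul, Finset.sum_range_add, ← mul_add, ← mul_assoc]
      have e0 : (2 : ℝ≥0∞)⁻¹ * (2 ^ n)⁻¹ = (2 ^ (n + 1))⁻¹ := by
        rw [pow_succ', ENNReal.mul_inv (by simp) (by simp)]
      rw [e0]
      congr 2
      · refine Finset.sum_congr rfl fun u _ => ?_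
        congr 1
        change bitsVal s _ = _
        congr 1
        simp only [Bool.false_eq_true, if_false]
        rw [pow_succ]
        field_simp
        ring
      · refine Finset.sum_congr rfl fun u _ => ?_
        congr 1
        change bitsVal s _ = _
        congr 1
        simp only [if_true]
        push_cast
        rw [pow_succ]
        field_simp
        ring
  exact key n []

/-- Each fair coin either keeps the result r so far or replaces it by the current bit b. This
averages the probabilities belonging to r and b, just as a step of `bitsVal` averages its arguments;
the bits are read with the least significant one first. -/
theorem biasedBit_apply (L : List Bool) :
    biasedBit L true = ENNReal.ofReal (bitsVal L 0) ∧
      biasedBit L false = ENNReal.ofReal (1 - bitsVal L 0) := by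
  have key : ∀ (L : List Bool) (r : Bool) (y : Bool),
      foldPMF (fun r b => (PMF.uniformOfFintype Bool).map fun x => if x = true then b else r) L r y =
      ENNReal.ofReal (if y then bitsVal L (if r then 1 else 0)
        else 1 - bitsVal L (if r then 1 else 0)) := by
    intro L
    induction L with
    | nil => intro r y; cases r <;> cases y <;> simp [foldPMF, bitsVal]
    | cons b L ih =>
      intro r y
      have e : bitsVal (b :: L) (if r then 1 else 0) =
          (bitsVal L (if r then 1 else 0) + bitsVal L (if b then 1 else 0)) / 2 := by
        rw [← bitsVal_mid]
        rfl
      have hb := bitsVal_mem L (p := if b then 1 else 0) (by split_ifs <;> norm_num)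
        (by split_ifs <;> norm_num)
      have hr := bitsVal_mem L (p := if r then 1 else 0) (by split_ifs <;> norm_num)
        (by split_ifs <;> norm_num)
      have h2 : (2 : ℝ≥0∞)⁻¹ = ENNReal.ofReal 2⁻¹ := by
        rw [ENNReal.ofReal_inv_of_pos (by norm_num)]
        simp
      rw [foldPMF, PMF.bind_map, PMF.bind_apply, tsum_bool]
      simp only [PMF.uniformOfFintype_apply, Fintype.card_bool, Nat.cast_ofNat,
        Function.comp_apply, Bool.false_eq_true, if_false, if_true, ih]
      rw [e]
      generalize bitsVal L (if b then 1 else 0) = x at *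
      generalize bitsVal L (if r then 1 else 0) = z at *
      rw [h2, ← ENNReal.ofReal_mul (by norm_num), ← ENNReal.ofReal_mul (by norm_num),
        ← ENNReal.ofReal_add]
      · congr 1
        cases y <;> simp <;> ring
      · split_ifs <;> linarith
      · split_ifs <;> linarith
  have h1 := key L false true
  have h2 := key L false false
  simp only [Bool.false_eq_true, if_false, if_true] at h1 h2
  exact ⟨h1, h2⟩

/-- The probability of the single sequence of biased bits that selects exactly the elements with P.
A lower bound is enough, and the result is reversed because the fold pushes elements to the front.
-/
theorem sublistPMF_apply {β : Type} (L : List Bool) (P : β → Prop) [DecidablePred P] (U : List β)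
    (t : ℕ) (ht : U.countP P = t) :
    ENNReal.ofReal (bitsVal L 0 ^ t * (1 - bitsVal L 0) ^ (U.length - t)) ≤
      sublistPMF L U (U.filter P).reverse := by
  subst ht
  have key : ∀ (U s : List β),
      ENNReal.ofReal (bitsVal L 0 ^ (U.countP P) * (1 - bitsVal L 0) ^ (U.length - U.countP P)) ≤
      foldPMF (fun s u => (biasedBit L).map fun b => if b = true then u :: s else s) U s
        ((U.filter P).reverse ++ s) := by
    intro U
    obtain ⟨h0, h1⟩ := bitsVal_mem L le_rfl zero_le_one
    obtain ⟨ht, hf⟩ := biasedBit_apply L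
    induction U with
    | nil => intro s; simp [foldPMF]
    | cons u U ih =>
      intro s
      rw [foldPMF, PMF.bind_map]
      by_cases hu : P u
      · refine le_trans ?_ (PMF.mul_le_bind_apply _ _ true _)
        rw [ht]
        have e : (List.filter P (u :: U)).reverse ++ s = (List.filter P U).reverse ++ (u :: s) := by
          simp [hu]
        rw [e]
        refine le_trans (le_of_eq ?_) (mul_le_mul_right (ih (u :: s)) _)
        rw [← ENNReal.ofReal_mul h0, List.countP_cons_of_pos (by simpa using hu), List.length_cons,
          Nat.add_sub_add_right, pow_succ]
        congr 1
        ring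
      · refine le_trans ?_ (PMF.mul_le_bind_apply _ _ false _)
        rw [hf]
        have e : (List.filter P (u :: U)).reverse ++ s = (List.filter P U).reverse ++ s := by
          simp [hu]
        rw [e]
        refine le_trans (le_of_eq ?_) (mul_le_mul_right (ih s) _)
        have hle := List.countP_le_length (p := fun x => decide (P x)) (l := U)
        rw [← ENNReal.ofReal_mul (by linarith), List.countP_cons_of_neg (by simpa using hu),
          List.length_cons, Nat.succ_sub hle, pow_succ]
        congr 1
        ring
  have := key U []
  rw [List.append_nil] at this
  exact this

theorem sublistPMF_support {β : Type} (L : List Bool) (U X : List β)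
    (h : X ∈ (sublistPMF L U).support) : X.reverse.Sublist U := by
  have key : ∀ (U s : List β), ∀ X ∈ (foldPMF (fun s u => (biasedBit L).map fun b =>
      if b = true then u :: s else s) U s).support, ∃ V : List β, V.Sublist U ∧ X = V.reverse ++ s := by
    intro U
    induction U with
    | nil =>
      intro s X hX
      simp only [foldPMF, PMF.support_pure, Set.mem_singleton_iff] at hX
      exact ⟨[], List.Sublist.refl _, by simpa using hX⟩
    | cons u U ih =>
      intro s X hX
      simp only [foldPMF, PMF.mem_support_bind_iff, PMF.mem_support_map_iff] at hX
      obtain ⟨s', ⟨b, -, rfl⟩, hX⟩ := hX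
      obtain ⟨V, hV, rfl⟩ := ih _ X hX
      cases b
      · exact ⟨V, hV.cons u, by simp⟩
      · exact ⟨u :: V, hV.cons_cons u, by simp⟩
  obtain ⟨V, hV, rfl⟩ := key U [] X h
  simpa using hV

/-! ### The average over all biases -/

/-- Sort the (t + s + 1)-subsets of a set of B numbers by their (t + 1)-st smallest element u. -/
theorem sum_choose_mul_choose (B t s : ℕ) :
    ∑ u ∈ Finset.range B, u.choose t * (B - 1 - u).choose s = B.choose (t + s + 1) := by
  induction B generalizing s with
  | zero => simp
  | succ B ih =>
    rw [Finset.sum_range_succ, Nat.add_sub_cancel]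
    cases s with
    | zero =>
      have := ih 0
      simp only [Nat.choose_zero_right, mul_one] at this ⊢
      rw [this, Nat.add_zero, Nat.choose_succ_succ, add_comm]
    | succ s =>
      have h : ∀ u ∈ Finset.range B, u.choose t * (B - u).choose (s + 1) =
          u.choose t * (B - 1 - u).choose s + u.choose t * (B - 1 - u).choose (s + 1) := by
        intro u hu
        rw [Finset.mem_range] at hu
        rw [show B - u = (B - 1 - u) + 1 by omega, Nat.choose_succ_succ, mul_add]
      rw [Finset.sum_congr rfl h, Finset.sum_add_distrib, ih, ih]
      simp only [Nat.sub_self, Nat.choose_zero_succ, mul_zero, add_zero]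
      rw [show t + (s + 1) + 1 = (t + s + 1) + 1 by omega, Nat.choose_succ_succ]

/-- A discrete version of the Beta integral ∫ x^t (1-x)^(n-t) dx = 1/((n+1) C(n,t)), up to a factor
2. Powers are bounded below by falling factorials, whose sum is known exactly. The falling factorial
of B that results is at least (B - n)^(n+1), hence at least B^(n+1)/2 by Bernoulli's inequality and
the size of B. -/
theorem average_lower {B n t : ℕ} (ht : t ≤ n) (hB : 2 * (n + 1) ^ 2 ≤ B) :
    1 / (2 * (n + 1) * n.choose t) ≤
      (B : ℝ)⁻¹ * ∑ u ∈ Finset.range B, ((u : ℝ) / B) ^ t * (1 - u / B) ^ (n - t) := by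
  have hB0 : 0 < B := lt_of_lt_of_le (by positivity) hB
  have hB' : (0 : ℝ) < B := by exact_mod_cast hB0
  have h1 : t.factorial * (n - t).factorial * B.choose (n + 1) ≤
      ∑ u ∈ Finset.range B, u ^ t * (B - u) ^ (n - t) := by
    have := sum_choose_mul_choose B t (n - t)
    rw [show t + (n - t) + 1 = n + 1 by omega] at this
    rw [← this, Finset.mul_sum]
    refine Finset.sum_le_sum fun u hu => ?_
    calc _ = (t.factorial * u.choose t) * ((n - t).factorial * (B - 1 - u).choose (n - t)) := by
          ring
      _ = u.descFactorial t * (B - 1 - u).descFactorial (n - t) := by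
          rw [Nat.descFactorial_eq_factorial_mul_choose, Nat.descFactorial_eq_factorial_mul_choose]
      _ ≤ u ^ t * (B - 1 - u) ^ (n - t) :=
          Nat.mul_le_mul (Nat.descFactorial_le_pow _ _) (Nat.descFactorial_le_pow _ _)
      _ ≤ _ := Nat.mul_le_mul_left _ (Nat.pow_le_pow_left (by omega) _)
  have h2 : (B - n) ^ (n + 1) ≤ (n + 1).factorial * B.choose (n + 1) := by
    rw [← Nat.descFactorial_eq_factorial_mul_choose]
    have := Nat.pow_sub_le_descFactorial B (n + 1)
    rwa [Nat.add_sub_add_right] at this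
  have hnB : n ≤ B := by nlinarith
  have h3 : (B : ℝ) ^ (n + 1) / 2 ≤ ((B - n : ℕ) : ℝ) ^ (n + 1) := by
    rw [Nat.cast_sub hnB]
    have hBr : (2 : ℝ) * (n + 1) ^ 2 ≤ B := by exact_mod_cast hB
    have hb := one_add_mul_le_pow (a := -((n : ℝ) / B)) (by
      have : (n : ℝ) / B ≤ 1 := by rw [div_le_one hB']; exact_mod_cast hnB
      linarith) (n + 1)
    have e : ((B : ℝ) - n) ^ (n + 1) = B ^ (n + 1) * (1 + -((n : ℝ) / B)) ^ (n + 1) := by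
      rw [← mul_pow]
      congr 1
      field_simp
      ring
    rw [e, div_eq_mul_one_div]
    gcongr
    refine le_trans ?_ hb
    have : ((n + 1 : ℕ) : ℝ) * (n / B) ≤ 1 / 2 := by
      rw [← mul_div_assoc, div_le_iff₀ hB']
      push_cast
      nlinarith [(Nat.cast_nonneg n : (0 : ℝ) ≤ n)]
    linarith
  have h4 : (n.choose t : ℝ) * (t.factorial * (n - t).factorial) = n.factorial := by
    have := Nat.choose_mul_factorial_mul_factorial ht
    rw [mul_assoc] at this
    exact_mod_cast this
  have h5 : (B : ℝ) ^ (n + 1) / 2 ≤ (n + 1) * n.choose t *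
      ∑ u ∈ Finset.range B, (u : ℝ) ^ t * (B - u) ^ (n - t) := by
    have h1' : (t.factorial : ℝ) * (n - t).factorial * B.choose (n + 1) ≤
        ∑ u ∈ Finset.range B, (u : ℝ) ^ t * (B - u) ^ (n - t) := by
      have : ((t.factorial * (n - t).factorial * B.choose (n + 1) : ℕ) : ℝ) ≤
        ((∑ u ∈ Finset.range B, u ^ t * (B - u) ^ (n - t) : ℕ) : ℝ) := by exact_mod_cast h1
      push_cast at this
      refine this.trans (le_of_eq (Finset.sum_congr rfl fun u hu => ?_))
      rw [Finset.mem_range] at hu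
      rw [Nat.cast_sub hu.le]
    have h2' : ((B - n : ℕ) : ℝ) ^ (n + 1) ≤ (n + 1).factorial * B.choose (n + 1) := by
      exact_mod_cast h2
    calc _ ≤ _ := h3
      _ ≤ _ := h2'
      _ = (n + 1) * n.choose t * (t.factorial * (n - t).factorial * B.choose (n + 1)) := by
          rw [Nat.factorial_succ]
          push_cast
          rw [← h4]
          ring
      _ ≤ _ := by gcongr
  have h6 : ∑ u ∈ Finset.range B, ((u : ℝ) / B) ^ t * (1 - u / B) ^ (n - t) =
      (∑ u ∈ Finset.range B, (u : ℝ) ^ t * (B - u) ^ (n - t)) / B ^ n := by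
    rw [Finset.sum_div]
    refine Finset.sum_congr rfl fun u _ => ?_
    have : (1 : ℝ) - u / B = (B - u) / B := by field_simp
    rw [this, div_pow, div_pow, div_mul_div_comm, ← pow_add, Nat.add_sub_cancel' ht]
  have hch : (0 : ℝ) < n.choose t := by exact_mod_cast Nat.choose_pos ht
  rw [h6, div_le_iff₀ (by positivity)]
  have e : (B : ℝ)⁻¹ * ((∑ u ∈ Finset.range B, (u : ℝ) ^ t * (B - u) ^ (n - t)) / B ^ n) *
      (2 * (n + 1) * n.choose t) = ((n + 1) * n.choose t *
      ∑ u ∈ Finset.range B, (u : ℝ) ^ t * (B - u) ^ (n - t)) / (B ^ (n + 1) / 2) := by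
    rw [pow_succ]
    field_simp
  rw [e, le_div_iff₀ (by positivity), one_mul]
  exact h5

/-- A random sublist of `U`, chosen with the help of `ℓ` random bits for the bias. -/
noncomputable def randomSample {β : Type} (ℓ : ℕ) (U : List β) : PMF (List β) :=
  (coins ℓ).bind fun L => sublistPMF L U

theorem randomSample_support {β : Type} {ℓ : ℕ} {U X : List β}
    (h : X ∈ (randomSample ℓ U).support) : X.reverse.Sublist U := by
  rw [randomSample, PMF.mem_support_bind_iff] at h
  obtain ⟨L, -, h⟩ := h
  exact sublistPMF_support L U X h

theorem card_split_subsets {β : Type} [DecidableEq β] {V O : Finset β} (hO : O ⊆ V) {i t : ℕ}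
    (hit : i ≤ t) :
    O.card.choose i * (V.card - O.card).choose (t - i) ≤
      (V.powerset.filter fun A => A.card = t ∧ (A ∩ O).card = i).card := by
  rw [← Finset.card_sdiff_of_subset hO, ← Finset.card_powersetCard, ← Finset.card_powersetCard,
    ← Finset.card_product]
  have hdis : ∀ p ∈ Finset.powersetCard i O ×ˢ Finset.powersetCard (t - i) (V \ O),
      (p.1 ∪ p.2) ∩ O = p.1 ∧ (p.1 ∪ p.2) \ O = p.2 ∧ Disjoint p.1 p.2 := by
    intro p hp
    simp only [Finset.mem_product, Finset.mem_powersetCard] at hp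
    obtain ⟨⟨h1, -⟩, h2, -⟩ := hp
    have h3 : Disjoint p.2 O := Finset.disjoint_of_subset_left h2 Finset.sdiff_disjoint
    refine ⟨?_, ?_, (Finset.disjoint_of_subset_right h1 h3).symm⟩
    · rw [Finset.union_inter_distrib_right, Finset.inter_eq_left.2 h1,
        Finset.disjoint_iff_inter_eq_empty.1 h3, Finset.union_empty]
    · rw [Finset.union_sdiff_distrib, Finset.sdiff_eq_empty_iff_subset.2 h1, Finset.empty_union,
        Finset.sdiff_eq_self_of_disjoint h3]
  refine Finset.card_le_card_of_injOn (fun p => p.1 ∪ p.2) ?_ ?_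
  · intro p hp
    have h := hdis p hp
    simp only [Finset.coe_product, Set.mem_prod, Finset.mem_coe, Finset.mem_powersetCard] at hp
    simp only [Finset.coe_filter, Finset.mem_powerset, Set.mem_ofPred_eq]
    refine ⟨Finset.union_subset (hp.1.1.trans hO) (hp.2.1.trans Finset.sdiff_subset), ?_, ?_⟩
    · rw [Finset.card_union_of_disjoint h.2.2, hp.1.2, hp.2.2]
      omega
    · rw [h.1, hp.1.2]
  · intro p hp p' hp' he
    have h := hdis p hp
    have h' := hdis p' hp'
    dsimp only at he
    refine Prod.ext ?_ ?_
    · rw [← h.1, he, h'.1]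
    · rw [← h.2.1, he, h'.2.1]

/-- Different sets A correspond to different outcome lists, so the bounds for the individual lists
add up. -/
theorem sublistPMF_lower {β : Type} [DecidableEq β] (L : List Bool) {U : List β} (hU : U.Nodup)
    {O : Finset β} (hO : O ⊆ U.toFinset) {i t : ℕ} (hit : i ≤ t) :
    ((O.card.choose i * (U.length - O.card).choose (t - i) : ℕ) : ℝ≥0∞) *
      ENNReal.ofReal (bitsVal L 0 ^ t * (1 - bitsVal L 0) ^ (U.length - t)) ≤
      (sublistPMF L U).expect
        ({X | X.toFinset.card = t ∧ (X.toFinset ∩ O).card = i}.indicator fun _ => 1) := by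
  classical
  set 𝒜 := U.toFinset.powerset.filter fun A => A.card = t ∧ (A ∩ O).card = i with h𝒜
  have hcard := card_split_subsets hO hit
  rw [List.toFinset_card_of_nodup hU, ← h𝒜] at hcard
  let f : Finset β → List β := fun A => (U.filter fun x => x ∈ A).reverse
  have hf : ∀ A ∈ 𝒜, (f A).toFinset = A := by
    intro A hA
    have hAU := Finset.mem_powerset.1 (Finset.mem_filter.1 hA).1
    ext x
    simp only [f, List.toFinset_reverse, List.mem_toFinset, List.mem_filter, decide_eq_true_eq]
    exact ⟨fun h => h.2, fun h => ⟨List.mem_toFinset.1 (hAU h), h⟩⟩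
  have hinj : Set.InjOn f 𝒜 := fun A hA B hB h => by
    rw [← hf A hA, ← hf B hB, h]
  calc _ ≤ (𝒜.card : ℝ≥0∞) *
        ENNReal.ofReal (bitsVal L 0 ^ t * (1 - bitsVal L 0) ^ (U.length - t)) := by
        gcongr
    _ = ∑ A ∈ 𝒜, ENNReal.ofReal (bitsVal L 0 ^ t * (1 - bitsVal L 0) ^ (U.length - t)) := by
        rw [Finset.sum_const, nsmul_eq_mul]
    _ ≤ ∑ A ∈ 𝒜, sublistPMF L U (f A) := by
        refine Finset.sum_le_sum fun A hA => sublistPMF_apply L (fun x => x ∈ A) U t ?_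
        have h1 := hf A hA
        have h2 := (Finset.mem_filter.1 hA).2.1
        rw [List.countP_eq_length_filter, ← h2, ← h1,
          List.toFinset_card_of_nodup (List.nodup_reverse.2 (hU.filter _)), List.length_reverse]
        simp only [h1]
    _ = ∑ X ∈ 𝒜.image f, sublistPMF L U X *
        ({X | X.toFinset.card = t ∧ (X.toFinset ∩ O).card = i}.indicator (fun _ => 1) X) := by
        rw [Finset.sum_image hinj]
        refine Finset.sum_congr rfl fun A hA => ?_
        rw [Set.indicator_of_mem, mul_one]
        rw [Set.mem_ofPred_eq, hf A hA]
        exact (Finset.mem_filter.1 hA).2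
    _ ≤ _ := ENNReal.sum_le_tsum _

/-- Averaged over the bias, every t-set has probability at least 1/(2(n+1) C(n,t)), for all t at
once. Up to the factor 2(n+1), the sample serves as a uniform t-set without t being known. -/
theorem randomSample_lower {β : Type} [DecidableEq β] {ℓ : ℕ} {U : List β} (hU : U.Nodup)
    {O : Finset β} (hO : O ⊆ U.toFinset) {i t : ℕ} (hit : i ≤ t) (ht : t ≤ U.length)
    (hℓ : 2 * (U.length + 1) ^ 2 ≤ 2 ^ ℓ) :
    ENNReal.ofReal (O.card.choose i * (U.length - O.card).choose (t - i) /
      (2 * (U.length + 1) * U.length.choose t)) ≤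
      (randomSample ℓ U).expect
        ({X | X.toFinset.card = t ∧ (X.toFinset ∩ O).card = i}.indicator fun _ => 1) := by
  set n := U.length with hn
  set M := O.card.choose i * (n - O.card).choose (t - i) with hM
  rw [randomSample, PMF.expect_bind]
  refine le_trans ?_ (PMF.expect_mono fun L _ => sublistPMF_lower L hU hO hit)
  rw [← hn, ← hM, expect_coins fun x => (M : ℝ≥0∞) * ENNReal.ofReal (x ^ t * (1 - x) ^ (n - t))]
  have havg := average_lower ht hℓ
  push_cast at havg
  have hnn : ∀ u ∈ Finset.range (2 ^ ℓ),
      (0 : ℝ) ≤ ((u : ℝ) / 2 ^ ℓ) ^ t * (1 - u / 2 ^ ℓ) ^ (n - t) := by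
    intro u hu
    rw [Finset.mem_range] at hu
    have : (u : ℝ) / 2 ^ ℓ ≤ 1 := by
      rw [div_le_one (by positivity)]
      exact_mod_cast hu.le
    have : (0 : ℝ) ≤ 1 - u / 2 ^ ℓ := by linarith
    positivity
  rw [← Finset.mul_sum, ← ENNReal.ofReal_sum_of_nonneg hnn]
  have h2 : ((2 : ℝ≥0∞) ^ ℓ)⁻¹ = ENNReal.ofReal ((2 : ℝ) ^ ℓ)⁻¹ := by
    rw [ENNReal.ofReal_inv_of_pos (by positivity), ENNReal.ofReal_pow (by norm_num)]
    simp
  rw [h2, ← ENNReal.ofReal_natCast M, ← ENNReal.ofReal_mul (by positivity),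
    ← ENNReal.ofReal_mul (by positivity)]
  refine ENNReal.ofReal_le_ofReal ?_
  calc _ = (M : ℝ) * (1 / (2 * (n + 1) * n.choose t)) := by rw [hM]; push_cast; ring
    _ ≤ M * (((2 : ℝ) ^ ℓ)⁻¹ * ∑ u ∈ Finset.range (2 ^ ℓ),
        ((u : ℝ) / 2 ^ ℓ) ^ t * (1 - u / 2 ^ ℓ) ^ (n - t)) := by gcongr
    _ = _ := by ring

/-! ### Programs for random samples -/

section
variable {A B C : Type} [Enc A] [Enc B] [Enc C]

theorem comp_coin (D : A → Prop) : Comp D (fun _ => PMF.uniformOfFintype Bool) fun _ => 1 :=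
  ⟨.coin, fun a _ => Prog.runs_coin (enc a)⟩

/-- A random computation, followed by one that may also use the input. -/
theorem Comp.bindWith {D : A → Prop} {D' : B × A → Prop} {f : A → PMF B} {g : B × A → PMF C}
    {T T'' : A → ℝ} {T' : B × A → ℝ} (hf : Comp D f T) (hg : Comp D' g T')
    (h : ∀ a, D a → ∀ b ∈ (f a).support, D' (b, a) ∧ T' (b, a) ≤ T'' a) :
    Comp D (fun a => (f a).bind fun b => g (b, a)) fun a => T a + T'' a + 3 := by
  have := (Comp.pair hf (DetComp.id D)).bind hg (T'' := T'') (by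
    intro a ha q hq
    simp only [PMF.pure_map, PMF.mem_support_bind_iff, PMF.support_pure,
      Set.mem_singleton_iff] at hq
    obtain ⟨b, hb, rfl⟩ := hq
    exact h a ha b hb)
  refine (this.congr fun a _ => ?_).mono (fun _ h => h) fun a _ => by linarith
  simp only [PMF.pure_map, PMF.bind_bind, PMF.pure_bind]

theorem Comp.mapWith {D : A → Prop} {D' : B × A → Prop} {f : A → PMF B} {g : B × A → C}
    {T T'' : A → ℝ} {T' : B × A → ℝ} (hf : Comp D f T) (hg : DetComp D' g T')
    (h : ∀ a, D a → ∀ b ∈ (f a).support, D' (b, a) ∧ T' (b, a) ≤ T'' a) :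
    Comp D (fun a => (f a).map fun b => g (b, a)) fun a => T a + T'' a + 3 := by
  refine (hf.bindWith hg h).congr fun a _ => ?_
  rw [← PMF.bind_pure_comp]
  rfl

theorem foldPMF_support_length {σ β : Type} {step : σ → β → PMF σ} {P : List β → σ → Prop}
    (h : ∀ b r s, P (b :: r) s → ∀ s' ∈ (step s b).support, P r s') :
    ∀ l s, P l s → ∀ s' ∈ (foldPMF step l s).support, P [] s' := by
  intro l
  induction l with
  | nil =>
    intro s hs s' hs'
    simp only [foldPMF, PMF.support_pure, Set.mem_singleton_iff] at hs'
    rwa [hs']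
  | cons b l ih =>
    intro s hs s' hs'
    rw [foldPMF, PMF.mem_support_bind_iff] at hs'
    obtain ⟨s'', h1, h2⟩ := hs'
    exact ih s'' (h b l s hs s'' h1) s' h2

theorem coins_length {n : ℕ} {L : List Bool} (h : L ∈ (coins n).support) : L.length = n := by
  have := foldPMF_support_length (P := fun r (s : List Bool) => s.length + r.length = n)
    (step := fun s _ => (PMF.uniformOfFintype Bool).map fun b => b :: s) (by
      intro b r s hs s' hs'
      rw [PMF.mem_support_map_iff] at hs'
      obtain ⟨x, -, rfl⟩ := hs'
      simp only [List.length_cons] at hs ⊢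
      omega) (List.replicate n (0 : ℕ)) [] (by simp) L h
  simpa using this

theorem comp_coins : Comp (fun _ => True) coins fun n => 100 * (n + 1) := by
  have hs : Comp (fun _ => True)
      (fun q : ℕ × List Bool × ℕ => (PMF.uniformOfFintype Bool).map fun b => b :: q.2.1)
      fun _ => 20 := by
    have h1 : DetComp (fun _ => True) (fun q : Bool × ℕ × List Bool × ℕ => q.1 :: q.2.2.1) _ :=
      (DetComp.listCons fun _ => True).comp ((DetComp.fst fun _ => True).pair
        ((DetComp.fst fun _ => True).comp ((DetComp.snd fun _ => True).comp
          (DetComp.snd fun _ => True) fun _ _ => trivial) fun _ _ => trivial)) fun _ _ => trivial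
    exact ((comp_coin fun _ => True).mapWith h1 (T'' := fun _ => 9)
      (fun _ _ _ _ => ⟨trivial, by norm_num⟩)).mono (fun _ h => h) fun _ _ => by norm_num
  have h := Comp.fold (fun _ _ _ => True) (τ := fun _ => 20) (DetComp.replicate fun _ => True)
    (DetComp.emptyList fun _ => True) hs (fun _ _ _ _ => trivial)
    (fun _ _ _ _ _ _ => ⟨trivial, le_rfl, fun _ _ => trivial⟩)
  refine (h.congr fun n _ => ?_).mono (fun _ h => h) fun n _ => ?_
  · rw [PMF.pure_bind]
    rfl
  · rw [List.length_replicate]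
    linarith [(Nat.cast_nonneg n : (0 : ℝ) ≤ n)]

theorem DetComp.iteBool {D : A → Prop} {g : A → Bool} {f₁ f₂ : A → B} {T T₁ T₂ : A → ℝ}
    (hg : DetComp D g T) (h₁ : DetComp D f₁ T₁) (h₂ : DetComp D f₂ T₂) :
    DetComp D (fun a => if g a = true then f₁ a else f₂ a)
      fun a => T a + max (T₁ a) (T₂ a) + 1 := by
  have h := Comp.ite (P := fun a => g a = true) hg (fun a _ => enc_bool_ne_nil (g a))
    (h₁.mono (fun _ h => h.1) fun _ _ => le_rfl) (h₂.mono (fun _ h => h.1) fun _ _ => le_rfl)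
  refine (h.congr fun a _ => ?_).mono (fun _ h => h) fun a _ => ?_
  · dsimp only
    split_ifs <;> rfl
  · split_ifs
    · linarith [le_max_left (T₁ a) (T₂ a)]
    · linarith [le_max_right (T₁ a) (T₂ a)]

theorem comp_biasedBit : Comp (fun _ => True) biasedBit fun L => 100 * (L.length + 1) := by
  have hs : Comp (fun _ => True) (fun q : List Bool × Bool × Bool =>
      (PMF.uniformOfFintype Bool).map fun x => if x = true then q.2.2 else q.2.1)
      fun _ => 20 := by
    have h0 := (DetComp.snd (A := List Bool) (B := Bool × Bool) fun _ => True).comp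
      (DetComp.snd (A := Bool) fun _ => True) fun _ _ => trivial
    have h1 := (DetComp.fst (A := Bool) (B := List Bool × Bool × Bool) fun _ => True).iteBool
      ((DetComp.snd (A := Bool) (B := Bool) fun _ => True).comp h0 fun _ _ => trivial)
      ((DetComp.fst (A := Bool) (B := Bool) fun _ => True).comp h0 fun _ _ => trivial)
    exact ((comp_coin fun _ => True).mapWith h1 (T'' := fun _ => 9)
      (fun _ _ _ _ => ⟨trivial, by norm_num⟩)).mono (fun _ h => h) fun _ _ => by norm_num
  have hi : DetComp (fun _ => True) (fun _ : List Bool => false) fun _ => 1 :=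
    ⟨.nil, fun a _ => by rw [PMF.pure_map]; exact Prog.runs_nil (enc a)⟩
  have h := Comp.fold (fun _ _ _ => True) (τ := fun _ => 20) (DetComp.id fun _ => True)
    hi hs (fun _ _ _ _ => trivial)
    (fun _ _ _ _ _ _ => ⟨trivial, le_rfl, fun _ _ => trivial⟩)
  refine (h.congr fun L _ => ?_).mono (fun _ h => h) fun L _ => ?_
  · rw [PMF.pure_bind]
    rfl
  · linarith [(Nat.cast_nonneg L.length : (0 : ℝ) ≤ L.length)]

theorem comp_randomSample :
    Comp (fun _ => True) (fun q : ℕ × List A => randomSample q.1 q.2)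
      fun q => 1000 * (q.1 + 1) * (q.2.length + 1) := by
  have hs : Comp (fun _ => True) (fun q : (List Bool × ℕ × List A) × List A × A =>
      (biasedBit q.1.1).map fun b => if b = true then q.2.2 :: q.2.1 else q.2.1)
      fun q => 100 * (q.1.1.length + 1) + 30 := by
    have h0 := (DetComp.snd (A := List Bool × ℕ × List A) (B := List A × A) fun _ => True).comp
      (DetComp.snd (A := Bool) fun _ => True) fun _ _ => trivial
    have h1 := (DetComp.fst (A := List A) (B := A) fun _ => True).comp h0 fun _ _ => trivial
    have h2 := (DetComp.snd (A := List A) (B := A) fun _ => True).comp h0 fun _ _ => trivial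
    have h3 := (DetComp.fst (A := Bool) (B := (List Bool × ℕ × List A) × List A × A)
      fun _ => True).iteBool ((DetComp.listCons fun _ => True).comp (h2.pair h1)
        fun _ _ => trivial) h1
    have hb := comp_biasedBit.comp ((DetComp.fst fun _ => True).comp
      (DetComp.fst (A := List Bool × ℕ × List A) (B := List A × A) fun _ => True)
      fun _ _ => trivial) fun _ _ => trivial
    exact (hb.mapWith h3 (T'' := fun _ => 20)
      (fun _ _ _ _ => ⟨trivial, by norm_num⟩)).mono (fun _ h => h) fun _ _ => by linarith
  have h := Comp.fold (A := List Bool × ℕ × List A) (D := fun _ => True) (fun _ _ _ => True)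
    (τ := fun q => 100 * (q.1.length + 1) + 30)
    ((DetComp.snd (A := ℕ) (B := List A) fun _ => True).comp
      (DetComp.snd (A := List Bool) fun _ => True) fun _ _ => trivial)
    (DetComp.emptyList fun _ => True) hs (fun _ _ _ _ => trivial)
    (fun _ _ _ _ _ _ => ⟨trivial, le_rfl, fun _ _ => trivial⟩)
  have hc := comp_coins.comp (DetComp.fst (A := ℕ) (B := List A) fun _ => True) fun _ _ => trivial
  have := hc.bindWith h (T'' := fun q => 1 + 1 + 1 + 1 +
    q.2.length * (100 * (q.1 + 1) + 30 + 40) + 20) (by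
      intro q _ L hL
      refine ⟨trivial, ?_⟩
      rw [coins_length hL])
  refine (this.congr fun q _ => ?_).mono (fun _ h => h) fun q _ => ?_
  · simp only [PMF.pure_bind]
    rfl
  · have h1 := (Nat.cast_nonneg q.2.length : (0 : ℝ) ≤ q.2.length)
    have h2 := (Nat.cast_nonneg q.1 : (0 : ℝ) ≤ q.1)
    nlinarith [mul_nonneg h1 h2]

end

/-! ### Depth and size -/

/-- The height of a tree. -/
def Data.depth : Data → ℕ
  | nil => 0
  | cons a b => max a.depth b.depth + 1

theorem Data.depth_le_size (d : Data) : d.depth ≤ d.size := by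
  induction d with
  | nil => simp [Data.depth]
  | cons a b iha ihb =>
    simp only [Data.depth, Data.size]
    omega

/-- Sharing lets the size of a tree double in one step, but its height grows by at most one per
step. -/
theorem Prog.Eval.depth_le {p : Prog} {x : Data} {μ : PMF (Data × ℕ)} (h : p.Eval x μ) :
    ∀ o ∈ μ.support, o.1.depth ≤ x.depth + o.2 := by
  induction h with
  | id x => simp
  | nil x => simp [Data.depth]
  | hd x => cases x <;> simp [Data.hd, Data.depth]; omega
  | tl x => cases x <;> simp [Data.tl, Data.depth]; omega
  | coin x =>
    intro o ho
    rw [PMF.mem_support_map_iff] at ho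
    obtain ⟨b, -, rfl⟩ := ho
    cases b <;> simp [Data.ofBool, Data.depth]
  | cons _ _ ih₁ ih₂ =>
    intro o ho
    simp only [PMF.mem_support_bind_iff, PMF.mem_support_map_iff] at ho
    obtain ⟨a, ha, r, hr, rfl⟩ := ho
    have := ih₁ a ha
    have := ih₂ r hr
    simp only [Data.depth]
    omega
  | seq _ _ ih₁ ih₂ =>
    intro o ho
    simp only [PMF.mem_support_bind_iff, PMF.mem_support_map_iff] at ho
    obtain ⟨a, ha, r, hr, rfl⟩ := ho
    have := ih₁ a ha
    have := ih₂ a ha r hr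
    dsimp only
    omega
  | cond _ _ _ ih₁ ih₂ ih₃ =>
    intro o ho
    simp only [PMF.mem_support_bind_iff, PMF.mem_support_map_iff] at ho
    obtain ⟨a, ha, r, hr, rfl⟩ := ho
    dsimp only
    by_cases hn : a.1 = Data.nil
    · have := ih₃ a ha hn r hr
      omega
    · have := ih₂ a ha hn r hr
      omega
  | loop _ ih => exact ih

section
variable {A : Type} [Enc A]

theorem length_le_depth (l : List A) : l.length ≤ (enc l).depth := by
  induction l with
  | nil => simp
  | cons a l ih =>
    rw [enc_list_cons, Data.depth, List.length_cons]
    omega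

theorem depth_le_of_mem {a : A} {l : List A} (h : a ∈ l) : (enc a).depth ≤ (enc l).depth := by
  induction l with
  | nil => simp at h
  | cons b l ih =>
    rw [enc_list_cons, Data.depth]
    rcases List.mem_cons.1 h with rfl | h
    · omega
    · have := ih h
      omega

theorem esize_list (l : List A) : esize l = (l.map fun a => esize a + 1).sum + 1 := by
  induction l with
  | nil => rfl
  | cons a l ih =>
    rw [esize_cons, ih, List.map_cons, List.sum_cons]
    omega

theorem esize_le_of_subset [DecidableEq A] {X Y : List A} (hX : X.Nodup) (h : X ⊆ Y) :
    esize X ≤ esize Y := by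
  rw [esize_list, esize_list]
  obtain ⟨Z, hZ, hZY⟩ := hX.subperm h
  rw [← (hZ.map _).sum_eq]
  have := (hZY.map fun a => esize a + 1).sum_le_sum (by simp)
  omega

theorem esize_list_le (l : List A) (D : ℕ) (h : ∀ a ∈ l, esize a ≤ D) :
    esize l ≤ l.length * (D + 1) + 1 := by
  rw [esize_list]
  have := List.sum_le_card_nsmul (l.map fun a => esize a + 1) (D + 1) (by
    intro x hx
    obtain ⟨a, ha, rfl⟩ := List.mem_map.1 hx
    have := h a ha
    omega)
  simp only [List.length_map, smul_eq_mul] at this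
  omega

end

/-! ### The given algorithms as typed computations -/

namespace ImplicitSetSystem
variable {Φ : ImplicitSetSystem}

/-- The size of the universe is bounded through the height of its code: a list of height D has at
most D entries, and each of these strings has at most D bits, so the total size is O(D²). -/
theorem PolyTimeComputable.exists_universe (h : Φ.PolyTimeComputable) :
    ∃ U : List Bool → List (List Bool), PolyTime U ∧
      ∀ I, (U I).Nodup ∧ (U I).toFinset = Φ.U I := by
  obtain ⟨⟨p, P, -, h⟩, -⟩ := h
  choose y hy hp using h
  choose U hU1 hU2 hU3 using hy
  refine ⟨U, ?_, fun I => ⟨hU1 I, hU2 I⟩⟩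
  refine PolyTime.of_bounds (T := fun I => (P.eval (esize I) : ℕ)) P
    ((.X + P) * (4 * (.X + P) + 2) + 1) ⟨p, fun I _ => ?_⟩ (fun I => le_rfl) fun I => ?_
  · rw [PMF.pure_map]
    have := (hp I).runs
    rw [hU3 I] at this
    exact this
  · set D := esize I + P.eval (esize I) with hD
    have hdep : (enc (U I)).depth ≤ D := by
      obtain ⟨s, hs, he⟩ := hp I
      have := he.depth_le (y I, s) (by simp)
      have h2 := Data.depth_le_size (Data.ofString I)
      have e1 : (Data.ofString I).size = esize I := rfl
      have e2 : (y I).depth = (enc (U I)).depth := by rw [hU3 I]; rfl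
      dsimp only at this
      rw [e1] at h2 hs
      omega
    have h1 := (length_le_depth (U I)).trans hdep
    have h2 : ∀ s ∈ U I, esize s ≤ 4 * D + 1 := by
      intro s hs
      have h3 := (length_le_depth s).trans ((depth_le_of_mem hs).trans hdep)
      have h4 := esize_list_le s 3 fun b _ => esize_bool_le b
      omega
    have h3 := esize_list_le (U I) (4 * D + 1) h2
    simp only [Polynomial.eval_add, Polynomial.eval_mul, Polynomial.eval_X, Polynomial.eval_ofNat,
      Polynomial.eval_one]
    rw [← hD]
    calc _ ≤ _ := h3
      _ ≤ D * (4 * D + 1 + 1) + 1 := by gcongr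
      _ = _ := by ring

/-- `X` lists the elements of a subset of the universe. -/
def ListsSubset (Φ : ImplicitSetSystem) (I : List Bool) (X : List (List Bool)) : Prop :=
  X.Nodup ∧ X.toFinset ⊆ Φ.U I

theorem ListsSubset.isCode {I : List Bool} {X : List (List Bool)} (h : Φ.ListsSubset I X) :
    (enc X).IsCode X.toFinset := ⟨X, h.1, rfl, rfl⟩

theorem PolyTimeComputable.exists_test (h : Φ.PolyTimeComputable) :
    ∃ (f : List Bool × List (List Bool) → Data) (P : Polynomial ℕ),
      DetComp (fun q => Φ.ListsSubset q.1 q.2) f (fun q => (P.eval (esize q) : ℕ)) ∧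
      ∀ q, Φ.ListsSubset q.1 q.2 → (enc (f q) ≠ Data.nil ↔ q.2.toFinset ∈ Φ.F q.1) := by
  obtain ⟨-, p, P, -, h⟩ := h
  have h' : ∀ q : List Bool × List (List Bool), ∃ y, Φ.ListsSubset q.1 q.2 →
      (y ≠ Data.nil ↔ q.2.toFinset ∈ Φ.F q.1) ∧ p.ReturnsWithin (enc q) (P.eval (esize q)) y := by
    intro q
    by_cases hq : Φ.ListsSubset q.1 q.2
    · obtain ⟨y, h1, h2⟩ := h q.1 q.2.toFinset (enc q.2) hq.2 hq.isCode
      exact ⟨y, fun _ => ⟨h1, h2⟩⟩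
    · exact ⟨Data.nil, fun h => absurd h hq⟩
  choose f hf using h'
  refine ⟨f, P, ⟨p, fun q hq => ?_⟩, fun q hq => (hf q hq).1⟩
  rw [PMF.pure_map]
  exact (hf q hq).2.runs

/-- Outputs are codes of lists on every outcome of the coins, so they can be decoded without
changing the distribution; outside the promised inputs the function is arbitrary. -/
theorem HasRandomizedExtensionAlgorithm.exists_comp {α c : ℝ}
    (h : Φ.HasRandomizedExtensionAlgorithm α c) :
    ∃ (f : List Bool × List (List Bool) × ℕ → PMF (List (List Bool))) (P : Polynomial ℕ)
      (ε : ℝ≥0∞), 0 < ε ∧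
      Comp (fun q => Φ.ListsSubset q.1 q.2.1) f
        (fun q => (P.eval (esize q) : ℕ) * c ^ q.2.2) ∧
      ∀ q, Φ.ListsSubset q.1 q.2.1 → (∀ Y ∈ (f q).support, Φ.ListsSubset q.1 Y) ∧
        ε ≤ (f q).expect ({Y | Φ.IsExtension α q.1 q.2.1.toFinset q.2.2 Y.toFinset}.indicator
          fun _ => 1) := by
  obtain ⟨p, P, ε, hε, h⟩ := h
  have h' : ∀ q : List Bool × List (List Bool) × ℕ, ∃ ν : PMF (List (List Bool)),
      Φ.ListsSubset q.1 q.2.1 →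
      p.Runs (enc q) ((P.eval (esize q) : ℕ) * c ^ q.2.2) (ν.map enc) ∧
      (∀ Y ∈ ν.support, Φ.ListsSubset q.1 Y) ∧
      ε ≤ ν.expect ({Y | Φ.IsExtension α q.1 q.2.1.toFinset q.2.2 Y.toFinset}.indicator
          fun _ => 1) := by
    intro q
    by_cases hq : Φ.ListsSubset q.1 q.2.1
    · obtain ⟨μ, h1, h2, h3⟩ := h q.1 q.2.1.toFinset (enc q.2.1) q.2.2 hq.2 hq.isCode
      have h2' : ∀ o ∈ μ.support, ∃ Y : List (List Bool), Φ.ListsSubset q.1 Y ∧ o.1 = enc Y := by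
        intro o ho
        obtain ⟨Y, hY, l, hl, rfl, hc⟩ := h2 o ho
        exact ⟨l, ⟨hl, hY⟩, hc⟩
      have hinv : ∀ Y : List (List Bool), Function.invFun enc (enc Y) = Y :=
        Function.leftInverse_invFun enc_injective
      refine ⟨μ.map fun o => Function.invFun enc o.1, fun _ => ⟨⟨μ, h1, ?_⟩, ?_, ?_⟩⟩
      · rw [PMF.map_comp, ← PMF.bind_pure_comp, ← PMF.bind_pure_comp]
        refine PMF.bind_congr_of_support _ fun o ho => ?_
        obtain ⟨Y, -, hY⟩ := h2' o ho
        simp only [Function.comp_apply]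
        rw [hY, hinv]
      · intro Y hY
        rw [PMF.mem_support_map_iff] at hY
        obtain ⟨o, ho, rfl⟩ := hY
        obtain ⟨Y, hY1, hY2⟩ := h2' o ho
        rw [hY2, hinv]
        exact hY1
      · rw [PMF.expect_map]
        refine h3.trans ?_
        rw [PMF.toOuterMeasure_eq_expect]
        refine PMF.expect_mono fun o ho => ?_
        by_cases hm : o ∈ {o : Data × ℕ | ∃ Y, o.1.IsCode Y ∧
            Φ.IsExtension α q.1 q.2.1.toFinset q.2.2 Y}
        · obtain ⟨Y, ⟨l, -, rfl, hc⟩, hY2⟩ := hm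
          have : Function.invFun enc o.1 = l := by rw [hc]; exact hinv l
          rw [this, Set.indicator_of_mem (show l ∈ {Y : List (List Bool) |
            Φ.IsExtension α q.1 q.2.1.toFinset q.2.2 Y.toFinset} from hY2)]
          exact Set.indicator_le_self' (by simp) o
        · rw [Set.indicator_of_notMem hm]
          exact zero_le
    · exact ⟨PMF.pure [], fun h => absurd h hq⟩
  choose f hf using h'
  exact ⟨f, P, ε, hε, ⟨p, fun q hq => (hf q hq).1⟩, fun q hq => (hf q hq).2⟩

end ImplicitSetSystem

section
variable {A B C : Type} [Enc A] [Enc B] [Enc C]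

theorem DetComp.projFst {D : A → Prop} {f : A → B × C} {T : A → ℝ} (hf : DetComp D f T) :
    DetComp D (fun a => (f a).1) fun a => T a + 2 :=
  ((DetComp.fst fun _ => True).comp hf fun _ _ => trivial).timeMono fun a _ => by linarith

theorem DetComp.projSnd {D : A → Prop} {f : A → B × C} {T : A → ℝ} (hf : DetComp D f T) :
    DetComp D (fun a => (f a).2) fun a => T a + 2 :=
  ((DetComp.snd fun _ => True).comp hf fun _ _ => trivial).timeMono fun a _ => by linarith

end

theorem Polynomial.cast_eval_mono (P : Polynomial ℕ) {a b : ℕ} (h : a ≤ b) :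
    ((P.eval a : ℕ) : ℝ) ≤ (P.eval b : ℕ) := by exact_mod_cast P.eval_mono_nat h

/-! ### One trial: sample, extend, keep the better solution -/

namespace ImplicitSetSystem
variable {Φ : ImplicitSetSystem}

open Classical in
/-- The shorter one of a candidate and a solution, if the candidate is a solution. -/
noncomputable def pickBest (Φ : ImplicitSetSystem)
    (q : List Bool × List (List Bool) × List (List Bool)) : List (List Bool) :=
  if q.2.1.toFinset ∈ Φ.F q.1 then if q.2.1.length - q.2.2.length ≠ 0 then q.2.2 else q.2.1
  else q.2.2

theorem PolyTimeComputable.comp_pickBest (h : Φ.PolyTimeComputable) :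
    ∃ P : Polynomial ℕ, DetComp (fun q => Φ.ListsSubset q.1 q.2.1) Φ.pickBest
      fun q => (P.eval (esize q) : ℕ) := by
  classical
  obtain ⟨f, P, hf, hf'⟩ := h.exists_test
  have hc : PolyTime fun q : List Bool × List (List Bool) × List (List Bool) =>
      if q.2.1.length - q.2.2.length ≠ 0 then q.2.2 else q.2.1 := by
    have h1 : PolyTime fun q : List Bool × List (List Bool) × List (List Bool) => q.2.1 :=
      PolyTime.fst.comp .snd
    have h2 : PolyTime fun q : List Bool × List (List Bool) × List (List Bool) => q.2.2 :=
      PolyTime.snd.comp .snd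
    exact .iteNat ((polyTime_length.comp h1).sub (polyTime_length.comp h2)) h2 h1
  obtain ⟨Pc, hc, -⟩ := hc
  have hid := DetComp.id fun q : List Bool × List (List Bool) × List (List Bool) =>
    Φ.ListsSubset q.1 q.2.1
  have ht := hf.comp (hid.projFst.pair hid.projSnd.projFst) fun q hq => hq
  have hmain := Comp.ite (P := fun q : List Bool × List (List Bool) × List (List Bool) =>
    q.2.1.toFinset ∈ Φ.F q.1) ht (fun q hq => hf' _ hq)
    (hc.mono (fun _ _ => trivial) fun _ _ => le_rfl)
    (hid.projSnd.projSnd.mono (fun _ h => h.1) fun _ _ => le_rfl)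
  refine ⟨P + Pc + 30, (hmain.congr fun q _ => ?_).mono (fun _ h => h) fun q _ => ?_⟩
  · unfold pickBest
    dsimp only
    split_ifs <;> rfl
  · simp only [Polynomial.eval_add, Polynomial.eval_ofNat]
    push_cast
    have h1 := P.cast_eval_mono (show esize (q.1, q.2.1) ≤ esize q by
      rw [show esize q = esize q.1 + (esize q.2.1 + esize q.2.2 + 1) + 1 from rfl, esize_pair]
      omega)
    have h2 : (0 : ℝ) ≤ (Pc.eval (esize q) : ℕ) := Nat.cast_nonneg _
    split_ifs <;> linarith

/-- One trial: extend a random sample, and keep the result if it is better than the best solution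
so far. The input consists of the instance, its universe, the number of bits of the bias, the
parameter of the extension algorithm and the best solution so far. -/
noncomputable def trial (Φ : ImplicitSetSystem)
    (ext : List Bool × List (List Bool) × ℕ → PMF (List (List Bool)))
    (a : (List Bool × List (List Bool) × ℕ × ℕ) × List (List Bool)) : PMF (List (List Bool)) :=
  (randomSample a.1.2.2.1 a.1.2.1).bind fun X => (ext (a.1.1, X, a.1.2.2.2)).map fun Y =>
    Φ.pickBest (a.1.1, unionList (X, Y), a.2)

/-- `U` lists the universe, and `best` a subset of it. -/
def TrialInput (Φ : ImplicitSetSystem)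
    (a : (List Bool × List (List Bool) × ℕ × ℕ) × List (List Bool)) : Prop :=
  a.1.2.1.Nodup ∧ a.1.2.1.toFinset = Φ.U a.1.1 ∧ Φ.ListsSubset a.1.1 a.2

theorem ListsSubset.esize_le {I : List Bool} {U X : List (List Bool)} (hX : Φ.ListsSubset I X)
    (hU : U.toFinset = Φ.U I) : esize X ≤ esize U := by
  refine esize_le_of_subset hX.1 fun x hx => ?_
  rw [← List.mem_toFinset, hU]
  exact hX.2 (List.mem_toFinset.2 hx)

theorem listsSubset_of_sublist {I : List Bool} {U X : List (List Bool)} (hU : U.Nodup)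
    (hU' : U.toFinset = Φ.U I) (h : X.reverse.Sublist U) : Φ.ListsSubset I X := by
  refine ⟨List.nodup_reverse.1 (h.nodup hU), fun x hx => ?_⟩
  rw [← hU', List.mem_toFinset]
  exact h.subset (List.mem_reverse.2 (List.mem_toFinset.1 hx))

theorem ListsSubset.union {I : List Bool} {X Y : List (List Bool)} (hX : Φ.ListsSubset I X)
    (hY : Φ.ListsSubset I Y) : Φ.ListsSubset I (unionList (X, Y)) := by
  obtain ⟨h1, h2⟩ := unionList_spec X Y hY.1
  refine ⟨h1, ?_⟩
  rw [h2]
  exact Finset.union_subset hY.2 hX.2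

/-- All lists that occur are duplicate-free and contained in the universe, so their codes are no
larger than that of U. The time therefore depends on the fixed part `a.1` of the input, not on the
current best solution. -/
theorem exists_comp_trial {c : ℝ} (hc : 1 ≤ c) (h : Φ.PolyTimeComputable)
    {ext : List Bool × List (List Bool) × ℕ → PMF (List (List Bool))} {P : Polynomial ℕ}
    (hext : Comp (fun q => Φ.ListsSubset q.1 q.2.1) ext
      fun q => (P.eval (esize q) : ℕ) * c ^ q.2.2)
    (hext' : ∀ q, Φ.ListsSubset q.1 q.2.1 → ∀ Y ∈ (ext q).support, Φ.ListsSubset q.1 Y) :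
    ∃ Q : Polynomial ℕ, Comp Φ.TrialInput (Φ.trial ext)
      fun a => (Q.eval (esize a.1) : ℕ) * c ^ a.1.2.2.2 := by
  obtain ⟨Pp, hp⟩ := h.comp_pickBest
  obtain ⟨Pu, hu, -⟩ := polyTime_unionList
  let Γ := (List Bool × List (List Bool) × ℕ × ℕ) × List (List Bool)
  have hidA := DetComp.id Φ.TrialInput
  have hA := (comp_randomSample (A := List Bool)).comp
    (hidA.projFst.projSnd.projSnd.projFst.pair hidA.projFst.projSnd.projFst) fun _ _ => trivial
  let DB : List (List Bool) × Γ → Prop := fun b =>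
    Φ.TrialInput b.2 ∧ Φ.ListsSubset b.2.1.1 b.1
  have hidB := DetComp.id DB
  have hB := hext.comp (hidB.projSnd.projFst.projFst.pair (hidB.projFst.pair
    hidB.projSnd.projFst.projSnd.projSnd.projSnd)) fun b hb => hb.2
  let DC : List (List Bool) × List (List Bool) × Γ → Prop := fun b =>
    DB b.2 ∧ Φ.ListsSubset b.2.2.1.1 b.1
  have hidC := DetComp.id DC
  have hC := hp.comp (hidC.projSnd.projSnd.projFst.projFst.pair
    ((hu.comp (hidC.projSnd.projFst.pair hidC.projFst) fun _ _ => trivial).pair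
      hidC.projSnd.projSnd.projSnd)) fun b hb => hb.1.2.union hb.2
  have hBC := hB.mapWith hC
    (T'' := fun b => ((Pu.comp (2 * .X + 1) + Pp.comp (3 * .X + 2) + 100).eval (esize b.2.1) : ℕ))
    (by
      intro b hb Y hY
      have hY' := hext' _ hb.2 Y hY
      refine ⟨⟨hb, hY'⟩, ?_⟩
      obtain ⟨⟨hU1, hU2, hbest⟩, hX⟩ := hb
      have e : esize b.2.1 = esize b.2.1.1 + (esize b.2.1.2.1 + (esize b.2.1.2.2.1 +
        esize b.2.1.2.2.2 + 1) + 1) + 1 := rfl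
      have h1 := hX.esize_le hU2
      have h2 := hY'.esize_le hU2
      have h3 := (hX.union hY').esize_le hU2
      have h4 := hbest.esize_le hU2
      have g1 := Pu.cast_eval_mono (show esize (b.1, Y) ≤ 2 * esize b.2.1 + 1 by
        rw [esize_pair]; omega)
      have g2 := Pp.cast_eval_mono (show esize (b.2.1.1, unionList (b.1, Y), b.2.2) ≤
        3 * esize b.2.1 + 2 by rw [esize_pair, esize_pair]; omega)
      simp only [Polynomial.eval_add, Polynomial.eval_comp, Polynomial.eval_mul,
        Polynomial.eval_ofNat, Polynomial.eval_X, Polynomial.eval_one]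
      push_cast at g1 g2 ⊢
      linarith)
  have hABC := hA.bindWith hBC
    (T'' := fun a => ((P.eval (esize a.1) : ℕ) : ℝ) * c ^ a.1.2.2.2 +
      ((Pu.comp (2 * .X + 1) + Pp.comp (3 * .X + 2) + 200).eval (esize a.1) : ℕ)) (by
      intro a ha X hX
      have hX' := listsSubset_of_sublist ha.1 ha.2.1 (randomSample_support hX)
      refine ⟨⟨ha, hX'⟩, ?_⟩
      have e : esize a.1 = esize a.1.1 + (esize a.1.2.1 + (esize a.1.2.2.1 +
        esize a.1.2.2.2 + 1) + 1) + 1 := rfl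
      have h1 := hX'.esize_le ha.2.1
      have g1 := P.cast_eval_mono (show esize (a.1.1, X, a.1.2.2.2) ≤ esize a.1 by
        rw [esize_pair, esize_pair]; omega)
      have g2 : ((P.eval (esize (a.1.1, X, a.1.2.2.2)) : ℕ) : ℝ) * c ^ a.1.2.2.2 ≤
        ((P.eval (esize a.1) : ℕ) : ℝ) * c ^ a.1.2.2.2 := by gcongr
      simp only [Polynomial.eval_add, Polynomial.eval_ofNat, Nat.cast_add, Nat.cast_ofNat]
      linarith)
  refine ⟨1000 * .X ^ 2 + P + Pu.comp (2 * .X + 1) + Pp.comp (3 * .X + 2) + 300,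
    hABC.mono (fun _ h => h) fun a ha => ?_⟩
  have hck : 1 ≤ c ^ a.1.2.2.2 := one_le_pow₀ hc
  have e : esize a.1 = esize a.1.1 + (esize a.1.2.1 + (esize a.1.2.2.1 +
    esize a.1.2.2.2 + 1) + 1) + 1 := rfl
  have h1 : (1000 : ℝ) * (a.1.2.2.1 + 1) * (a.1.2.1.length + 1) ≤ 1000 * (esize a.1) ^ 2 := by
    have g1 : ((a.1.2.2.1 + 1 : ℕ) : ℝ) ≤ esize a.1 := by
      have := esize_nat a.1.2.2.1
      exact_mod_cast (by omega)
    have g2 : ((a.1.2.1.length + 1 : ℕ) : ℝ) ≤ esize a.1 := by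
      have := length_le_esize a.1.2.1
      exact_mod_cast (by omega)
    push_cast at g1 g2
    have : ((a.1.2.2.1 : ℝ) + 1) * (a.1.2.1.length + 1) ≤ esize a.1 * esize a.1 := by gcongr
    nlinarith
  simp only [Polynomial.eval_add, Polynomial.eval_mul, Polynomial.eval_pow, Polynomial.eval_X,
    Polynomial.eval_ofNat, Nat.cast_add, Nat.cast_mul, Nat.cast_pow, Nat.cast_ofNat]
  set s : ℝ := (esize a.1 : ℝ)
  set v1 : ℝ := (((Pu.comp (2 * .X + 1)).eval (esize a.1) : ℕ) : ℝ)
  set v2 : ℝ := (((Pp.comp (3 * .X + 2)).eval (esize a.1) : ℕ) : ℝ)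
  set v3 : ℝ := ((P.eval (esize a.1) : ℕ) : ℝ)
  have p1 : 0 ≤ v1 := Nat.cast_nonneg _
  have p2 : 0 ≤ v2 := Nat.cast_nonneg _
  have hnn : 0 ≤ 1000 * s ^ 2 + v1 + v2 + 300 := by positivity
  have := mul_le_mul_of_nonneg_left hck hnn
  nlinarith

end ImplicitSetSystem

/-! ### Probability amplification -/

theorem PMF.expect_add {α : Type*} (p : PMF α) (φ ψ : α → ℝ≥0∞) :
    p.expect (fun a => φ a + ψ a) = p.expect φ + p.expect ψ := by
  unfold PMF.expect
  simp only [mul_add, ENNReal.tsum_add]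

theorem PMF.expect_indicator_of_support {α : Type*} {p : PMF α} {G : Set α}
    (h : ∀ a ∈ p.support, a ∈ G) : p.expect (G.indicator fun _ => 1) = 1 := by
  refine le_antisymm ?_ ?_
  · refine (PMF.expect_mono fun a _ => Set.indicator_le_self G _ a).trans_eq (p.expect_const 1)
  · rw [← p.expect_const 1]
    exact PMF.expect_mono fun a ha => by rw [Set.indicator_of_mem (h a ha), p.expect_const]

section
variable {σ β : Type} {step : σ → β → PMF σ} {G : Set σ}

/-- G is never left, and each step enters it with probability at least p whatever happened before.
Hence all steps fail with probability at most (1 - p) to their number. -/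
theorem foldPMF_amplify {Inv : σ → Prop} {p : ℝ} (hp0 : 0 ≤ p) (hp1 : p ≤ 1)
    (hInv : ∀ s b, Inv s → ∀ s' ∈ (step s b).support, Inv s' ∧ (s ∈ G → s' ∈ G))
    (hhit : ∀ s b, Inv s → ENNReal.ofReal p ≤ (step s b).expect (G.indicator fun _ => 1)) :
    ∀ l s, Inv s → ENNReal.ofReal (1 - (1 - p) ^ l.length) ≤
      (foldPMF step l s).expect (G.indicator fun _ => 1) := by
  intro l
  induction l with
  | nil => intro s _; simp
  | cons b l ih =>
    intro s hs
    rw [foldPMF, PMF.expect_bind, List.length_cons]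
    set y := 1 - (1 - p) ^ l.length with hy
    have hy1 : 0 ≤ 1 - y := by
      rw [hy, sub_sub_cancel]
      exact pow_nonneg (by linarith) _
    have hy0 : 0 ≤ y := by
      rw [hy, sub_nonneg]
      exact pow_le_one₀ (by linarith) (by linarith)
    calc ENNReal.ofReal (1 - (1 - p) ^ (l.length + 1))
        = ENNReal.ofReal p * ENNReal.ofReal (1 - y) + ENNReal.ofReal y := by
          rw [← ENNReal.ofReal_mul hp0, ← ENNReal.ofReal_add (mul_nonneg hp0 hy1) hy0, hy]
          congr 1
          ring
      _ ≤ (step s b).expect (G.indicator fun _ => 1) * ENNReal.ofReal (1 - y) +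
          (step s b).expect fun _ => ENNReal.ofReal y := by
          rw [PMF.expect_const]
          gcongr
          exact hhit s b hs
      _ = (step s b).expect fun s' =>
          G.indicator (fun _ => 1) s' * ENNReal.ofReal (1 - y) + ENNReal.ofReal y := by
          rw [← PMF.expect_mul_const, PMF.expect_add]
      _ ≤ _ := PMF.expect_mono fun s' hs' => by
          by_cases hG : s' ∈ G
          · rw [Set.indicator_of_mem hG, one_mul, ← ENNReal.ofReal_add hy1 hy0, sub_add_cancel,
              ENNReal.ofReal_one, PMF.expect_indicator_of_support]
            intro t ht
            exact (foldPMF_support_length (P := fun _ s => Inv s ∧ s ∈ G)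
              (fun b _ s h t ht => ⟨(hInv s b h.1 t ht).1, (hInv s b h.1 t ht).2 h.2⟩) l s'
              ⟨(hInv s b hs s' hs').1, hG⟩ t ht).2
          · rw [Set.indicator_of_notMem hG, zero_mul, zero_add]
            exact ih s' (hInv s b hs s' hs').1

/-- A lower bound for step j alone carries over to the whole fold: earlier steps keep the indexed
invariant, later ones do not leave G. -/
theorem foldPMF_hit {Inv : ℕ → σ → Prop} {r : ℝ≥0∞} {j : ℕ}
    (hInv : ∀ i s b, Inv i s → ∀ s' ∈ (step s b).support, Inv (i + 1) s' ∧ (s ∈ G → s' ∈ G))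
    (hhit : ∀ s b, Inv j s → r ≤ (step s b).expect (G.indicator fun _ => 1)) :
    ∀ (l : List β) i s, Inv i s → i ≤ j → j < i + l.length →
      r ≤ (foldPMF step l s).expect (G.indicator fun _ => 1) := by
  intro l
  induction l with
  | nil =>
    intro i s _ h1 h2
    rw [List.length_nil] at h2
    omega
  | cons b l ih =>
    intro i s hs h1 h2
    rw [foldPMF, PMF.expect_bind]
    rcases h1.eq_or_lt with rfl | h1
    · refine (hhit s b hs).trans (PMF.expect_mono fun s' hs' => ?_)
      by_cases hG : s' ∈ G
      · rw [Set.indicator_of_mem hG, PMF.expect_indicator_of_support]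
        intro t ht
        exact (foldPMF_support_length (P := fun _ s => (∃ i, Inv i s) ∧ s ∈ G)
          (fun b _ s ⟨⟨i, hi⟩, h⟩ t ht => ⟨⟨_, (hInv i s b hi t ht).1⟩, (hInv i s b hi t ht).2 h⟩)
          l s' ⟨⟨_, (hInv i s b hs s' hs').1⟩, hG⟩ t ht).2
      · rw [Set.indicator_of_notMem hG]
        exact zero_le
    · rw [← (step s b).expect_const r]
      refine PMF.expect_mono fun s' hs' => ?_
      exact ih (i + 1) s' (hInv i s b hs s' hs').1 h1 (by rw [List.length_cons] at h2; omega)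

end

/-! ### The success probability of a trial -/

namespace ImplicitSetSystem
variable {Φ : ImplicitSetSystem}

/-- `best` lists the elements of a solution. -/
def ListsSolution (Φ : ImplicitSetSystem) (I : List Bool) (best : List (List Bool)) : Prop :=
  best.Nodup ∧ best.toFinset ∈ Φ.F I

theorem ListsSolution.listsSubset {I : List Bool} {best : List (List Bool)}
    (h : Φ.ListsSolution I best) : Φ.ListsSubset I best :=
  ⟨h.1, Φ.subset_U I _ h.2⟩

theorem pickBest_spec {I : List Bool} {Z best : List (List Bool)} (hZ : Z.Nodup)
    (hb : Φ.ListsSolution I best) :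
    Φ.ListsSolution I (Φ.pickBest (I, Z, best)) ∧
      (Φ.pickBest (I, Z, best)).length ≤ best.length ∧
      (Z.toFinset ∈ Φ.F I → (Φ.pickBest (I, Z, best)).length ≤ Z.length) := by
  unfold pickBest
  dsimp only
  split_ifs with h1 h2
  · exact ⟨hb, le_rfl, fun _ => by omega⟩
  · exact ⟨⟨hZ, h1⟩, by omega, fun _ => le_rfl⟩
  · exact ⟨hb, le_rfl, fun h => absurd h h1⟩

variable {ext : List Bool × List (List Bool) × ℕ → PMF (List (List Bool))}

theorem trial_support
    (hext : ∀ q, Φ.ListsSubset q.1 q.2.1 → ∀ Y ∈ (ext q).support, Φ.ListsSubset q.1 Y)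
    {I : List Bool} {U best : List (List Bool)} {m j : ℕ} (hU : U.Nodup)
    (hU' : U.toFinset = Φ.U I) (hb : Φ.ListsSolution I best) :
    ∀ Z ∈ (Φ.trial ext ((I, U, m, j), best)).support,
      Φ.ListsSolution I Z ∧ Z.length ≤ best.length := by
  intro Z hZ
  simp only [trial, PMF.mem_support_bind_iff, PMF.mem_support_map_iff] at hZ
  obtain ⟨X, hX, Y, hY, rfl⟩ := hZ
  have hX' := listsSubset_of_sublist hU hU' (randomSample_support hX)
  have h := pickBest_spec (hX'.union (hext _ hX' Y hY)).1 hb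
  exact ⟨h.1, h.2.1⟩

/-- The set S = O \ X has k - i elements, and S ∪ X = O ∪ X is a solution by monotonicity, so the
premise of the extension problem holds. A good answer Y then gives |X ∪ Y| ≤ t + α (k - i) ≤ α k.
The two successes multiply because the extension algorithm succeeds with probability ε for every
fixed X. -/
theorem trial_hit (hmono : Φ.Monotone) {α : ℝ} {ε : ℝ≥0∞}
    (hext : ∀ q, Φ.ListsSubset q.1 q.2.1 → (∀ Y ∈ (ext q).support, Φ.ListsSubset q.1 Y) ∧
      ε ≤ (ext q).expect
        ({Y | Φ.IsExtension α q.1 q.2.1.toFinset q.2.2 Y.toFinset}.indicator fun _ => 1))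
    {I : List Bool} {U best : List (List Bool)} {m i t : ℕ} (hU : U.Nodup)
    (hU' : U.toFinset = Φ.U I) (hb : Φ.ListsSolution I best)
    {O : Finset (List Bool)} (hO : O ∈ Φ.F I) (hiO : i ≤ O.card) (hit : i ≤ t)
    (ht : t ≤ U.length) (hα : (t : ℝ) ≤ α * i) (hm : 2 * (U.length + 1) ^ 2 ≤ 2 ^ m) :
    ENNReal.ofReal (O.card.choose i * (U.length - O.card).choose (t - i) /
      (2 * (U.length + 1) * U.length.choose t)) * ε ≤
      (Φ.trial ext ((I, U, m, O.card - i), best)).expect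
        ({Z | (Z.length : ℝ) ≤ α * O.card}.indicator fun _ => 1) := by
  have hOU : O ⊆ U.toFinset := hU' ▸ Φ.subset_U I O hO
  rw [trial, PMF.expect_bind]
  calc _ ≤ (randomSample m U).expect
        ({X | X.toFinset.card = t ∧ (X.toFinset ∩ O).card = i}.indicator fun _ => 1) * ε := by
        gcongr
        exact randomSample_lower hU hOU hit ht hm
    _ = (randomSample m U).expect fun X =>
        {X | X.toFinset.card = t ∧ (X.toFinset ∩ O).card = i}.indicator (fun _ => 1) X * ε := by
        rw [PMF.expect_mul_const]
    _ ≤ _ := PMF.expect_mono fun X hX => ?_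
  by_cases hXt : X ∈ {X : List (List Bool) | X.toFinset.card = t ∧ (X.toFinset ∩ O).card = i}
  swap
  · rw [Set.indicator_of_notMem hXt, zero_mul]
    exact zero_le
  rw [Set.indicator_of_mem hXt, one_mul]
  obtain ⟨hX1, hX2⟩ := hXt
  have hX' := listsSubset_of_sublist hU hU' (randomSample_support hX)
  obtain ⟨h1, h2⟩ := hext (I, X, O.card - i) hX'
  refine h2.trans ?_
  rw [PMF.expect_map]
  refine PMF.expect_mono fun Y hY => ?_
  by_cases hYe : Y ∈ {Y : List (List Bool) |
    Φ.IsExtension α I X.toFinset (O.card - i) Y.toFinset}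
  swap
  · rw [Set.indicator_of_notMem hYe]
    exact zero_le
  rw [Set.indicator_of_mem hYe]
  have hY' := h1 Y hY
  obtain ⟨hF, hcard⟩ := hYe ⟨O \ X.toFinset, Finset.sdiff_subset.trans (hU' ▸ hOU), by
    rw [Finset.sdiff_union_self_eq_union]
    exact (hmono I).2 O _ Finset.subset_union_left
      (Finset.union_subset (hU' ▸ hOU) hX'.2) hO, by
    rw [Finset.card_sdiff, hX2]⟩
  obtain ⟨hun, hus⟩ := unionList_spec X Y hY'.1
  have hlen := (pickBest_spec hun hb).2.2 (by rw [hus]; exact hF)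
  have hle : (unionList (X, Y)).length ≤ Y.toFinset.card + t := by
    rw [← List.toFinset_card_of_nodup hun, hus, ← hX1]
    exact Finset.card_union_le _ _
  rw [Set.indicator_of_mem]
  have h3 : ((Φ.pickBest (I, unionList (X, Y), best)).length : ℝ) ≤ Y.toFinset.card + t := by
    exact_mod_cast hlen.trans hle
  rw [Nat.cast_sub hiO] at hcard
  change ((Φ.pickBest (I, unionList (X, Y), best)).length : ℝ) ≤ α * O.card
  linarith

end ImplicitSetSystem

/-! ### The algorithm -/

/-- The number of trials is inversely proportional to the weight, which grows by a factor of about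
`e / m` until it exceeds `V`. -/
def nextWeight (V e m w : ℕ) : ℕ := if V / w ≠ 0 then w * e / m + 1 else w

/-- The weight for the parameter `j`. -/
def weight (V e m j : ℕ) : ℕ := (nextWeight V e m)^[j] 1

theorem weight_succ (V e m j : ℕ) : weight V e m (j + 1) = nextWeight V e m (weight V e m j) :=
  Function.iterate_succ_apply' _ _ _

theorem detComp_nextWeight : DetComp (fun _ => True)
    (fun q : (ℕ × ℕ × ℕ) × ℕ => nextWeight q.1.1 q.1.2.1 q.1.2.2 q.2)
    fun q => 200 * (q.1.1 + 1) + 1200 * (q.2 + 1) * (q.1.2.1 + 1) + 100 := by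
  have hid := DetComp.id fun _ : (ℕ × ℕ × ℕ) × ℕ => True
  have h1 := detComp_div.comp (hid.projFst.projFst.pair hid.projSnd) fun _ _ => trivial
  have h2 := (DetComp.succ fun _ => True).comp (detComp_div.comp ((detComp_mul.comp
    (hid.projSnd.pair hid.projFst.projSnd.projFst) fun _ _ => trivial).pair
    hid.projFst.projSnd.projSnd) fun _ _ => trivial) fun _ _ => trivial
  have h := Comp.ite (P := fun q : (ℕ × ℕ × ℕ) × ℕ => q.1.1 / q.2 ≠ 0) h1
    (fun q _ => enc_nat_ne_nil _) (h2.mono (fun _ _ => trivial) fun _ _ => le_rfl)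
    (hid.projSnd.mono (fun _ _ => trivial) fun _ _ => le_rfl)
  refine (h.congr fun q _ => ?_).mono (fun _ h => h) fun q _ => ?_
  · unfold nextWeight
    dsimp only
    split_ifs <;> rfl
  · have p1 := (Nat.cast_nonneg q.2 : (0 : ℝ) ≤ q.2)
    have p2 := (Nat.cast_nonneg q.1.2.1 : (0 : ℝ) ≤ q.1.2.1)
    have p3 := mul_nonneg p1 p2
    dsimp only
    push_cast
    split_ifs <;> nlinarith

/-- One step of the computation of the number of trials. -/
def growStep (g h v : ℕ) : ℕ := v * g / h + 1

theorem le_growStep {g h : ℕ} (hh : 0 < h) (hgh : h ≤ g) (v : ℕ) : v ≤ growStep g h v := by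
  unfold growStep
  have : v ≤ v * g / h := by
    rw [Nat.le_div_iff_mul_le hh]
    exact Nat.mul_le_mul_left _ hgh
  omega

theorem le_growStep_iterate {g h : ℕ} (hh : 0 < h) (hgh : h ≤ g) (v n : ℕ) :
    v ≤ (growStep g h)^[n] v := by
  induction n generalizing v with
  | zero => exact le_rfl
  | succ n ih => exact (le_growStep hh hgh v).trans (ih _)

theorem foldl_const_eq_iterate {σ β : Type} (f : σ → σ) (l : List β) (s : σ) :
    l.foldl (fun s _ => f s) s = f^[l.length] s := by
  induction l generalizing s with
  | nil => rfl
  | cons b l ih => rw [List.foldl_cons, ih]; rfl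

/-- The iterates increase, so each step costs no more than the final value times g. The total is
linear in that value, which is of order γ^n. -/
theorem detComp_growStep_iterate {B : Type} [Enc B] :
    DetComp (fun q : (List B × ℕ) × ℕ × ℕ => 0 < q.2.2 ∧ q.2.2 ≤ q.2.1)
      (fun q => (growStep q.2.1 q.2.2)^[q.1.1.length] q.1.2)
      fun q => q.1.1.length * (1200 * ((growStep q.2.1 q.2.2)^[q.1.1.length] q.1.2 + 1) *
        (q.2.1 + 1) + 100) + 40 := by
  let D := fun q : (List B × ℕ) × ℕ × ℕ => 0 < q.2.2 ∧ q.2.2 ≤ q.2.1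
  have hid := DetComp.id D
  have hid' := DetComp.id fun _ : ((List B × ℕ) × ℕ × ℕ) × ℕ × B => True
  have hs := (DetComp.succ fun _ => True).comp (detComp_div.comp ((detComp_mul.comp
    (hid'.projSnd.projFst.pair hid'.projFst.projSnd.projFst) fun _ _ => trivial).pair
    hid'.projFst.projSnd.projSnd) fun _ _ => trivial) fun _ _ => trivial
  have h := DetComp.foldl (fun q r v => (growStep q.2.1 q.2.2)^[r.length] v =
      (growStep q.2.1 q.2.2)^[q.1.1.length] q.1.2)
    (τ := fun q => 1200 * ((growStep q.2.1 q.2.2)^[q.1.1.length] q.1.2 + 1) *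
        (q.2.1 + 1) + 60)
    hid.projFst.projFst hid.projFst.projSnd hs (fun _ _ => rfl) (by
      intro q hq b r v hv
      refine ⟨trivial, ?_, by rw [← hv]; rfl⟩
      have h1 : (v : ℝ) ≤ ((growStep q.2.1 q.2.2)^[q.1.1.length] q.1.2 : ℕ) := by
        rw [← hv]
        exact_mod_cast le_growStep_iterate hq.1 hq.2 v _
      have p2 := (Nat.cast_nonneg q.2.1 : (0 : ℝ) ≤ q.2.1)
      have p3 := mul_le_mul_of_nonneg_right h1 p2
      dsimp only
      push_cast
      nlinarith)
  refine (h.funCongr fun q _ => ?_).timeMono fun q _ => ?_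
  · exact foldl_const_eq_iterate (growStep q.2.1 q.2.2) q.1.1 q.1.2
  · linarith

/-! ### Programs for a phase and for the whole search -/

namespace ImplicitSetSystem
variable {Φ : ImplicitSetSystem}

/-- All trials for one value of the parameter. The state consists of the parameter, its weight and
the best solution so far. -/
noncomputable def phase (Φ : ImplicitSetSystem)
    (ext : List Bool × List (List Bool) × ℕ → PMF (List (List Bool)))
    (q : ((List Bool × List (List Bool) × ℕ) × ℕ × ℕ) × (ℕ × ℕ × List (List Bool))) :
    PMF (ℕ × ℕ × List (List Bool)) :=
  (foldPMF (fun best _ => Φ.trial ext ((q.1.1.1, q.1.1.2.1, q.1.1.2.2, q.2.1), best))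
    (List.replicate (q.1.2.1 / q.2.2.1) (0 : ℕ)) q.2.2.2).map fun best =>
      (q.2.1 + 1, nextWeight q.1.2.1 q.1.2.2 q.1.1.2.2 q.2.2.1, best)

/-- The whole search, after some precomputation. -/
noncomputable def search (Φ : ImplicitSetSystem)
    (ext : List Bool × List (List Bool) × ℕ → PMF (List (List Bool)))
    (a : (List Bool × List (List Bool) × ℕ) × ℕ × ℕ) : PMF (List (List Bool)) :=
  (foldPMF (fun s _ => Φ.phase ext (a, s)) ([] :: a.1.2.1) (0, 1, a.1.2.1)).map fun s => s.2.2

variable {c : ℝ} {ext : List Bool × List (List Bool) × ℕ → PMF (List (List Bool))}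
  {Q : Polynomial ℕ}

theorem trial_support_listsSubset
    (hext : ∀ q, Φ.ListsSubset q.1 q.2.1 → ∀ Y ∈ (ext q).support, Φ.ListsSubset q.1 Y)
    {a : (List Bool × List (List Bool) × ℕ × ℕ) × List (List Bool)} (ha : Φ.TrialInput a) :
    ∀ Z ∈ (Φ.trial ext a).support, Φ.ListsSubset a.1.1 Z := by
  classical
  intro Z hZ
  simp only [trial, PMF.mem_support_bind_iff, PMF.mem_support_map_iff] at hZ
  obtain ⟨X, hX, Y, hY, rfl⟩ := hZ
  have hX' := listsSubset_of_sublist ha.1 ha.2.1 (randomSample_support hX)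
  have hun := hX'.union (hext _ hX' Y hY)
  unfold pickBest
  dsimp only
  split_ifs
  exacts [ha.2.2, hun, ha.2.2]

theorem phase_support {Inv : List (List Bool) → Prop}
    {a : (List Bool × List (List Bool) × ℕ) × ℕ × ℕ} {j w : ℕ} {best : List (List Bool)}
    (hInv : ∀ b, Inv b → ∀ b' ∈ (Φ.trial ext ((a.1.1, a.1.2.1, a.1.2.2, j), b)).support, Inv b')
    (hb : Inv best) : ∀ s ∈ (Φ.phase ext (a, j, w, best)).support,
      s.1 = j + 1 ∧ s.2.1 = nextWeight a.2.1 a.2.2 a.1.2.2 w ∧ Inv s.2.2 := by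
  intro s hs
  rw [phase, PMF.mem_support_map_iff] at hs
  obtain ⟨b, hbs, rfl⟩ := hs
  exact ⟨rfl, rfl, foldPMF_support_length (P := fun _ b => Inv b)
    (fun _ _ b hb b' hb' => hInv b hb b' hb') _ _ hb b hbs⟩

/-- A bound for the time of a phase. -/
noncomputable def phaseTime (c : ℝ) (Q : Polynomial ℕ)
    (q : ((List Bool × List (List Bool) × ℕ) × ℕ × ℕ) × ℕ × ℕ) : ℝ :=
  400 * (q.1.2.1 + 1) + 1200 * (q.2.2 + 1) * (q.1.2.2 + 1) +
    (q.1.2.1 / q.2.2 : ℕ) *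
      ((Q.eval (esize (q.1.1.1, q.1.1.2.1, q.1.1.2.2, q.2.1)) : ℕ) * c ^ q.2.1 + 100) + 300

theorem comp_phase
    (hext : ∀ q, Φ.ListsSubset q.1 q.2.1 → ∀ Y ∈ (ext q).support, Φ.ListsSubset q.1 Y)
    (hQ : Comp Φ.TrialInput (Φ.trial ext)
      fun a => (Q.eval (esize a.1) : ℕ) * c ^ a.1.2.2.2) :
    Comp (fun q => Φ.TrialInput ((q.1.1.1, q.1.1.2.1, q.1.1.2.2, q.2.1), q.2.2.2)) (Φ.phase ext)
      fun q => phaseTime c Q (q.1, q.2.1, q.2.2.1) := by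
  let Γ := ((List Bool × List (List Bool) × ℕ) × ℕ × ℕ) × (ℕ × ℕ × List (List Bool))
  let D : Γ → Prop := fun q => Φ.TrialInput ((q.1.1.1, q.1.1.2.1, q.1.1.2.2, q.2.1), q.2.2.2)
  have hid := DetComp.id D
  have hl := (DetComp.replicate fun _ => True).comp (detComp_div.comp
    (hid.projFst.projSnd.projFst.pair hid.projSnd.projSnd.projFst) fun _ _ => trivial)
    fun _ _ => trivial
  let D' : Γ × List (List Bool) × ℕ → Prop := fun p =>
    Φ.TrialInput ((p.1.1.1.1, p.1.1.1.2.1, p.1.1.1.2.2, p.1.2.1), p.2.1)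
  have hid' := DetComp.id D'
  have hs := hQ.comp (((hid'.projFst.projFst.projFst.projFst).pair
    ((hid'.projFst.projFst.projFst.projSnd.projFst).pair
      ((hid'.projFst.projFst.projFst.projSnd.projSnd).pair hid'.projFst.projSnd.projFst))).pair
    hid'.projSnd.projFst) fun _ h => h
  have hfold := Comp.fold (fun q _ b =>
      Φ.TrialInput ((q.1.1.1, q.1.1.2.1, q.1.1.2.2, q.2.1), b))
    (τ := fun q => ((Q.eval (esize (q.1.1.1, q.1.1.2.1, q.1.1.2.2, q.2.1)) : ℕ) : ℝ) *
      c ^ q.2.1 + 60)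
    hl hid.projSnd.projSnd.projSnd hs (fun q hq s hs => by
      simp only [PMF.support_pure, Set.mem_singleton_iff] at hs
      rw [hs]
      exact hq) (fun q hq b r best hb => by
      refine ⟨hb, ?_, fun Z hZ => ⟨hb.1, hb.2.1, trial_support_listsSubset hext hb Z hZ⟩⟩
      dsimp only
      linarith)
  have hid₃ := DetComp.id fun _ : List (List Bool) × Γ => True
  have hw := detComp_nextWeight.comp
    (((hid₃.projSnd.projFst.projSnd.projFst).pair ((hid₃.projSnd.projFst.projSnd.projSnd).pair
      hid₃.projSnd.projFst.projFst.projSnd.projSnd)).pair hid₃.projSnd.projSnd.projSnd.projFst)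
    fun _ _ => trivial
  have hend := ((DetComp.succ fun _ => True).comp hid₃.projSnd.projSnd.projFst
    fun _ _ => trivial).pair (hw.pair hid₃.projFst)
  have h := hfold.mapWith hend (T'' := fun q => 200 * ((q.1.2.1 : ℝ) + 1) +
    1200 * (q.2.2.1 + 1) * (q.1.2.2 + 1) + 200) (fun q _ b _ => ⟨trivial, by
      dsimp only
      linarith⟩)
  refine (h.congr fun q _ => ?_).mono (fun _ h => h) fun q _ => ?_
  · rw [PMF.pure_bind]
    rfl
  · unfold phaseTime
    rw [List.length_replicate]
    dsimp only
    linarith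

theorem comp_search {D : (List Bool × List (List Bool) × ℕ) × ℕ × ℕ → Prop}
    {τ : (List Bool × List (List Bool) × ℕ) × ℕ × ℕ → ℝ}
    (hext : ∀ q, Φ.ListsSubset q.1 q.2.1 → ∀ Y ∈ (ext q).support, Φ.ListsSubset q.1 Y)
    (hQ : Comp Φ.TrialInput (Φ.trial ext)
      fun a => (Q.eval (esize a.1) : ℕ) * c ^ a.1.2.2.2)
    (hD : ∀ a, D a → a.1.2.1.Nodup ∧ a.1.2.1.toFinset = Φ.U a.1.1)
    (hτ : ∀ a, D a → ∀ j ≤ a.1.2.1.length,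
      phaseTime c Q (a, j, weight a.2.1 a.2.2 a.1.2.2 j) ≤ τ a) :
    Comp D (Φ.search ext) fun a => (a.1.2.1.length + 1) * (τ a + 50) + 100 := by
  have hid := DetComp.id D
  have h0 : DetComp D (fun _ => (0 : ℕ)) fun _ => 1 := DetComp.zero D
  -- The list `[] :: U` acts only as a counter for the n + 1 phases j = 0, …, n.
  have hl := (DetComp.listCons fun _ => True).comp ((DetComp.emptyList (B := Bool) D).pair
    hid.projFst.projSnd.projFst) fun _ _ => trivial
  have hi := h0.pair (((DetComp.succ fun _ => True).comp h0 fun _ _ => trivial).pair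
    hid.projFst.projSnd.projFst)
  let D' : (((List Bool × List (List Bool) × ℕ) × ℕ × ℕ) × (ℕ × ℕ × List (List Bool)) ×
    List Bool) → Prop := fun p =>
    Φ.TrialInput ((p.1.1.1, p.1.1.2.1, p.1.1.2.2, p.2.1.1), p.2.1.2.2)
  have hid' := DetComp.id D'
  have hs := (comp_phase hext hQ).comp (hid'.projFst.pair hid'.projSnd.projFst) fun _ h => h
  have hfold := Comp.fold (fun a r s => s.1 + r.length = a.1.2.1.length + 1 ∧
      s.2.1 = weight a.2.1 a.2.2 a.1.2.2 s.1 ∧ Φ.ListsSubset a.1.1 s.2.2)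
    (τ := fun a => τ a + 10) hl hi hs (fun a ha s hs => by
      simp only [PMF.support_pure, Set.mem_singleton_iff] at hs
      rw [hs]
      exact ⟨by simp, rfl, (hD a ha).1, (hD a ha).2.subset⟩) (fun a ha b r s hs => by
      obtain ⟨h1, h2, h3⟩ := hs
      rw [List.length_cons] at h1
      have hin : Φ.TrialInput ((a.1.1, a.1.2.1, a.1.2.2, s.1), s.2.2) :=
        ⟨(hD a ha).1, (hD a ha).2, h3⟩
      refine ⟨hin, ?_, ?_⟩
      · have := hτ a ha s.1 (by omega)
        rw [← h2] at this
        dsimp only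
        linarith
      · intro s' hs'
        obtain ⟨g1, g2, g3⟩ := phase_support (Inv := fun b => Φ.ListsSubset a.1.1 b)
          (fun b hb b' hb' => trial_support_listsSubset hext
            (a := ((a.1.1, a.1.2.1, a.1.2.2, s.1), b)) ⟨(hD a ha).1, (hD a ha).2, hb⟩ b' hb')
          h3 s' hs'
        exact ⟨by omega, by rw [g2, g1, weight_succ, h2], g3⟩)
  have h := hfold.bind (DetComp.snd (A := ℕ) (B := ℕ × List (List Bool)) fun _ => True)
    (T'' := fun _ => 1) (fun _ _ _ _ => ⟨trivial, le_rfl⟩)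
  have h := h.bind (DetComp.snd (A := ℕ) (B := List (List Bool)) fun _ => True)
    (T'' := fun _ => 1) (fun _ _ _ _ => ⟨trivial, le_rfl⟩)
  refine (h.congr fun q _ => ?_).mono (fun _ h => h) fun q _ => ?_
  · rw [PMF.pure_bind, PMF.bind_bind, search, ← PMF.bind_pure_comp]
    simp only [PMF.pure_bind]
    rfl
  · rw [List.length_cons]
    push_cast
    linarith

end ImplicitSetSystem

/-! ### Correctness of the search -/

namespace ImplicitSetSystem
variable {Φ : ImplicitSetSystem}
  {ext : List Bool × List (List Bool) × ℕ → PMF (List (List Bool))}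

theorem search_support
    (hext : ∀ q, Φ.ListsSubset q.1 q.2.1 → ∀ Y ∈ (ext q).support, Φ.ListsSubset q.1 Y)
    (hmono : Φ.Monotone) {a : (List Bool × List (List Bool) × ℕ) × ℕ × ℕ}
    (hU : a.1.2.1.Nodup) (hU' : a.1.2.1.toFinset = Φ.U a.1.1) :
    ∀ Z ∈ (Φ.search ext a).support, Φ.ListsSolution a.1.1 Z := by
  intro Z hZ
  rw [search, PMF.mem_support_map_iff] at hZ
  obtain ⟨s, hs, rfl⟩ := hZ
  refine foldPMF_support_length (P := fun _ s => Φ.ListsSolution a.1.1 s.2.2)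
    (fun _ _ s hs s' hs' => ?_) _ _ ?_ s hs
  · exact (phase_support (fun b hb b' hb' => (trial_support hext hU hU' hb b' hb').1) hs s' hs').2.2
  · exact ⟨hU, by rw [hU']; exact (hmono _).1⟩

/-- Only phase j = k - i is used. Its N trials succeed with probability at least p each, and 1 -
(1-p)^N ≥ 1 - exp(-pN) ≥ 1 - exp(-η). -/
theorem search_hit (hmono : Φ.Monotone) {α : ℝ} {ε : ℝ}
    (hε : 0 ≤ ε)
    (hext : ∀ q, Φ.ListsSubset q.1 q.2.1 → (∀ Y ∈ (ext q).support, Φ.ListsSubset q.1 Y) ∧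
      ENNReal.ofReal ε ≤ (ext q).expect
        ({Y | Φ.IsExtension α q.1 q.2.1.toFinset q.2.2 Y.toFinset}.indicator fun _ => 1))
    {a : (List Bool × List (List Bool) × ℕ) × ℕ × ℕ} {i t n : ℕ} (hU : a.1.2.1.Nodup)
    (hU' : a.1.2.1.toFinset = Φ.U a.1.1) (hn : a.1.2.1.length = n)
    {O : Finset (List Bool)} (hO : O ∈ Φ.F a.1.1) (hiO : i ≤ O.card) (hit : i ≤ t)
    (ht : t ≤ n) (hα : (t : ℝ) ≤ α * i) (hm : 2 * (n + 1) ^ 2 ≤ 2 ^ a.1.2.2) {η : ℝ}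
    (hη : η ≤ (a.2.1 / weight a.2.1 a.2.2 a.1.2.2 (O.card - i) : ℕ) *
      (O.card.choose i * (n - O.card).choose (t - i) / (2 * (n + 1) * n.choose t) * ε)) :
    ENNReal.ofReal (1 - Real.exp (-η)) ≤ (Φ.search ext a).expect
      ({Z | (Z.length : ℝ) ≤ α * O.card}.indicator fun _ => 1) := by
  have hext₁ := fun q hq => (hext q hq).1
  set p : ℝ := O.card.choose i * (n - O.card).choose (t - i) / (2 * (n + 1) * n.choose t) * ε
    with hp
  have hp0 : 0 ≤ p := by positivity
  have hOn : O.card ≤ n := by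
    rw [← hn, ← List.toFinset_card_of_nodup hU, hU']
    exact Finset.card_le_card (Φ.subset_U _ O hO)
  have htrial : ∀ best, Φ.ListsSolution a.1.1 best → ENNReal.ofReal p ≤
      (Φ.trial ext ((a.1.1, a.1.2.1, a.1.2.2, O.card - i), best)).expect
        ({Z | (Z.length : ℝ) ≤ α * O.card}.indicator fun _ => 1) := by
    intro best hb
    rw [hp, ENNReal.ofReal_mul (by positivity), ← hn]
    exact trial_hit hmono hext hU hU' hb hO hiO hit (hn ▸ ht) hα (hn ▸ hm)
  have hUsol : Φ.ListsSolution a.1.1 a.1.2.1 := ⟨hU, by rw [hU']; exact (hmono _).1⟩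
  -- p is at most the success probability of an actual trial, started from the whole universe.
  have hp1 : p ≤ 1 := by
    rw [← ENNReal.ofReal_le_one]
    refine (htrial _ hUsol).trans ?_
    exact (PMF.expect_mono fun a _ => Set.indicator_le_self _ _ a).trans_eq (PMF.expect_const _ 1)
  rw [search, PMF.expect_map]
  refine foldPMF_hit (G := {s : ℕ × ℕ × List (List Bool) | (s.2.2.length : ℝ) ≤ α * O.card})
    (Inv := fun j s => s.1 = j ∧ s.2.1 = weight a.2.1 a.2.2 a.1.2.2 j ∧
      Φ.ListsSolution a.1.1 s.2.2) (j := O.card - i) ?_ ?_ _ 0 _ ⟨rfl, rfl, hUsol⟩ (Nat.zero_le _) ?_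
  · rintro j s b ⟨h1, h2, h3⟩ s' hs'
    obtain ⟨g1, g2, g3, g4⟩ := phase_support
      (Inv := fun b => Φ.ListsSolution a.1.1 b ∧ b.length ≤ s.2.2.length)
      (fun b hb b' hb' => by
        have := trial_support hext₁ hU hU' hb.1 b' hb'
        exact ⟨this.1, this.2.trans hb.2⟩) ⟨h3, le_rfl⟩ s' hs'
    refine ⟨⟨by rw [g1, h1], by rw [g2, h2, weight_succ], g3⟩, fun h => ?_⟩
    have g4' : (s'.2.2.length : ℝ) ≤ s.2.2.length := by exact_mod_cast g4
    exact g4'.trans h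
  · rintro ⟨j, w, best⟩ b ⟨rfl, rfl, h3⟩
    rw [phase, PMF.expect_map]
    refine le_trans (ENNReal.ofReal_le_ofReal ?_) (foldPMF_amplify
      (G := {b : List (List Bool) | (b.length : ℝ) ≤ α * O.card})
      (Inv := Φ.ListsSolution a.1.1) hp0 hp1 ?_ ?_ _ _ h3)
    · rw [List.length_replicate]
      have h1 : (1 - p) ^ (a.2.1 / weight a.2.1 a.2.2 a.1.2.2 (O.card - i)) ≤
          Real.exp (-p) ^ (a.2.1 / weight a.2.1 a.2.2 a.1.2.2 (O.card - i)) :=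
        pow_le_pow_left₀ (by linarith) (Real.one_sub_le_exp_neg p) _
      rw [← Real.exp_nat_mul] at h1
      have h2 := Real.exp_le_exp.2 (show ((a.2.1 / weight a.2.1 a.2.2 a.1.2.2 (O.card - i) : ℕ) : ℝ)
        * -p ≤ -η by linarith)
      dsimp only
      linarith
    · intro s b hs s' hs'
      have := trial_support hext₁ hU hU' hs s' hs'
      refine ⟨this.1, fun h => ?_⟩
      have g : (s'.length : ℝ) ≤ s.length := by exact_mod_cast this.2
      exact g.trans h
    · intro s b hs
      exact htrial s hs
  · rw [List.length_cons, hn]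
    omega

end ImplicitSetSystem

/-! ### Estimates for the numbers of trials -/

/-- Since y ≥ 1, x ≤ y (1 + D/(n+1)) ≤ y exp(D/(n+1)). So errors O(1/n) in the bases c and γ cost
constant factors only. -/
theorem pow_le_exp_mul_pow {x y D : ℝ} {j n : ℕ} (hx : 0 ≤ x) (hy : 1 ≤ y) (hD : 0 ≤ D)
    (hj : j ≤ n) (h : x - y ≤ D / (n + 1)) : x ^ j ≤ Real.exp D * y ^ j := by
  have hn : (0 : ℝ) < n + 1 := by positivity
  have hq : 0 ≤ D / (n + 1) := by positivity
  have h1 : x ≤ Real.exp (D / (n + 1)) * y := by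
    have := Real.add_one_le_exp (D / (n + 1))
    nlinarith
  calc x ^ j ≤ (Real.exp (D / (n + 1)) * y) ^ j := pow_le_pow_left₀ hx h1 _
    _ = Real.exp (j * (D / (n + 1))) * y ^ j := by rw [mul_pow, ← Real.exp_nat_mul]
    _ ≤ _ := by
      gcongr
      have : (j : ℝ) ≤ n + 1 := by exact_mod_cast hj.trans (Nat.le_succ n)
      calc (j : ℝ) * (D / (n + 1)) ≤ (n + 1) * (D / (n + 1)) := by gcongr
        _ = D := by field_simp

theorem one_add_log_div_le {m n : ℕ} (h : (n + 1) ^ 4 ≤ m) :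
    (1 + Real.log m) / m ≤ 2 / (n + 1) := by
  have hm : (0 : ℝ) < m := by
    have : 0 < m := lt_of_lt_of_le (by positivity) h
    exact_mod_cast this
  have hs : 0 < √(m : ℝ) := Real.sqrt_pos.2 hm
  have hsq : √(m : ℝ) * √(m : ℝ) = m := Real.mul_self_sqrt hm.le
  have h1 : Real.log m = 2 * Real.log √(m : ℝ) := by rw [Real.log_sqrt hm.le]; ring
  have h2 := Real.log_le_sub_one_of_pos hs
  have h3 : ((n : ℝ) + 1) ≤ √(m : ℝ) := by
    refine Real.le_sqrt_of_sq_le ?_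
    have h' : ((n : ℝ) + 1) ^ 4 ≤ m := by exact_mod_cast h
    have : ((n : ℝ) + 1) ^ 2 ≤ ((n : ℝ) + 1) ^ 4 :=
      pow_le_pow_right₀ (by linarith [(Nat.cast_nonneg n : (0 : ℝ) ≤ n)]) (by norm_num)
    linarith
  rw [div_le_div_iff₀ hm (by positivity)]
  have : (1 + Real.log m) * (n + 1) ≤ (2 * √(m : ℝ)) * √(m : ℝ) := by gcongr; linarith
  linarith

/-- Adding 1 compensates the rounding down, which gives the lower bound. Each of these units grows
by at most r^n, which gives n r^n in the upper bound. -/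
theorem growStep_iterate_bounds {g h : ℕ} (hh : 0 < h) (hgh : h ≤ g) (m n : ℕ) :
    (m : ℝ) * ((g : ℝ) / h) ^ n ≤ ((growStep g h)^[n] m : ℕ) ∧
      (((growStep g h)^[n] m : ℕ) : ℝ) ≤ (m + n) * ((g : ℝ) / h) ^ n := by
  have hh' : (0 : ℝ) < h := by exact_mod_cast hh
  set r : ℝ := (g : ℝ) / h with hr
  have hr1 : 1 ≤ r := by
    rw [hr, one_le_div hh']
    exact_mod_cast hgh
  have step : ∀ v : ℕ, (v : ℝ) * r ≤ growStep g h v ∧ (growStep g h v : ℝ) ≤ v * r + 1 := by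
    intro v
    have e : (v : ℝ) * r = ((v * g : ℕ) : ℝ) / h := by rw [hr]; push_cast; ring
    unfold growStep
    rw [e]
    constructor
    · push_cast [← Nat.floor_div_eq_div (K := ℝ)]
      exact (Nat.lt_floor_add_one _).le
    · push_cast
      have := Nat.cast_div_le (α := ℝ) (m := v * g) (n := h)
      push_cast at this
      linarith
  induction n with
  | zero => simp
  | succ n ih =>
    rw [Function.iterate_succ_apply']
    obtain ⟨s1, s2⟩ := step ((growStep g h)^[n] m)
    have hrn : 1 ≤ r ^ (n + 1) := one_le_pow₀ hr1
    constructor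
    · calc (m : ℝ) * r ^ (n + 1) = m * r ^ n * r := by ring
        _ ≤ ((growStep g h)^[n] m : ℕ) * r := by gcongr; exact ih.1
        _ ≤ _ := s1
    · calc _ ≤ _ := s2
        _ ≤ (m + n) * r ^ n * r + 1 := by gcongr; exact ih.2
        _ ≤ (m + (n + 1 : ℕ)) * r ^ (n + 1) := by push_cast; rw [pow_succ] at *; linarith

section
variable {V e m j n : ℕ} {c : ℝ}

theorem weight_pos (V e m j : ℕ) : 0 < weight V e m j := by
  induction j with
  | zero => exact Nat.one_pos
  | succ j ih =>
    rw [weight_succ, nextWeight]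
    split_ifs
    exacts [Nat.succ_pos _, ih]

/-- The weight grows only while it is at most V. Its unary code thus stays within a polynomial
factor of V even where c^j is much larger. -/
theorem weight_le (V e m j : ℕ) : weight V e m j ≤ V * e + 1 := by
  induction j with
  | zero => exact Nat.le_add_left _ _
  | succ j ih =>
    rw [weight_succ, nextWeight]
    split_ifs with h
    · have h1 : weight V e m j ≤ V := by
        by_contra hlt
        exact h (Nat.div_eq_of_lt (by omega))
      exact Nat.succ_le_succ ((Nat.div_le_self _ _).trans (Nat.mul_le_mul_right _ h1))
    · exact ih

/-- With y = c + 1/m ≥ e/m, each step multiplies by at most y and adds at most 1, so the weight is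
at most (j + 1) y^j. As m > n, y^j exceeds c^j by a factor exp 1 ≤ 3 at most. -/
theorem weight_upper (hc : 1 ≤ c) (hm : n < m) (he : |m * c - e| ≤ 1) (hj : j ≤ n) :
    (weight V e m j : ℝ) ≤ 3 * (n + 1) * c ^ j := by
  have hm0 : (0 : ℝ) < m := by exact_mod_cast (Nat.zero_le n).trans_lt hm
  set y : ℝ := c + 1 / m with hy
  have hy1 : 1 ≤ y := by
    have : 0 ≤ 1 / (m : ℝ) := by positivity
    linarith
  have hx : (e : ℝ) / m ≤ y := by
    rw [div_le_iff₀ hm0, hy, add_mul, one_div, inv_mul_cancel₀ hm0.ne']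
    linarith [(abs_le.1 he).1]
  have key : (weight V e m j : ℝ) ≤ (j + 1) * y ^ j := by
    clear hj
    induction j with
    | zero => simp [weight]
    | succ j ih =>
      have hyj : 1 ≤ y ^ (j + 1) := one_le_pow₀ hy1
      have h1 : ((j : ℝ) + 1) * y ^ j * y + 1 ≤ ((j + 1 : ℕ) + 1) * y ^ (j + 1) := by
        push_cast
        rw [pow_succ] at *
        linarith
      refine le_trans ?_ h1
      have h2 : (weight V e m j : ℝ) * y ≤ (j + 1) * y ^ j * y := by gcongr
      rw [weight_succ, nextWeight]
      split_ifs
      · push_cast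
        have h3 := Nat.cast_div_le (α := ℝ) (m := weight V e m j * e) (n := m)
        push_cast at h3
        have h4 : (weight V e m j : ℝ) * (e / m) ≤ weight V e m j * y := by gcongr
        rw [← mul_div_assoc] at h4
        linarith
      · have : (weight V e m j : ℝ) * 1 ≤ weight V e m j * y := by gcongr
        linarith
  have hpow := pow_le_exp_mul_pow (x := y) (y := c) (D := 1) (by linarith) hc zero_le_one hj (by
    rw [hy, add_sub_cancel_left]
    gcongr
    exact_mod_cast hm)
  have hexp : Real.exp 1 ≤ 3 := Real.exp_one_lt_three.le
  calc _ ≤ _ := key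
    _ ≤ (n + 1) * (Real.exp 1 * c ^ j) := by gcongr
    _ ≤ (n + 1) * (3 * c ^ j) := by gcongr
    _ = _ := by ring

/-- If V / w ≠ 0, the weight has never been frozen, so it is at least (e/m)^j ≥ c^j / 3. If it has
been frozen, there are no trials. -/
theorem div_weight_mul_pow_le (hc : 1 < c) (hm : n < m) (hm' : 1 ≤ m * (c - 1))
    (he : |m * c - e| ≤ 1) (hj : j ≤ n) :
    ((V / weight V e m j : ℕ) : ℝ) * c ^ j ≤ 3 * V := by
  have hm0 : (0 : ℝ) < m := by exact_mod_cast (Nat.zero_le n).trans_lt hm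
  have hx1 : 1 ≤ (e : ℝ) / m := by
    rw [one_le_div hm0]
    linarith [(abs_le.1 he).2]
  rcases Nat.eq_zero_or_pos (V / weight V e m j) with h0 | h0
  · rw [h0]
    simp
  have key : ((e : ℝ) / m) ^ j ≤ weight V e m j := by
    clear hj
    induction j with
    | zero => simp [weight]
    | succ j ih =>
      rw [weight_succ, nextWeight] at h0 ⊢
      split_ifs at h0 ⊢ with h
      · have h1 := ih (Nat.pos_of_ne_zero h)
        calc ((e : ℝ) / m) ^ (j + 1) = (e / m) ^ j * (e / m) := pow_succ _ _
          _ ≤ weight V e m j * (e / m) := by gcongr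
          _ = ((weight V e m j * e : ℕ) : ℝ) / m := by push_cast; ring
          _ ≤ _ := by
            push_cast [← Nat.floor_div_eq_div (K := ℝ)]
            exact (Nat.lt_floor_add_one _).le
      · exact absurd h0.ne' h
  have hpow := pow_le_exp_mul_pow (x := c) (y := (e : ℝ) / m) (D := 1) (by linarith) hx1
    zero_le_one hj (by
    have : c - (e : ℝ) / m ≤ 1 / m := by
      rw [sub_le_iff_le_add, ← add_div, le_div_iff₀ hm0]
      linarith [(abs_le.1 he).2]
    refine this.trans ?_
    gcongr
    exact_mod_cast hm)
  have hexp : Real.exp 1 ≤ 3 := Real.exp_one_lt_three.le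
  have hw : (0 : ℝ) < weight V e m j := by exact_mod_cast weight_pos V e m j
  calc ((V / weight V e m j : ℕ) : ℝ) * c ^ j
      ≤ (V / weight V e m j : ℝ) * (3 * weight V e m j) := by
        gcongr
        · exact Nat.cast_div_le
        · exact hpow.trans (by gcongr)
    _ = 3 * V := by field_simp

end

theorem choose_mul_choose_le (n k i t : ℕ) (hk : k ≤ n) (hit : i ≤ t) :
    k.choose i * (n - k).choose (t - i) ≤ n.choose t := by
  conv_rhs => rw [show n = k + (n - k) by omega, Nat.add_choose_eq]
  exact Finset.single_le_sum (f := fun ij : ℕ × ℕ => k.choose ij.1 * (n - k).choose ij.2)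
    (fun _ _ => Nat.zero_le _) (a := (i, t - i)) (by simp; omega)

/-- Here A = n + 1, x = γ^n, y = c^(k-i), and d/b is the probability that a uniform t-set meets O in
i points. The power A^4 in V pays for A² in `exists_good_sizes`, A in the weight and A in the
sampling. Once V ≥ w, rounding V / w down loses at most a factor 2. -/
theorem trials_lower {V w : ℕ} {A x y κ E K d b ε : ℝ} (hw0 : 0 < w) (hA : 1 ≤ A) (hx : 0 < x)
    (hκ : 0 < κ) (hE : 0 < E) (hK : 3 * E ≤ K * κ) (hb : 0 < b)
    (hdb : d ≤ b) (hε : 0 ≤ ε) (hV : K * A ^ 4 * x ≤ E * V) (hw : w ≤ 3 * A * y)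
    (hgood : κ * y * b ≤ x * A ^ 2 * d) :
    ε / 4 ≤ (V / w : ℕ) * (d / (2 * A * b) * ε) := by
  have hw0' : (0 : ℝ) < w := by exact_mod_cast hw0
  have h1 : κ * y ≤ x * A ^ 2 := by
    have : κ * y * b ≤ x * A ^ 2 * b := hgood.trans (by gcongr)
    exact le_of_mul_le_mul_right this hb
  have h2 : 3 * A ^ 4 * x ≤ κ * V := by
    have e1 : 3 * E * (A ^ 4 * x) ≤ K * κ * (A ^ 4 * x) := by gcongr
    have e2 : K * A ^ 4 * x * κ ≤ E * V * κ := by gcongr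
    refine le_of_mul_le_mul_left ?_ hE
    linarith
  have h3 : κ * w ≤ 3 * A ^ 3 * x := by
    have e1 : κ * w ≤ κ * (3 * A * y) := by gcongr
    have e2 : 3 * A * (κ * y) ≤ 3 * A * (x * A ^ 2) := by gcongr
    linarith
  have hA3 : A ^ 3 ≤ A ^ 4 := pow_le_pow_right₀ hA (by norm_num)
  have hwV : w ≤ V := by
    have : (w : ℝ) ≤ V := by
      refine le_of_mul_le_mul_left ?_ hκ
      have : 3 * A ^ 3 * x ≤ 3 * A ^ 4 * x := by gcongr
      linarith
    exact_mod_cast this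
  set N := V / w with hN
  have hN1 : 1 ≤ N := (Nat.one_le_div_iff hw0).2 hwV
  have hN2 : (V : ℝ) ≤ 2 * N * w := by
    have e1 := Nat.lt_div_mul_add hw0 (a := V)
    rw [← hN] at e1
    have : V ≤ 2 * N * w := by nlinarith
    exact_mod_cast this
  have h4 : A ^ 3 * x ≤ 2 * N * (κ * y) := by
    have e1 : κ * V ≤ κ * (2 * N * (3 * A * y)) := by
      have : 2 * N * (w : ℝ) ≤ 2 * N * (3 * A * y) := by gcongr
      gcongr
      linarith
    have : 3 * A * (A ^ 3 * x) ≤ 3 * A * (2 * N * (κ * y)) := by linarith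
    exact le_of_mul_le_mul_left this (by positivity)
  have h5 : A * b ≤ 2 * N * d := by
    have e1 : A ^ 3 * x * b ≤ 2 * N * (κ * y) * b := by gcongr
    have e2 : 2 * N * (κ * y * b) ≤ 2 * N * (x * A ^ 2 * d) := by gcongr
    have : x * A ^ 2 * (A * b) ≤ x * A ^ 2 * (2 * N * d) := by linarith
    exact le_of_mul_le_mul_left this (by positivity)
  have h6 : 1 / 4 ≤ (N : ℝ) * (d / (2 * A * b)) := by
    rw [← mul_div_assoc, div_le_div_iff₀ (by norm_num) (by positivity)]
    linarith
  calc ε / 4 = 1 / 4 * ε := by ring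
    _ ≤ N * (d / (2 * A * b)) * ε := by gcongr
    _ = _ := by ring

/-! ### Running time and conclusion -/

namespace ImplicitSetSystem
variable {Φ : ImplicitSetSystem}
  {ext : List Bool × List (List Bool) × ℕ → PMF (List (List Bool))}

/-- The balance behind the number of trials: V / w trials of cost c^j each cost at most 3 V,
whatever j is. -/
theorem phaseTime_le {c : ℝ} (hc : 1 < c) (Q : Polynomial ℕ)
    {a : (List Bool × List (List Bool) × ℕ) × ℕ × ℕ} {j n : ℕ} (hm : n < a.1.2.2)
    (hm' : 1 ≤ a.1.2.2 * (c - 1)) (he : |a.1.2.2 * c - a.2.2| ≤ 1) (hj : j ≤ n) :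
    phaseTime c Q (a, j, weight a.2.1 a.2.2 a.1.2.2 j) ≤ (a.2.1 + 1) *
      (800 + 2400 * (a.2.2 + 1) ^ 2 + 3 * (Q.eval (esize (a.1.1, a.1.2.1, a.1.2.2, n)) : ℕ)) := by
  unfold phaseTime
  dsimp only
  have h1 := div_weight_mul_pow_le (V := a.2.1) hc hm hm' he hj
  have h2 : (weight a.2.1 a.2.2 a.1.2.2 j : ℝ) ≤ a.2.1 * a.2.2 + 1 := by
    exact_mod_cast weight_le a.2.1 a.2.2 a.1.2.2 j
  have h3 : ((a.2.1 / weight a.2.1 a.2.2 a.1.2.2 j : ℕ) : ℝ) ≤ a.2.1 := by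
    exact_mod_cast Nat.div_le_self _ _
  have h4 := Q.cast_eval_mono (show esize (a.1.1, a.1.2.1, a.1.2.2, j) ≤
    esize (a.1.1, a.1.2.1, a.1.2.2, n) by simp only [esize_pair, esize_nat]; omega)
  set q : ℝ := ((Q.eval (esize (a.1.1, a.1.2.1, a.1.2.2, n)) : ℕ) : ℝ)
  set q' : ℝ := ((Q.eval (esize (a.1.1, a.1.2.1, a.1.2.2, j)) : ℕ) : ℝ)
  set N : ℝ := ((a.2.1 / weight a.2.1 a.2.2 a.1.2.2 j : ℕ) : ℝ)
  have hV : (0 : ℝ) ≤ a.2.1 := Nat.cast_nonneg _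
  have hE : (0 : ℝ) ≤ a.2.2 := Nat.cast_nonneg _
  have hq' : 0 ≤ q' := Nat.cast_nonneg _
  have hq : 0 ≤ q := Nat.cast_nonneg _
  have h5 : q' * (N * c ^ j) ≤ q * (3 * a.2.1) := by gcongr
  have h6 : ((weight a.2.1 a.2.2 a.1.2.2 j : ℝ) + 1) * (a.2.2 + 1) ≤
      (2 * ((a.2.1 + 1) * (a.2.2 + 1))) * (a.2.2 + 1) := by
    gcongr
    nlinarith
  have e : N * (q' * c ^ j + 100) = q' * (N * c ^ j) + 100 * N := by ring
  rw [e]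
  nlinarith [mul_nonneg hV hq]

/-- The running time of the whole algorithm, in terms of the number `V` of trials. -/
theorem comp_search_instance {c : ℝ} (hc : 1 < c) {Q : Polynomial ℕ}
    (hext : ∀ q, Φ.ListsSubset q.1 q.2.1 → ∀ Y ∈ (ext q).support, Φ.ListsSubset q.1 Y)
    (hQ : Comp Φ.TrialInput (Φ.trial ext)
      fun a => (Q.eval (esize a.1) : ℕ) * c ^ a.1.2.2.2)
    {U : List Bool → List (List Bool)} {m g e : List Bool → ℕ} (hU : PolyTime U)
    (hU' : ∀ I, (U I).Nodup ∧ (U I).toFinset = Φ.U I) (hm : PolyTime m) (hg : PolyTime g)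
    (he : PolyTime e) (hmn : ∀ I, (U I).length < m I) (hmc : ∀ I, 1 ≤ m I * (c - 1))
    (hgm : ∀ I, m I ^ 2 ≤ g I) (he' : ∀ I, |m I * c - e I| ≤ 1) :
    ∃ R : Polynomial ℕ, Comp (fun _ => True) (fun I => Φ.search ext
      ((I, U I, m I), (growStep (g I) (m I ^ 2))^[(U I).length] (m I), e I))
      fun I => (R.eval (esize I) : ℕ) *
        (((growStep (g I) (m I ^ 2))^[(U I).length] (m I) : ℕ) + 1) := by
  set V : List Bool → ℕ := fun I => (growStep (g I) (m I ^ 2))^[(U I).length] (m I) with hV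
  -- Only the size bound S is used; it controls all polynomial quantities at once.
  obtain ⟨S, -, hS⟩ := (PolyTime.id.pair (hU.pair (hm.pair (polyTime_length.comp hU)))).pair
    (he.pair hg)
  obtain ⟨Pa, ha, -⟩ := PolyTime.id.pair (hU.pair hm)
  obtain ⟨Pb, hb, -⟩ := (hU.pair hm).pair (hg.pair (hm.pow 2))
  obtain ⟨Pe, he₁, -⟩ := he
  have hVc := detComp_growStep_iterate.comp hb fun I _ =>
    ⟨pow_pos ((Nat.zero_le _).trans_lt (hmn I)) 2, hgm I⟩
  have hctx := ha.pair (hVc.pair he₁)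
  let τ : (List Bool × List (List Bool) × ℕ) × ℕ × ℕ → ℝ := fun a => (a.2.1 + 1) *
    (800 + 2400 * (a.2.2 + 1) ^ 2 +
      3 * (Q.eval (esize (a.1.1, a.1.2.1, a.1.2.2, a.1.2.1.length)) : ℕ))
  have hsearch := comp_search (D := fun a => ∃ I, a = ((I, U I, m I), V I, e I)) (τ := τ)
    hext hQ (by rintro _ ⟨I, rfl⟩; exact hU' I) (by
      rintro _ ⟨I, rfl⟩ j hj
      exact phaseTime_le hc Q (hmn I) (hmc I) (he' I) hj)
  refine ⟨Pa + Pb + Pe + 200 + 1300 * S * (S + 1) +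
    (S + 1) * (900 + 2400 * (S + 1) ^ 2 + 3 * Q.comp S),
    (hsearch.comp hctx fun I _ => ⟨I, rfl⟩).mono (fun _ h => h) fun I _ => ?_⟩
  have hSI : esize I + (esize (U I) + (esize (m I) + esize (U I).length + 1) + 1) + 1 +
    (esize (e I) + esize (g I) + 1) + 1 ≤ S.eval (esize I) := hS I
  have hQI := Q.cast_eval_mono (show esize (I, U I, m I, (U I).length) ≤ S.eval (esize I) by
    simp only [esize_pair] at hSI ⊢
    omega)
  simp only [esize_nat] at hSI
  have hn : ((U I).length : ℝ) ≤ (S.eval (esize I) : ℕ) := by exact_mod_cast (by omega)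
  have hgS : (g I : ℝ) ≤ (S.eval (esize I) : ℕ) := by exact_mod_cast (by omega)
  have heS : (e I : ℝ) ≤ (S.eval (esize I) : ℕ) := by exact_mod_cast (by omega)
  simp only [Polynomial.eval_add, Polynomial.eval_mul, Polynomial.eval_pow, Polynomial.eval_comp,
    Polynomial.eval_ofNat, Polynomial.eval_one]
  push_cast
  simp only [τ]
  change _ + (_ + ((U I).length * (1200 * ((V I : ℝ) + 1) * (g I + 1) + 100) + 40) + 1 + _ + 1) +
    1 + _ + 1 ≤ _ * ((V I : ℝ) + 1)
  set s : ℝ := ((S.eval (esize I) : ℕ) : ℝ)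
  set v : ℝ := (V I : ℝ)
  set qs : ℝ := ((Q.eval (S.eval (esize I)) : ℕ) : ℝ)
  set qn : ℝ := ((Q.eval (esize (I, U I, m I, (U I).length)) : ℕ) : ℝ)
  have hv : 0 ≤ v := Nat.cast_nonneg _
  have hs : 0 ≤ s := Nat.cast_nonneg _
  have pa : (0 : ℝ) ≤ (Pa.eval (esize I) : ℕ) := Nat.cast_nonneg _
  have pb : (0 : ℝ) ≤ (Pb.eval (esize I) : ℕ) := Nat.cast_nonneg _
  have pe : (0 : ℝ) ≤ (Pe.eval (esize I) : ℕ) := Nat.cast_nonneg _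
  have hqn : 0 ≤ qn := Nat.cast_nonneg _
  have b1 : (U I).length * (1200 * (v + 1) * (g I + 1) + 100) ≤
      s * (1200 * (v + 1) * (s + 1) + 100) := by gcongr
  have b2 : ((U I).length + 1) * ((v + 1) * (800 + 2400 * ((e I : ℝ) + 1) ^ 2 + 3 * qn) + 50) ≤
      (s + 1) * ((v + 1) * (800 + 2400 * (s + 1) ^ 2 + 3 * qs) + 50) := by gcongr
  have b3 : (Pa.eval (esize I) + Pb.eval (esize I) + Pe.eval (esize I) + 200 : ℝ) * 1 ≤
      (Pa.eval (esize I) + Pb.eval (esize I) + Pe.eval (esize I) + 200) * (v + 1) := by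
    gcongr
    linarith
  have b4 : s * 100 * 1 ≤ s * 100 * ((s + 1) * (v + 1)) := by
    gcongr
    nlinarith
  have b5 : (s + 1) * 50 * 1 ≤ (s + 1) * 50 * (v + 1) := by
    gcongr
    linarith
  have b6 : 0 ≤ (s + 1) * (v + 1) := by positivity
  linarith

theorem hasRandomizedApproximationAlgorithm_of_comp {α γ : ℝ}
    {f : List Bool → PMF (List (List Bool))} {R : Polynomial ℕ}
    (hf : Comp (fun _ => True) f fun I => (R.eval (esize I) : ℕ) * γ ^ (Φ.U I).card)
    (hsol : ∀ I, ∀ Z ∈ (f I).support, Φ.ListsSolution I Z) {ε : ℝ≥0∞} (hε : 0 < ε)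
    (hgood : ∀ I O, Φ.IsOptimal I O →
      ε ≤ (f I).expect ({Z | (Z.length : ℝ) ≤ α * O.card}.indicator fun _ => 1))
    (hmono : Φ.Monotone) : Φ.HasRandomizedApproximationAlgorithm α γ := by
  obtain ⟨p, hp⟩ := hf
  refine ⟨p, R, ε, hε, fun I => ?_⟩
  obtain ⟨μ, hμ, hμf⟩ := hp I trivial
  refine ⟨μ, hμ, fun o ho => ?_, ?_⟩
  · have h1 : o.1 ∈ (μ.map Prod.fst).support := (PMF.mem_support_map_iff _ _ _).2 ⟨o, ho, rfl⟩
    rw [hμf, PMF.mem_support_map_iff] at h1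
    obtain ⟨Z, hZ, hZo⟩ := h1
    have hs := hsol I Z hZ
    exact ⟨Z.toFinset, hs.2, hZo ▸ hs.listsSubset.isCode⟩
  -- The universe is a solution, so an optimal one exists; comparison with a single optimum suffices
  -- since all have the same cardinality.
  · obtain ⟨O, hO, hOmin⟩ := (measure Finset.card).wf.has_min (Φ.F I) ⟨_, (hmono I).1⟩
    have hOpt : Φ.IsOptimal I O := ⟨hO, fun T hT => not_lt.1 (hOmin T hT)⟩
    refine (hgood I O hOpt).trans ?_
    set W : Set Data := {d | ∃ S ∈ Φ.F I, d.IsCode S ∧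
      ∀ OPT, Φ.IsOptimal I OPT → (S.card : ℝ) ≤ α * OPT.card} with hW
    have h1 : μ.toOuterMeasure {o | ∃ S ∈ Φ.F I, o.1.IsCode S ∧
        ∀ OPT, Φ.IsOptimal I OPT → (S.card : ℝ) ≤ α * OPT.card} =
        (f I).expect fun Z => W.indicator (fun _ => 1) (enc Z) := by
      rw [PMF.toOuterMeasure_eq_expect, ← PMF.expect_map _ enc, ← hμf, PMF.expect_map]
      rfl
    rw [h1]
    refine PMF.expect_mono fun Z hZ => ?_
    by_cases hZW : Z ∈ {Z : List (List Bool) | (Z.length : ℝ) ≤ α * O.card}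
    swap
    · rw [Set.indicator_of_notMem hZW]
      exact zero_le
    rw [Set.indicator_of_mem hZW, Set.indicator_of_mem]
    have hs := hsol I Z hZ
    refine ⟨Z.toFinset, hs.2, hs.listsSubset.isCode, fun OPT hOPT => ?_⟩
    rw [List.toFinset_card_of_nodup hs.1,
      le_antisymm (hOPT.2 O hO) (hOpt.2 OPT hOPT.1)]
    exact hZW

end ImplicitSetSystem

theorem IsAmls.logGap_sub {α c γ : ℝ} (hα : 1 ≤ α) (hc : 1 < c) (h : IsAmls α c γ) :
    0 < (γ - 1) / (c - 1) ∧ (γ - 1) / (c - 1) < 1 / α ∧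
      logGap α (1 / α) - logGap α ((γ - 1) / (c - 1)) = Real.log c := by
  obtain ⟨⟨h1, h2⟩, h3⟩ := h
  have hα0 : 0 < α := by linarith
  have hc0 : 0 < c - 1 := by linarith
  have p1 : 0 < (γ - 1) / (c - 1) := div_pos (by linarith) hc0
  have p2 : (γ - 1) / (c - 1) < 1 / α := by
    rw [div_lt_iff₀ hc0, one_div_mul_eq_div]
    linarith
  refine ⟨p1, p2, ?_⟩
  rw [← mul_bernoulliKL hα p1 p2, h3]
  field_simp

namespace ImplicitSetSystem
variable {Φ : ImplicitSetSystem}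

theorem HasRandomizedExtensionAlgorithm.hasRandomizedApproximationAlgorithm {α c γ : ℝ}
    (hext : Φ.HasRandomizedExtensionAlgorithm α c) (hmono : Φ.Monotone)
    (hpoly : Φ.PolyTimeComputable) (hα : 1 ≤ α) (hc : 1 < c)
    (hα' : PolyApproximable α) (hc' : PolyApproximable c) (hγ : IsAmls α c γ) :
    Φ.HasRandomizedApproximationAlgorithm α γ := by
  obtain ⟨hδ, hδ1, heq⟩ := hγ.logGap_sub hα hc
  have hγ1 : 1 < γ := hγ.1.1
  set δ := (γ - 1) / (c - 1) with hδdef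
  have hγδ : 1 + δ * (c - 1) = γ := by
    rw [hδdef, div_mul_cancel₀ _ (by linarith)]
    ring
  obtain ⟨C, hC, hbase⟩ := baseNum_approx hα hc hδ hδ1 heq
  obtain ⟨κ, hκ, hsizes⟩ := exists_good_sizes hα hc hδ hδ1 heq
  rw [hγδ] at hbase hsizes
  obtain ⟨an, han, han'⟩ := hα'.exists_polyTime
  obtain ⟨en, hen, hen'⟩ := hc'.exists_polyTime
  obtain ⟨U, hU, hU'⟩ := hpoly.exists_universe
  obtain ⟨ext, P, ε₀, hε₀, hcomp, hext'⟩ := hext.exists_comp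
  have hext₁ := fun q hq => (hext' q hq).1
  obtain ⟨Q, hQ⟩ := exists_comp_trial hc.le hpoly hcomp hext₁
  set D : ℝ := 2 * C with hD
  set E : ℝ := Real.exp D with hE
  -- K ≥ 1/(c-1) ensures that the approximation e/m of c is at least 1, and K ≥ 3E/κ absorbs the
  -- constants in `trials_lower`.
  obtain ⟨K, hK⟩ := exists_nat_ge (max (max 1 (1 / (c - 1))) (3 * E / κ))
  have hK1 : 1 ≤ K := by exact_mod_cast (le_max_left 1 _).trans ((le_max_left _ _).trans hK)
  have hKc : 1 ≤ K * (c - 1) := by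
    have := (le_max_right _ (1 / (c - 1))).trans ((le_max_left _ _).trans hK)
    rwa [div_le_iff₀ (by linarith)] at this
  have hKκ : 3 * E ≤ K * κ := by
    have := (le_max_right _ _).trans hK
    rwa [div_le_iff₀ hκ] at this
  set n : List Bool → ℕ := fun I => (U I).length with hn
  -- m is at once the common denominator, the number of coins for the bias and the initial value of
  -- V; the last role needs the fourth power.
  set m : List Bool → ℕ := fun I => K * (n I + 1) ^ 4 with hm
  set e : List Bool → ℕ := fun I => en (m I) with he
  set g : List Bool → ℕ := fun I => baseNum (m I) (an (m I)) (e I) with hg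
  have hncard : ∀ I, n I = (Φ.U I).card := fun I => by
    rw [← (hU' I).2, List.toFinset_card_of_nodup (hU' I).1]
  have hnP : PolyTime n := polyTime_length.comp hU
  have hmP : PolyTime m := (PolyTime.natConst K).mul ((polyTime_succ.comp hnP).pow 4)
  have heP : PolyTime e := hen.comp hmP
  have hgP : PolyTime g := hmP.baseNum (han.comp hmP) heP
  have hm4 : ∀ I, (n I + 1) ^ 4 ≤ m I := fun I => Nat.le_mul_of_pos_left _ hK1
  have hmn : ∀ I, n I < m I := fun I =>
    lt_of_lt_of_le (Nat.lt_succ_self _) ((Nat.le_self_pow (by norm_num) _).trans (hm4 I))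
  have hm0 : ∀ I, 0 < m I := fun I => (Nat.zero_le _).trans_lt (hmn I)
  have hmc : ∀ I, (1 : ℝ) ≤ m I * (c - 1) := fun I => by
    have h1 : (K : ℝ) ≤ m I := by
      exact_mod_cast Nat.le_mul_of_pos_right K (by positivity)
    exact hKc.trans (mul_le_mul_of_nonneg_right h1 (by linarith))
  have hgm : ∀ I, m I ^ 2 ≤ g I := fun I => Nat.le_add_right _ _
  set V : List Bool → ℕ := fun I => (growStep (g I) (m I ^ 2))^[n I] (m I) with hV
  have happrox : ∀ I, |(g I : ℝ) / (m I ^ 2 : ℕ) - γ| ≤ D / (n I + 1) := fun I => by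
    push_cast
    refine (hbase (m I) (an (m I)) (e I) (hm0 I) (han' _) (hen' _)).trans ?_
    calc _ ≤ C * (2 / (n I + 1)) := mul_le_mul_of_nonneg_left (one_add_log_div_le (hm4 I)) hC
      _ = D / (n I + 1) := by rw [hD]; ring
  have hr1 : ∀ I, 1 ≤ (g I : ℝ) / (m I ^ 2 : ℕ) := fun I => by
    rw [one_le_div (by exact_mod_cast pow_pos (hm0 I) 2)]
    exact_mod_cast hgm I
  have hVb := fun I => growStep_iterate_bounds (pow_pos (hm0 I) 2) (hgm I) (m I) (n I)
  have hD0 : 0 ≤ D := by positivity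
  have hVlow : ∀ I, (K : ℝ) * (n I + 1) ^ 4 * γ ^ n I ≤ E * V I := fun I => by
    have h1 := pow_le_exp_mul_pow (x := γ) (by linarith) (hr1 I) hD0 le_rfl (n := n I)
      (by linarith [(abs_le.1 (happrox I)).1])
    have h2 : (m I : ℝ) = K * (n I + 1) ^ 4 := by simp [hm]
    rw [← h2]
    calc (m I : ℝ) * γ ^ n I ≤ m I * (E * ((g I : ℝ) / (m I ^ 2 : ℕ)) ^ n I) := by gcongr
      _ = E * (m I * ((g I : ℝ) / (m I ^ 2 : ℕ)) ^ n I) := by ring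
      _ ≤ _ := by
        gcongr
        exact (hVb I).1
  obtain ⟨R, hR⟩ := comp_search_instance hc hext₁ hQ hU hU' hmP hgP heP hmn hmc hgm
    fun I => hen' _
  obtain ⟨S, -, hS⟩ := hmP.add (hnP.add (PolyTime.natConst 1))
  obtain ⟨L, hL⟩ := exists_nat_ge E
  have htime : Comp (fun _ => True)
      (fun I => Φ.search ext ((I, U I, m I), V I, e I))
      fun I => ((R * (Polynomial.C L * S)).eval (esize I) : ℕ) * γ ^ (Φ.U I).card := by
    refine hR.mono (fun _ h => h) fun I _ => ?_
    rw [← hncard]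
    have hγn : 1 ≤ γ ^ n I := one_le_pow₀ hγ1.le
    have h1 := pow_le_exp_mul_pow (x := (g I : ℝ) / (m I ^ 2 : ℕ)) (by linarith [hr1 I]) hγ1.le hD0 le_rfl (n := n I)
      (by linarith [(abs_le.1 (happrox I)).2])
    have h2 : (m I + (n I + 1) : ℝ) ≤ (S.eval (esize I) : ℕ) := by
      have : esize (m I + (n I + 1)) ≤ S.eval (esize I) := hS I
      rw [esize_nat] at this
      exact_mod_cast (by omega)
    have hE1 : 1 ≤ E := Real.one_le_exp hD0
    have h3 : (V I : ℝ) + 1 ≤ (m I + (n I + 1)) * (E * γ ^ n I) := by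
      have h4 : (V I : ℝ) ≤ (m I + n I) * (E * γ ^ n I) :=
        (hVb I).2.trans (by gcongr)
      have h5 : 1 ≤ E * γ ^ n I := one_le_mul_of_one_le_of_one_le hE1 hγn
      linarith
    simp only [Polynomial.eval_mul, Polynomial.eval_C]
    push_cast
    calc ((R.eval (esize I) : ℕ) : ℝ) * ((V I : ℝ) + 1)
        ≤ (R.eval (esize I) : ℕ) * ((S.eval (esize I) : ℕ) * (L * γ ^ n I)) := by
          gcongr
          exact h3.trans (by gcongr)
      _ = _ := by ring
  -- The minimum with 1 makes the success probability finite, so that it can be treated as a real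
  -- number.
  set ε : ℝ := (min ε₀ 1).toReal with hε
  have hmin : min ε₀ 1 ≠ ⊤ := ((min_le_right _ _).trans_lt ENNReal.one_lt_top).ne
  have hεpos : 0 < ε := ENNReal.toReal_pos (lt_min hε₀ one_pos).ne' hmin
  have hext₂ : ∀ q, Φ.ListsSubset q.1 q.2.1 → (∀ Y ∈ (ext q).support, Φ.ListsSubset q.1 Y) ∧
      ENNReal.ofReal ε ≤ (ext q).expect
        ({Y | Φ.IsExtension α q.1 q.2.1.toFinset q.2.2 Y.toFinset}.indicator fun _ => 1) := by
    intro q hq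
    refine ⟨hext₁ q hq, le_trans ?_ (hext' q hq).2⟩
    rw [hε, ENNReal.ofReal_toReal hmin]
    exact min_le_left _ _
  have hsol : ∀ I, ∀ Z ∈ (Φ.search ext ((I, U I, m I), V I, e I)).support,
      Φ.ListsSolution I Z := fun I =>
    search_support hext₁ hmono (a := ((I, U I, m I), V I, e I)) (hU' I).1 (hU' I).2
  refine hasRandomizedApproximationAlgorithm_of_comp htime hsol
    (ε := ENNReal.ofReal (1 - Real.exp (-(ε / 4)))) ?_ ?_ hmono
  · rw [ENNReal.ofReal_pos, sub_pos, Real.exp_lt_one_iff]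
    linarith
  intro I O hO
  -- If n < α |O|, every solution is within the factor α, and the search always returns a solution.
  rcases lt_or_ge (n I : ℝ) (α * O.card) with hlt | hle
  · rw [PMF.expect_indicator_of_support]
    · rw [ENNReal.ofReal_le_one]
      linarith [Real.exp_pos (-(ε / 4))]
    · intro Z hZ
      have hs := hsol I Z hZ
      have h1 : Z.length ≤ n I := by
        rw [hncard, ← List.toFinset_card_of_nodup hs.1]
        exact Finset.card_le_card hs.listsSubset.2
      have h2 : (Z.length : ℝ) ≤ n I := by exact_mod_cast h1
      exact h2.trans hlt.le
  · obtain ⟨i, t, hik, hit, htα, htk, hgood⟩ := hsizes (n I) O.card hle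
    have hOn : O.card ≤ n I := by
      rw [hncard]
      exact Finset.card_le_card (Φ.subset_U I O hO.1)
    have htn : t ≤ n I := by omega
    refine search_hit hmono hεpos.le hext₂ (a := ((I, U I, m I), V I, e I)) (hU' I).1 (hU' I).2
      rfl hO.1 hik hit htn htα ?_ ?_
    · have h1 := hm4 I
      have h2 : m I < 2 ^ m I := Nat.lt_two_pow_self
      have h3 : 2 * (n I + 1) ^ 2 ≤ (n I + 1) ^ 4 + 1 := by
        zify
        nlinarith [sq_nonneg (((n I : ℤ) + 1) ^ 2 - 1)]
      change 2 * (n I + 1) ^ 2 ≤ 2 ^ m I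
      omega
    · have hn0 : (0 : ℝ) ≤ n I := Nat.cast_nonneg _
      refine trials_lower (A := (n I : ℝ) + 1) (x := γ ^ n I) (y := c ^ (O.card - i)) (E := E)
        (b := (n I).choose t) (weight_pos _ _ _ _) (by linarith)
        (by positivity) hκ (Real.exp_pos _) hKκ (by exact_mod_cast Nat.choose_pos htn) ?_ hεpos.le
        (hVlow I) (weight_upper hc.le (hmn I) (hen' _) (by omega)) hgood
      exact_mod_cast choose_mul_choose_le (n I) O.card i t hOn hit

end ImplicitSetSystem

theorem theorem1 (Φ : ImplicitSetSystem) (hmono : Φ.Monotone) (hpoly : Φ.PolyTimeComputable)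
    (α c : ℝ) (hα : 1 ≤ α) (hc : 1 < c)
    (hα' : PolyApproximable α) (hc' : PolyApproximable c)
    (hext : Φ.HasRandomizedExtensionAlgorithm α c) :
    (∃! γ : ℝ, IsAmls α c γ) ∧
      ∀ γ : ℝ, IsAmls α c γ → Φ.HasRandomizedApproximationAlgorithm α γ :=
  ⟨existsUnique_isAmls hα hc, fun _ hγ =>
    hext.hasRandomizedApproximationAlgorithm hmono hpoly hα hc hα' hc' hγ⟩
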